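/- Let $M$ be a connected smooth $4$-manifold and $F\colon M\to\mathbb R^{4+r}$ a smooth immersion, with tangent spaces $T_pM$, normal spaces $N_p$ and second fundamental form $\mathrm{II}_p(X,Y)=\pi_N\nabla_XY$. For $\nu\in N_p$ put $\mathrm{II}_\nu=\nu\cdot\mathrm{II}_p$, and let $|\mathrm{II}_p|=\{\mathrm{II}_\nu:\nu\in N_p\}$. Suppose that $F$ is austere, that is, for every normal vector $\nu$ the eigenvalues of $\mathrm{II}_\nu$ with respect to the induced metric, counted with multiplicity, are symmetric about $0$. Suppose further that $F$ is of type C with constant parameters: there are constants $\lambda_1\ge\lambda_2\ge 0\ge\lambda_3$ with $\lambda_1\lambda_2\lambda_3+\lambda_1+\lambda_2+\lambda_3=0$ such that at every point $p\in M$, with respect to some orthonormal basis of $T_pM$, the matrices of the forms in $|\mathrm{II}_p|$ all belong to $$\mathcal Q_C=\left\{\begin{bmatrix}0&x_1&x_2&x_3\\ x_1&0&\lambda_3x_3&\lambda_2x_2\\ x_2&\lambda_3x_3&0&\lambda_1x_1\\ x_3&\lambda_2x_2&\lambda_1x_1&0\end{bmatrix}: x_1,x_2,x_3\in\mathbb R\right\}.$$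 Suppose finally that $F$ has normal rank $\delta=3$, that is, at every point the first normal space $\operatorname{span}\{\mathrm{II}_p(X,Y):X,Y\in T_pM\}$ has dimension $3$. Then $\lambda_1=\lambda_2=\lambda_3=0$, and $M$ is an open subset of a generalized helicoid in a $7$-dimensional affine subspace: there are constants $\mu_1,\mu_2,\mu_3>0$ and an isometric affine embedding $\Phi\colon\mathbb R^7\to\mathbb R^{4+r}$ such that $F$ maps $M$ into $\Phi(H_\mu)$, and maps every open subset of $M$ onto a relatively open subset of $\Phi(H_\mu)$, where $H_\mu\subset\mathbb R^7$ is the image of $$(x_0,x_1,x_2,x_3)\mapsto(x_0,\;x_1\cos(\mu_1x_0),\;x_1\sin(\mu_1x_0),\;x_2\cos(\mu_2x_0),\;x_2\sin(\mu_2x_0),\;x_3\cos(\mu_3x_0),\;x_3\sin(\mu_3x_0)).$$ -/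

import Mathlib

open scoped Manifold ContDiff

noncomputable section

namespace Austere

/-- Euclidean space `ℝⁿ`. -/
abbrev E (n : ℕ) := EuclideanSpace ℝ (Fin n)

section Immersed

variable {M : Type*} [TopologicalSpace M] [ChartedSpace (E 4) M] {n : ℕ}

/-- The differential of `F : M → ℝⁿ` at `p`. The tangent space of `M` at `p` is Mathlib's
`TangentSpace`, which is the model space `ℝ⁴`, through the preferred chart at `p`. -/
def differential (F : M → E n) (p : M) : E 4 →L[ℝ] E n :=
  mfderiv 𝓘(ℝ, E 4) 𝓘(ℝ, E n) F p

/-- A smooth immersion of the 4-manifold `M` into `ℝⁿ`. -/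
structure IsImmersed (F : M → E n) : Prop where
  smooth : ContMDiff 𝓘(ℝ, E 4) 𝓘(ℝ, E n) ∞ F
  injective : ∀ p, Function.Injective (differential F p)

/-- The tangent plane of the immersed submanifold at `p`, as a linear subspace of `ℝⁿ`. -/
def tangentPlane (F : M → E n) (p : M) : Submodule ℝ (E n) :=
  LinearMap.range (differential F p).toLinearMap

/-- The normal space of the immersed submanifold at `p`. -/
def normalSpace (F : M → E n) (p : M) : Submodule ℝ (E n) :=
  (tangentPlane F p)ᗮ

/-- The immersion read in the preferred chart at `p`. -/
def localRep (F : M → E n) (p : M) : E 4 → E n :=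
  F ∘ (extChartAt 𝓘(ℝ, E 4) p).symm

/-- The second fundamental form `II(v, w) = π_N (∇_v w)` at `p`: here `w` is extended to the
vector field that is constant in the preferred chart at `p`, so that `∇_v w` is the second
derivative of the immersion in this chart. -/
def secondFundamentalForm (F : M → E n) (p : M) (v w : E 4) : E n :=
  (normalSpace F p).starProjection
    (fderiv ℝ (fderiv ℝ (localRep F p)) (extChartAt 𝓘(ℝ, E 4) p p) v w)

/-- The first normal space at `p`: the span of the values of the second fundamental form. -/
def firstNormalSpace (F : M → E n) (p : M) : Submodule ℝ (E n) :=
  Submodule.span ℝ {x | ∃ v w : E 4, secondFundamentalForm F p v w = x}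

/-- The normal rank `δ(p)`. -/
def normalRank (F : M → E n) (p : M) : ℕ :=
  Module.finrank ℝ (firstNormalSpace F p)

/-- `e` is an orthonormal basis of the tangent space at `p` for the induced metric. -/
def IsTangentFrame (F : M → E n) (p : M) (e : Fin 4 → E 4) : Prop :=
  Orthonormal ℝ fun i => differential F p (e i)

/-- The matrix of the quadratic form `II_ν = ν · II` with respect to `e`. -/
def secondFormMatrix (F : M → E n) (p : M) (e : Fin 4 → E 4) (ν : E n) :
    Matrix (Fin 4) (Fin 4) ℝ :=
  Matrix.of fun i j => inner ℝ ν (secondFundamentalForm F p (e i) (e j))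

/-- `F` is austere: for every normal vector `ν`, the eigenvalues of `II_ν` with respect to the
metric, counted with multiplicity, are symmetric about zero. -/
def IsAustere (F : M → E n) : Prop :=
  ∀ p, ∀ ν ∈ normalSpace F p, ∀ e, IsTangentFrame F p e →
    (secondFormMatrix F p e ν).charpoly.roots.map (fun t => -t) =
      (secondFormMatrix F p e ν).charpoly.roots

/-- The matrix with coordinates `x₁, x₂, x₃` in the austere subspace `𝒬_C` with parameters
`λ₁, λ₂, λ₃`. -/
def matC (l x : Fin 3 → ℝ) : Matrix (Fin 4) (Fin 4) ℝ :=
  !![0,   x 0,       x 1,       x 2;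
     x 0, 0,         l 2 * x 2, l 1 * x 1;
     x 1, l 2 * x 2, 0,         l 0 * x 0;
     x 2, l 1 * x 1, l 0 * x 0, 0]

/-- The conditions on the parameters of `𝒬_C`. -/
def IsParamC (l : Fin 3 → ℝ) : Prop :=
  l 0 ≥ l 1 ∧ l 1 ≥ 0 ∧ 0 ≥ l 2 ∧ l 0 * l 1 * l 2 + l 0 + l 1 + l 2 = 0

/-- `F` is an austere 4-fold of type C with parameters `l p` at `p`: at every point, in some
orthonormal basis of the tangent space, the space `|II_p|` of all forms `II_ν`, with `ν` normal
at `p`, becomes a subspace of `𝒬_C`. -/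
structure IsTypeC (F : M → E n) (l : M → Fin 3 → ℝ) : Prop where
  austere : IsAustere F
  param : ∀ p, IsParamC (l p)
  conj : ∀ p, ∃ e, IsTangentFrame F p e ∧
    ∀ ν ∈ normalSpace F p, secondFormMatrix F p e ν ∈ Set.range (matC (l p))

end Immersed

/-- The generalized helicoid of dimension four in `ℝ⁷` with constants `μ₁, μ₂, μ₃`. -/
def generalizedHelicoid (μ : Fin 3 → ℝ) : Set (E 7) :=
  Set.range fun x : Fin 4 → ℝ =>
    !₂[x 0,
       x 1 * Real.cos (μ 0 * x 0), x 1 * Real.sin (μ 0 * x 0),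
       x 2 * Real.cos (μ 1 * x 0), x 2 * Real.sin (μ 1 * x 0),
       x 3 * Real.cos (μ 2 * x 0), x 3 * Real.sin (μ 2 * x 0)]

end Austere

end

/-! Near each point there is an orthonormal frame e₀,…,e₃ in which the second fundamental form II
has its normal form. The normals νₖ = II(e₀, eₖ₊₁) are independent because the rank is three. Such a
frame can be chosen smoothly: among the rotations that carry a smooth orthonormal frame to an
adapted one, those of maximal trace lie in a slice transversal to the stabilizer of 𝒬_C, and in this
slice the admissible rotations form a smooth graph (`exists_smooth_rotation`). The first normal
bundle turns out to be parallel. Since the parameters are constant, the Codazzi equations are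
therefore linear equations for the tangential connection coefficients w and the normal ones t, with
constant coefficients.

The parameters vanish. If no parameter and no 1 + λᵢλⱼ is zero, Codazzi forces w = 0, and a flat
metric contradicts Gauss. For (r, 0, -r) with r ≠ 0 and r² ≠ 1, enough of w vanishes for one Gauss
equation to fail. Up to exchanging two frame vectors, the other nonzero case is (1, L, -1) with L ≥
0. There the metric is Kähler and Codazzi leaves a few functions a, p free. If L ≠ 0, 1, the Gauss
equations write the Gram matrix G of the normals as a quadratic expression in a. Comparing its
derivatives with those given by the normal connection overdetermines the derivatives of a
(`kahler_elimination`) and makes ν₂ vanish. L = 1 fails algebraically. L = 0 has additional freedom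
and is excluded by differentiating the identities for G (`KahlerSystem.false_of_degenerate`).

The helicoid. For λ = 0 one has II(eᵢ, eⱼ) = 0 for i, j ≥ 1, and Codazzi makes e₁, e₂, e₃ tangent to
pieces of affine 3-planes, the leaves. Let P be the projection onto the leaf directions, D₀ the
derivative along e₀ and A = [D₀P, P] the infinitesimal rotation of the leaves. Then A and e₀ - A f
are constant along e₀ and are rescaled by a common factor along the leaves. Hence e₀ = ρ(B f + b)
with constant skew B and constant b: one screw motion carries the leaves into each other. All leaves
meet its axis, and an orthonormal basis of one leaf that diagonalizes B² gives the constants μᵢ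
(`AdaptedFrame.range_subset_helicoid`).

Globally, a helicoid is an analytic embedded copy of ℝ⁴ with an analytic retraction, so local
helicoids agree by unique continuation on the connected manifold M, and invariance of dimension at
the level of differentials makes F open onto the helicoid. -/

noncomputable section

/-! ### The Codazzi equations as linear algebra: generic parameters -/

namespace Austere

section
/-- The coefficient of the `j`-th normal vector in the second fundamental form of type C. -/
def coefC (l : Fin 3 → ℝ) (j : Fin 3) (a b : Fin 4) : ℝ := matC l (Pi.single j 1) a b

/-- The Codazzi equations at a point for connection coefficients `w` of an orthonormal tangent
frame and `t` of a frame of the first normal space. -/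
structure Codazzi (l : Fin 3 → ℝ) (w : Fin 4 → Fin 4 → Fin 4 → ℝ) (t : Fin 4 → Fin 3 → Fin 3 → ℝ) :
    Prop where
  skew : ∀ c a b, w c a b = - w c b a
  eq : ∀ a b c j,
    ∑ i, coefC l i a b * t c j i - ∑ d, w c d a * coefC l j d b - ∑ d, w c d b * coefC l j a d =
    ∑ i, coefC l i c b * t a j i - ∑ d, w a d c * coefC l j d b - ∑ d, w a d b * coefC l j c d

theorem coefC_eq (l : Fin 3 → ℝ) (j : Fin 3) :
    coefC l j = ![!![0, 1, 0, 0; 1, 0, 0, 0; 0, 0, 0, l 0; 0, 0, l 0, 0],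
      !![0, 0, 1, 0; 0, 0, 0, l 1; 1, 0, 0, 0; 0, l 1, 0, 0],
      !![0, 0, 0, 1; 0, 0, l 2, 0; 0, l 2, 0, 0; 1, 0, 0, 0]] j := by
  ext a b
  fin_cases j <;> fin_cases a <;> fin_cases b <;> simp [coefC, matC]

/-- This is what remains of a block once the normal coefficients are eliminated: six homogeneous
linear equations in six unknowns. The system is invariant under cyclic shifts of the indices, so one
pair of unknowns is enough. -/
theorem block_reduced (q1 q2 q3 A1 A2 A3 B1 B2 B3 : ℝ) (hq : q1 * q2 * q3 + q1 + q2 + q3 = 0)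
    (h1 : q1 ≠ 0) (h2 : q2 ≠ 0) (h3 : q3 ≠ 0)
    (n1 : 1 + q2 * q3 ≠ 0) (n2 : 1 + q1 * q3 ≠ 0) (n3 : 1 + q1 * q2 ≠ 0)
    (e1 : (1 + q2 * q3) * (A1 - q1 * B1) = 2 * q3 * (q2 * A3 - B3))
    (e2 : (1 + q3 * q1) * (A2 - q2 * B2) = 2 * q1 * (q3 * A1 - B1))
    (e3 : (1 + q1 * q2) * (A3 - q3 * B3) = 2 * q2 * (q1 * A2 - B2))
    (f1 : (1 + q2 * q3) * (A1 + q1 * B1) = 2 * q2 * (q3 * A2 + B2))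
    (f2 : (1 + q3 * q1) * (A2 + q2 * B2) = 2 * q3 * (q1 * A3 + B3))
    (f3 : (1 + q1 * q2) * (A3 + q3 * B3) = 2 * q1 * (q2 * A1 + B1)) : A1 = 0 ∧ B1 = 0 := by
  have a1 : A1 = 0 := by grind
  subst a1
  refine ⟨rfl, ?_⟩
  grind

/-- Vanishing of one homogeneous block of the connection coefficients. -/
theorem block_vanish (P R A B t : Fin 3 → ℝ) (T U : Fin 3 → ℝ)
    (hq : R 0 * R 1 * R 2 + R 0 * P 1 * P 2 + P 0 * R 1 * P 2 + P 0 * P 1 * R 2 = 0)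
    (hP : ∀ i, P i ≠ 0) (hR : ∀ i, R i ≠ 0)
    (hn : ∀ i, P (i + 1) * P (i + 2) + R (i + 1) * R (i + 2) ≠ 0)
    (ht : ∀ i, P i * (t i - 2 * A i) = 0)
    (e : ∀ i, R (i + 1) * T i = P (i + 2) * A i + R (i + 2) * (B i + 2 * B (i + 2)))
    (e' : ∀ i, R (i + 2) * t (i + 2) = P (i + 1) * T i + R (i + 2) * A i + P (i + 2) * B i)
    (f : ∀ i, R (i + 2) * U i = P (i + 1) * A i - R (i + 1) * (B i + 2 * B (i + 1)))
    (f' : ∀ i, R (i + 1) * t (i + 1) = P (i + 2) * U i + R (i + 1) * A i - P (i + 1) * B i) :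
    ∀ i, A i = 0 ∧ B i = 0 := by
  have ht' : ∀ i, t i = 2 * A i := fun i => by
    have := (mul_eq_zero.1 (ht i)).resolve_left (hP i); linarith
  have hRq : ∀ i, R i = R i / P i * P i := fun i => by rw [div_mul_cancel₀ _ (hP i)]
  -- Only the ratios of the two entries of each normal matter; they satisfy the same cubic relation
  -- as the parameters.
  set q : Fin 3 → ℝ := fun i => R i / P i with hqd
  have hR' : ∀ i, R i = q i * P i := hRq
  -- `e` and `e'` share the unknown T, `f` and `f'` share U; eliminating these leaves equations in A
  -- and B alone.
  have k : ∀ i, (1 + q (i + 1) * q (i + 2)) * A i + (q (i + 1) + q (i + 2)) * B i =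
      2 * q (i + 2) * (q (i + 1) * A (i + 2) - B (i + 2)) := fun i => by
    have h1 := e i
    have h2 := e' i
    rw [ht', hR'] at h2
    rw [hR', hR'] at h1
    have := hP (i + 1)
    have := hP (i + 2)
    apply mul_left_cancel₀ (mul_ne_zero (hP (i + 1)) (hP (i + 2)))
    linear_combination (-P (i + 1)) * h1 - q (i + 1) * P (i + 1) * h2
  have k' : ∀ i, (1 + q (i + 1) * q (i + 2)) * A i - (q (i + 1) + q (i + 2)) * B i =
      2 * q (i + 1) * (q (i + 2) * A (i + 1) + B (i + 1)) := fun i => by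
    have h1 := f i
    have h2 := f' i
    rw [ht', hR'] at h2
    rw [hR', hR'] at h1
    apply mul_left_cancel₀ (mul_ne_zero (hP (i + 1)) (hP (i + 2)))
    linear_combination (-P (i + 2)) * h1 - q (i + 2) * P (i + 2) * h2
  have hq' : q 0 * q 1 * q 2 + q 0 + q 1 + q 2 = 0 := by
    apply mul_left_cancel₀ (mul_ne_zero (mul_ne_zero (hP 0) (hP 1)) (hP 2))
    rw [hR' 0, hR' 1, hR' 2] at hq
    linear_combination hq
  have hq0 : ∀ i, q i ≠ 0 := fun i => div_ne_zero (hR i) (hP i)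
  have hn' : ∀ i, 1 + q (i + 1) * q (i + 2) ≠ 0 := fun i h => hn i (by
    rw [hR' (i + 1), hR' (i + 2)]; linear_combination P (i + 1) * P (i + 2) * h)
  -- The cubic relation in product form. It turns the coefficient of B in `k` and `k'` into a
  -- multiple of the coefficient of A, the shape needed in `block_reduced`.
  have hs : ∀ i, q (i + 1) + q (i + 2) = - q i * (1 + q (i + 1) * q (i + 2)) := by
    intro i; fin_cases i <;> simp <;> linear_combination hq'
  have k0 := k 0
  have k1 := k 1
  have k2 := k 2
  have l0 := k' 0
  have l1 := k' 1
  have l2 := k' 2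
  have n0 := hn' 0
  have n1 := hn' 1
  have n2 := hn' 2
  rw [hs] at k0 k1 k2 l0 l1 l2
  have x1 : (1 : Fin 3) + 1 = 2 := rfl
  have x2 : (1 : Fin 3) + 2 = 0 := rfl
  have x3 : (2 : Fin 3) + 1 = 0 := rfl
  have x4 : (2 : Fin 3) + 2 = 1 := rfl
  simp only [zero_add, x1, x2, x3, x4] at k0 k1 k2 l0 l1 l2 n0 n1 n2
  have r0 := block_reduced (q 0) (q 1) (q 2) (A 0) (A 1) (A 2) (B 0) (B 1) (B 2) hq'
    (hq0 _) (hq0 _) (hq0 _) n0 (by rwa [mul_comm]) n2 (by linear_combination k0)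
    (by linear_combination k1) (by linear_combination k2) (by linear_combination l0)
    (by linear_combination l1) (by linear_combination l2)
  have r1 := block_reduced (q 1) (q 2) (q 0) (A 1) (A 2) (A 0) (B 1) (B 2) (B 0)
    (by linear_combination hq') (hq0 _) (hq0 _) (hq0 _) n1 (by rwa [mul_comm]) n0
    (by linear_combination k1) (by linear_combination k2) (by linear_combination k0)
    (by linear_combination l1) (by linear_combination l2) (by linear_combination l0)
  have r2 := block_reduced (q 2) (q 0) (q 1) (A 2) (A 0) (A 1) (B 2) (B 0) (B 1)
    (by linear_combination hq') (hq0 _) (hq0 _) (hq0 _) n2 (by rwa [mul_comm]) n1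
    (by linear_combination k2) (by linear_combination k0) (by linear_combination k1)
    (by linear_combination l2) (by linear_combination l0) (by linear_combination l1)
  intro i
  fin_cases i
  exacts [r0, r1, r2]

end

end Austere

namespace Austere

section
/-- The three indices different from `g`. -/
def others : Fin 4 → Fin 3 → Fin 4 := ![![1, 2, 3], ![0, 2, 3], ![0, 1, 3], ![0, 1, 2]]

/-- The index of the normal vector proportional to the value of the second fundamental form at
`g` and the `i`-th index different from `g`. -/
def normalIdx : Fin 4 → Fin 3 → Fin 3 := ![![0, 1, 2], ![0, 2, 1], ![1, 2, 0], ![2, 1, 0]]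

variable {l : Fin 3 → ℝ} {w : Fin 4 → Fin 4 → Fin 4 → ℝ} {t : Fin 4 → Fin 3 → Fin 3 → ℝ}

theorem Codazzi.self_eq_zero (h : Codazzi l w t) (c a : Fin 4) : w c a a = 0 := by
  linarith [h.skew c a a]

set_option linter.unusedSimpArgs false
set_option maxHeartbeats 2000000 in
/-- In the generic case the Codazzi equations force the connection to vanish. -/
theorem Codazzi.block (h : Codazzi l w t) (hl : l 0 * l 1 * l 2 + l 0 + l 1 + l 2 = 0)
    (g : Fin 4)
    (h0 : ∀ i, l i ≠ 0) (hn : ∀ i, 1 + l i * l (i + 1) ≠ 0) (i : Fin 3) :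
    w (others g i) g (others g i) = 0 ∧
      w (others g i) (others g (i + 1)) (others g (i + 2)) = 0 := by
  have s := h.skew
  have s0 := h.self_eq_zero
  have e := h.eq
  have n0 := hn 0
  have n1 := hn 1
  have n2 := hn 2
  have x1 : (1 : Fin 3) + 1 = 2 := rfl
  have x2 : (1 : Fin 3) + 2 = 0 := rfl
  have x3 : (2 : Fin 3) + 1 = 0 := rfl
  have x4 : (2 : Fin 3) + 2 = 1 := rfl
  simp only [zero_add, x1, x2, x3, x4] at n0 n1 n2
  -- Regard the frame indices as the Klein four-group with neutral element 0, and give νₖ the degree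
  -- k + 1. Then II is homogeneous, so the Codazzi equations split according to the degree of w c a
  -- b and t c j i, which is the sum of the degrees of the three indices. The block of degree g has
  -- six unknowns w and nine unknowns t, listed here.
  refine block_vanish (fun i => coefC l (normalIdx g i) g (others g i))
    (fun i => coefC l (normalIdx g i) (others g (i + 1)) (others g (i + 2)))
    (fun i => w (others g i) g (others g i))
    (fun i => w (others g i) (others g (i + 1)) (others g (i + 2)))
    (fun i => t g (normalIdx g i) (normalIdx g i))
    (fun i => t (others g i) (normalIdx g (i + 2)) (normalIdx g (i + 1)))
    (fun i => t (others g i) (normalIdx g (i + 1)) (normalIdx g (i + 2)))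
    ?_ ?_ ?_ ?_ ?_ ?_ ?_ ?_ ?_ i
  · fin_cases g <;> simp [coefC_eq, others, normalIdx] <;> linear_combination hl
  · clear e s
    intro i; fin_cases g <;> fin_cases i <;> simp [coefC_eq, others, normalIdx, x1, h0]
  · clear e s
    intro i; fin_cases g <;> fin_cases i <;>
      simp [coefC_eq, others, normalIdx, x1, x2, x3, x4, h0]
  · clear e s s0 hn h
    have h00 := h0 0
    have h01 := h0 1
    have h02 := h0 2
    clear h0 i
    intro i; fin_cases g <;> fin_cases i <;> simp [coefC_eq, others, normalIdx, x1, x2, x3, x4] <;>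
      grind
  · intro i
    have k := e g g (others g i) (normalIdx g i)
    have k' := s (others g i) g (others g i)
    clear e s
    fin_cases g <;> fin_cases i <;>
      simp [coefC_eq, others, normalIdx, x1, x2, x3, x4, Fin.sum_univ_four, Fin.sum_univ_three, s0]
        at k k' ⊢ <;> grind
  · intro i
    have k := e (others g i) (others g i) (others g (i + 2)) (normalIdx g (i + 2))
    have k1 := s (others g i) g (others g i)
    have k2 := s (others g i) (others g (i + 1)) (others g (i + 2))
    have k3 := s (others g (i + 2)) (others g (i + 1)) (others g i)
    clear e s
    fin_cases g <;> fin_cases i <;>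
      simp [coefC_eq, others, normalIdx, x1, x2, x3, x4, Fin.sum_univ_four, Fin.sum_univ_three, s0]
        at k k1 k2 k3 ⊢ <;> grind
  · intro i
    have k := e (others g i) (others g (i + 1)) g (normalIdx g (i + 2))
    have k1 := s (others g i) g (others g i)
    have k2 := s (others g i) (others g (i + 1)) (others g (i + 2))
    clear e s
    fin_cases g <;> fin_cases i <;>
      simp [coefC_eq, others, normalIdx, x1, x2, x3, x4, Fin.sum_univ_four, Fin.sum_univ_three, s0]
        at k k1 k2 ⊢ <;> grind
  · intro i
    have k := e (others g i) (others g i) (others g (i + 1)) (normalIdx g (i + 1))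
    have k1 := s (others g i) g (others g i)
    have k2 := s (others g i) (others g (i + 1)) (others g (i + 2))
    have k3 := s (others g (i + 1)) (others g (i + 2)) (others g i)
    clear e s
    fin_cases g <;> fin_cases i <;>
      simp [coefC_eq, others, normalIdx, x1, x2, x3, x4, Fin.sum_univ_four, Fin.sum_univ_three, s0]
        at k k1 k2 k3 ⊢ <;> grind
  · intro i
    have k := e (others g i) (others g (i + 2)) g (normalIdx g (i + 1))
    have k1 := s (others g i) g (others g i)
    have k2 := s (others g i) (others g (i + 1)) (others g (i + 2))
    clear e s
    fin_cases g <;> fin_cases i <;>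
      simp [coefC_eq, others, normalIdx, x1, x2, x3, x4, Fin.sum_univ_four, Fin.sum_univ_three, s0]
        at k k1 k2 ⊢ <;> grind

theorem Codazzi.eq_zero (h : Codazzi l w t) (hl : l 0 * l 1 * l 2 + l 0 + l 1 + l 2 = 0)
    (h0 : ∀ i, l i ≠ 0) (hn : ∀ i, 1 + l i * l (i + 1) ≠ 0) (c a b : Fin 4) : w c a b = 0 := by
  have k := h.block hl
  have s := h.skew
  have s0 := h.self_eq_zero
  have x1 : (1 : Fin 3) + 1 = 2 := rfl
  have x2 : (1 : Fin 3) + 2 = 0 := rfl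
  have x3 : (2 : Fin 3) + 1 = 0 := rfl
  have x4 : (2 : Fin 3) + 2 = 1 := rfl
  have k0 := fun i => k 0 h0 hn i
  have k1 := fun i => k 1 h0 hn i
  have k2 := fun i => k 2 h0 hn i
  have k3 := fun i => k 3 h0 hn i
  simp [Fin.forall_fin_succ, others, x1, x2, x3, x4] at k0 k1 k2 k3
  revert c a b
  simp only [Fin.forall_fin_succ, s0]
  simp
  grind

end

end Austere

/-! ### The Codazzi equations for the parameters 0 and (r, 0, -r) -/

namespace Austere

section
variable {w : Fin 4 → Fin 4 → Fin 4 → ℝ} {t : Fin 4 → Fin 3 → Fin 3 → ℝ}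

/-- This makes the distribution spanned by e₁, e₂, e₃ integrable with totally geodesic leaves. As II
vanishes on it, the leaves are open in affine 3-planes. -/
theorem Codazzi.of_zero (h : Codazzi 0 w t) {i j : Fin 4} (hi : i ≠ 0) (hj : j ≠ 0) :
    w i 0 j = 0 := by
  have s0 := h.self_eq_zero
  have s := fun c a => h.skew c 0 a
  have e := h.eq
  simp only [coefC_eq] at e
  have h12 : w 1 0 2 = 0 ∧ w 2 0 1 = 0 := by
    have k1 := e 1 1 2 0
    have k5 := e 2 2 1 1
    simp [Fin.sum_univ_four, Fin.sum_univ_three, s0] at k1 k5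
    constructor <;> linarith [s 1 2, s 2 1]
  have h13 : w 1 0 3 = 0 ∧ w 3 0 1 = 0 := by
    have k1 := e 1 1 3 0
    have k5 := e 3 3 1 2
    simp [Fin.sum_univ_four, Fin.sum_univ_three, s0] at k1 k5
    constructor <;> linarith [s 1 3, s 3 1]
  have h23 : w 2 0 3 = 0 ∧ w 3 0 2 = 0 := by
    have k1 := e 2 2 3 1
    have k5 := e 3 3 2 2
    simp [Fin.sum_univ_four, Fin.sum_univ_three, s0] at k1 k5
    constructor <;> linarith [s 2 3, s 3 2]
  have h11 : w 1 0 1 = 0 := by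
    have k1 := e 1 1 2 1
    simp [Fin.sum_univ_four, Fin.sum_univ_three, s0] at k1
    linarith [s 1 1]
  have h22 : w 2 0 2 = 0 := by
    have k1 := e 2 2 1 0
    simp [Fin.sum_univ_four, Fin.sum_univ_three, s0] at k1
    linarith [s 2 2]
  have h33 : w 3 0 3 = 0 := by
    have k1 := e 3 3 1 0
    simp [Fin.sum_univ_four, Fin.sum_univ_three, s0] at k1
    linarith [s 3 3]
  clear e s0 s h
  fin_cases i <;> fin_cases j <;> simp_all

/-- The Codazzi equations for the parameters `(r, 0, -r)`, with indices `1, 3` paired. -/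
theorem Codazzi.of_skewPair {r : ℝ} (h : Codazzi ![r, 0, -r] w t) (h0 : r ≠ 0) (h1 : r ^ 2 ≠ 1) :
    (∀ c, w c 0 2 = 0) ∧ w 1 0 1 = 0 ∧ w 3 0 1 = 0 ∧ w 1 0 3 = 0 ∧ w 3 0 3 = 0 := by
  have s0 := h.self_eq_zero
  have s := h.skew
  have e := h.eq
  simp only [coefC_eq] at e
  have h1' : r ^ 2 - 1 ≠ 0 := sub_ne_zero.2 h1
  -- With a zero parameter `block_vanish` does not apply, so the four blocks are treated separately;
  -- `B0`, `B2`, `B1`, `B3` are numbered by degree.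
  have B0 : w 1 0 1 = 0 ∧ w 3 0 3 = 0 ∧ w 2 0 2 = 0 := by
    have a1 := e 0 0 1 0
    have a2 := e 0 0 2 1
    have a3 := e 0 0 3 2
    have b1 := e 1 1 2 1
    have b2 := e 1 1 3 2
    have b3 := e 2 2 1 0
    have b4 := e 2 2 3 2
    have b5 := e 3 3 1 0
    have b6 := e 3 3 2 1
    have c1 := e 0 1 2 2
    have c2 := e 0 2 1 2
    have c3 := e 0 1 3 1
    have c4 := e 0 3 1 1
    have c5 := e 0 2 3 0
    have c6 := e 0 3 2 0
    clear e
    simp [Fin.sum_univ_four, Fin.sum_univ_three, s0] at a1 a2 a3 b1 b2 b3 b4 b5 b6 c1 c2 c3 c4 c5 c6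
    have z1 := s 1 0 1
    have z2 := s 2 0 2
    have z3 := s 3 0 3
    have z4 := s 1 2 3
    have z5 := s 2 1 3
    have z6 := s 3 1 2
    clear s s0 h
    have u1 : w 1 0 1 = r * (w 1 2 3 + 2 * w 3 1 2) := by grind
    have u2 : w 3 0 3 = r * (w 3 1 2 + 2 * w 1 2 3) := by grind
    have u3 : w 1 0 1 = - r * w 1 2 3 := by
      apply mul_left_cancel₀ h0; grind
    have u4 : w 3 0 3 = - r * w 3 1 2 := by
      apply mul_left_cancel₀ h0; grind
    have u5 : -2 * r ^ 2 * w 1 0 1 - (1 - r ^ 2) * w 2 0 2 = 2 * r * w 1 2 3 := by grind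
    have u6 : -2 * r ^ 2 * w 3 0 3 - (1 - r ^ 2) * w 2 0 2 = 2 * r * w 3 1 2 := by grind
    clear a1 a2 a3 b1 b2 b3 b4 b5 b6 c1 c2 c3 c4 c5 c6
    have v : w 3 1 2 = - w 1 2 3 := by apply mul_left_cancel₀ h0; linarith
    have v1 : w 1 2 3 = 0 := by
      apply mul_left_cancel₀ (mul_ne_zero h0 h1'); grind
    have v2 : w 2 0 2 = 0 := by apply mul_left_cancel₀ h1'; grind
    rw [u3, u4, v, v1, v2]; simp
  have B2 : w 0 0 2 = 0 ∧ w 1 0 3 = 0 ∧ w 3 0 1 = 0 := by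
    have a1 := e 2 2 0 1
    have a2 := e 2 2 1 2
    have a3 := e 2 2 3 0
    have b1 := e 0 0 1 2
    have b2 := e 0 0 3 0
    have b3 := e 1 1 0 1
    have b4 := e 1 1 3 0
    have b5 := e 3 3 0 1
    have b6 := e 3 3 1 2
    have c1 := e 0 1 2 0
    have c2 := e 1 0 2 0
    have c3 := e 0 3 2 2
    have c4 := e 3 0 2 2
    have c5 := e 1 3 2 1
    have c6 := e 3 1 2 1
    clear e B0
    simp [Fin.sum_univ_four, Fin.sum_univ_three, s0] at a1 a2 a3 b1 b2 b3 b4 b5 b6 c1 c2 c3 c4 c5 c6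
    have z1 := s 0 0 2
    have z2 := s 1 1 2
    have z3 := s 3 2 3
    have z4 := s 0 1 3
    have z5 := s 1 0 3
    have z6 := s 3 0 1
    clear s s0 h
    have u1 : w 1 0 3 = - r * w 1 1 2 := by grind
    have u2 : w 3 0 1 = r * w 3 3 2 := by grind
    have u3 : w 3 3 2 = - w 1 1 2 := by
      apply mul_left_cancel₀ h0; grind
    have u4 : t 2 0 0 = - 2 * w 3 3 2 := by
      apply mul_left_cancel₀ h0; linarith
    have u5 : t 2 2 2 = - 2 * w 1 1 2 := by
      apply mul_left_cancel₀ h0; linarith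
    have u6 : t 0 0 2 = 2 * w 3 0 1 + w 0 1 3 - w 0 0 2 * r := by rw [z1]; linarith
    have u7 : t 0 2 0 = 2 * w 1 0 3 - w 0 1 3 + w 0 0 2 * r := by rw [z1]; linarith
    rw [u4, u6, u2, u3] at c1
    rw [u5, u7, u1] at c3
    have v1 : w 1 1 2 = 0 := by
      apply mul_left_cancel₀ h1'; linear_combination (c1 - c3 - r * z4) / (-4)
    have v2 : w 0 0 2 = 0 := by
      apply mul_left_cancel₀ h1'; rw [v1] at c3; linear_combination -c3
    rw [u1, u2, u3, v1, v2]; simp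
  have B1 : w 3 0 2 = 0 := by
    have a1 := e 1 1 0 0
    have a2 := e 1 1 2 2
    have a3 := e 1 1 3 1
    have b1 := e 0 0 2 2
    have b2 := e 0 0 3 1
    have b3 := e 2 2 0 0
    have b4 := e 2 2 3 1
    have b5 := e 3 3 0 0
    have b6 := e 3 3 2 2
    have c1 := e 0 2 1 1
    have c2 := e 2 0 1 1
    have c3 := e 0 3 1 2
    have c4 := e 3 0 1 2
    have c5 := e 2 3 1 0
    have c6 := e 3 2 1 0
    clear e B0 B2
    simp [Fin.sum_univ_four, Fin.sum_univ_three, s0] at a1 a2 a3 b1 b2 b3 b4 b5 b6 c1 c2 c3 c4 c5 c6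
    have z1 := s 0 0 1
    have z2 := s 2 1 2
    have z3 := s 3 1 3
    have z4 := s 0 2 3
    have z5 := s 2 0 3
    have z6 := s 3 0 2
    clear s s0 h
    have u1 : t 1 2 2 = -2 * w 2 2 1 := by
      apply mul_left_cancel₀ h0; linarith
    apply mul_left_cancel₀ h1'
    grind
  have B3 : w 1 0 2 = 0 := by
    have a1 := e 3 3 0 2
    have a2 := e 3 3 2 0
    have b1 := e 0 0 2 0
    have b2 := e 0 0 1 1
    have b4 := e 2 2 1 1
    have b6 := e 1 1 2 0
    have c1 := e 0 2 3 1
    have c2 := e 2 0 3 1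
    have c3 := e 0 1 3 0
    have c4 := e 1 0 3 0
    have c5 := e 2 1 3 2
    have c6 := e 1 2 3 2
    clear e B0 B2
    simp [Fin.sum_univ_four, Fin.sum_univ_three, s0] at a1 a2 b1 b2 b4 b6 c1 c2 c3 c4 c5 c6
    have z1 := s 0 0 3
    have z2 := s 2 2 3
    have z3 := s 1 1 3
    have z4 := s 0 1 2
    have z5 := s 2 0 1
    have z6 := s 1 0 2
    clear s s0 h
    have u1 : t 3 0 0 = -2 * w 2 2 3 := by
      apply mul_left_cancel₀ h0; linarith
    apply mul_left_cancel₀ h1'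
    grind
  refine ⟨fun c => ?_, B0.1, B2.2.2, B2.2.1, B0.2.1⟩
  fin_cases c
  exacts [B2.1, B3, B0.2.2, B1]

end

end Austere

/-! ### The Codazzi equations for the parameters (1, L, -1) -/

namespace Austere

section
variable {w : Fin 4 → Fin 4 → Fin 4 → ℝ} {t : Fin 4 → Fin 3 → Fin 3 → ℝ}

-- Here 1 + λ₁λ₃ = 0 and the solution space is no longer zero. In this block and in the three that
-- follow, fifteen equations determine all coefficients from one value of a and one value of p.
set_option maxHeartbeats 1000000 in
theorem Codazzi.kahler_block_zero {L : ℝ} (h : Codazzi ![1, L, -1] w t) (h0 : L ≠ 0)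
    (h1 : 1 + L ≠ 0) {a p : Fin 4 → ℝ} (ha : ∀ c, w c 0 1 = (1 + L) * a c)
    (hp : ∀ c, w c 0 2 = -p c) :
    w 1 2 3 = -(1 + L) * a 1 ∧
    w 2 1 3 = p 2 ∧
    w 3 0 3 = (L - 1) * a 1 ∧
    w 3 1 2 = (1 - L) * a 1 ∧
    t 0 0 0 = 2 * (1 + L) * a 1 ∧
    t 0 1 1 = -2 * p 2 ∧
    t 0 2 2 = -2 * (1 - L) * a 1 ∧
    t 1 1 2 = -(1 + L) ^ 2 * a 1 - 2 * L * p 2 ∧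
    t 1 2 1 = 4 * a 1 ∧
    t 2 0 2 = 2 * (1 + L) * a 1 + 2 * p 2 ∧
    t 2 2 0 = 2 * (1 - L) * a 1 - 2 * p 2 ∧
    t 3 0 1 = 4 * a 1 ∧
    t 3 1 0 = -(1 - L) ^ 2 * a 1 - 2 * L * p 2 := by
  have s0 := h.self_eq_zero
  have s := h.skew
  have e := h.eq
  simp only [coefC_eq] at e
  have e0 := e 0 0 1 0
  have e1 := e 0 0 2 1
  have e2 := e 0 0 3 2
  have e3 := e 1 1 2 1
  have e4 := e 1 3 0 1
  have e5 := e 1 1 3 2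
  have e6 := e 1 2 0 2
  have e7 := e 2 2 3 2
  have e8 := e 2 1 0 2
  have e9 := e 2 2 1 0
  have e10 := e 2 3 0 0
  have e11 := e 3 3 1 0
  have e12 := e 3 2 0 0
  have e13 := e 3 3 2 1
  have e14 := e 3 1 0 1
  clear e
  simp [Fin.sum_univ_four, Fin.sum_univ_three, s0] at e0 e1 e2 e3 e4 e5 e6 e7 e8 e9 e10 e11 e12 e13 e14
  have z0 := s 1 0 1
  have z1 := s 1 2 3
  have z2 := s 2 0 2
  have z3 := s 2 1 3
  have z4 := s 3 0 3
  have z5 := s 3 1 2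
  have ha := ha 1
  have hp := hp 2
  clear s s0 h
  have u0 : w 1 2 3 = -(1 + L) * a 1 := by
    grind
  have u1 : w 2 1 3 = p 2 := by
    grind
  have u2 : w 3 0 3 = (L - 1) * a 1 := by
    grind
  have u3 : w 3 1 2 = (1 - L) * a 1 := by
    grind
  have u4 : t 0 0 0 = 2 * (1 + L) * a 1 := by
    grind
  have u5 : t 0 1 1 = -2 * p 2 := by
    grind
  have u6 : t 0 2 2 = -2 * (1 - L) * a 1 := by
    grind
  have u7 : t 1 1 2 = -(1 + L) ^ 2 * a 1 - 2 * L * p 2 := by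
    grind
  have u8 : t 1 2 1 = 4 * a 1 := by
    grind
  have u9 : t 2 0 2 = 2 * (1 + L) * a 1 + 2 * p 2 := by
    grind
  have u10 : t 2 2 0 = 2 * (1 - L) * a 1 - 2 * p 2 := by
    grind
  have u11 : t 3 0 1 = 4 * a 1 := by
    grind
  have u12 : t 3 1 0 = -(1 - L) ^ 2 * a 1 - 2 * L * p 2 := by
    grind
  exact ⟨u0, u1, u2, u3, u4, u5, u6, u7, u8, u9, u10, u11, u12⟩

set_option maxHeartbeats 1000000 in
theorem Codazzi.kahler_block_one {L : ℝ} (h : Codazzi ![1, L, -1] w t) (h0 : L ≠ 0)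
    (h1 : 1 + L ≠ 0) {a p : Fin 4 → ℝ} (ha : ∀ c, w c 0 1 = (1 + L) * a c)
    (hp : ∀ c, w c 0 2 = -p c) :
    w 0 2 3 = -(1 + L) * a 0 ∧
    w 2 0 3 = (1 - L) * a 0 ∧
    w 2 1 2 = (L - 1) * a 0 ∧
    w 3 1 3 = p 3 ∧
    t 0 1 2 = -(1 + L) ^ 2 * a 0 - 2 * p 3 ∧
    t 0 2 1 = 4 * a 0 ∧
    t 1 0 0 = -2 * (1 + L) * a 0 ∧
    t 1 1 1 = 2 * p 3 ∧
    t 1 2 2 = -2 * (1 - L) * a 0 ∧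
    t 2 0 1 = -4 * a 0 ∧
    t 2 1 0 = (1 - L) ^ 2 * a 0 + 2 * p 3 ∧
    t 3 0 2 = 2 * (1 + L) * a 0 + 2 * p 3 ∧
    t 3 2 0 = -2 * (1 - L) * a 0 - 2 * p 3 := by
  have s0 := h.self_eq_zero
  have s := h.skew
  have e := h.eq
  simp only [coefC_eq] at e
  have e0 := e 1 1 0 0
  have e1 := e 1 1 2 2
  have e2 := e 1 1 3 1
  have e3 := e 0 0 2 2
  have e4 := e 0 3 1 2
  have e5 := e 0 0 3 1
  have e6 := e 0 2 1 1
  have e7 := e 2 2 3 1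
  have e8 := e 2 0 1 1
  have e9 := e 2 2 0 0
  have e10 := e 2 3 1 0
  have e11 := e 3 3 0 0
  have e12 := e 3 2 1 0
  have e13 := e 3 3 2 2
  have e14 := e 3 0 1 2
  clear e
  simp [Fin.sum_univ_four, Fin.sum_univ_three, s0] at e0 e1 e2 e3 e4 e5 e6 e7 e8 e9 e10 e11 e12 e13 e14
  have z0 := s 0 0 1
  have z1 := s 0 2 3
  have z2 := s 2 0 3
  have z3 := s 2 1 2
  have z4 := s 3 0 2
  have z5 := s 3 1 3
  have ha := ha 0
  have hp := hp 3
  clear s s0 h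
  have u0 : w 0 2 3 = -(1 + L) * a 0 := by
    grind
  have u1 : w 2 0 3 = (1 - L) * a 0 := by
    grind
  have u2 : w 2 1 2 = (L - 1) * a 0 := by
    grind
  have u3 : w 3 1 3 = p 3 := by
    grind
  have u4 : t 0 1 2 = -(1 + L) ^ 2 * a 0 - 2 * p 3 := by
    grind
  have u5 : t 0 2 1 = 4 * a 0 := by
    grind
  have u6 : t 1 0 0 = -2 * (1 + L) * a 0 := by
    grind
  have u7 : t 1 1 1 = 2 * p 3 := by
    grind
  have u8 : t 1 2 2 = -2 * (1 - L) * a 0 := by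
    grind
  have u9 : t 2 0 1 = -4 * a 0 := by
    grind
  have u10 : t 2 1 0 = (1 - L) ^ 2 * a 0 + 2 * p 3 := by
    grind
  have u11 : t 3 0 2 = 2 * (1 + L) * a 0 + 2 * p 3 := by
    grind
  have u12 : t 3 2 0 = -2 * (1 - L) * a 0 - 2 * p 3 := by
    grind
  exact ⟨u0, u1, u2, u3, u4, u5, u6, u7, u8, u9, u10, u11, u12⟩

set_option maxHeartbeats 1000000 in
theorem Codazzi.kahler_block_two {L : ℝ} (h : Codazzi ![1, L, -1] w t) (h0 : L ≠ 0)
    (h1 : 1 + L ≠ 0) {a p : Fin 4 → ℝ} (ha : ∀ c, w c 0 1 = (1 + L) * a c)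
    (hp : ∀ c, w c 0 2 = -p c) :
    w 0 1 3 = p 0 ∧
    w 1 0 3 = (1 - L) * a 3 ∧
    w 1 1 2 = (L - 1) * a 3 ∧
    w 3 2 3 = -(1 + L) * a 3 ∧
    t 0 0 2 = 2 * (1 + L) * a 3 + 2 * p 0 ∧
    t 0 2 0 = 2 * (1 - L) * a 3 - 2 * p 0 ∧
    t 1 0 1 = -4 * a 3 ∧
    t 1 1 0 = (1 - L) ^ 2 * a 3 + 2 * L * p 0 ∧
    t 2 0 0 = -2 * (1 + L) * a 3 ∧
    t 2 1 1 = 2 * p 0 ∧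
    t 2 2 2 = 2 * (1 - L) * a 3 ∧
    t 3 1 2 = -(1 + L) ^ 2 * a 3 - 2 * L * p 0 ∧
    t 3 2 1 = 4 * a 3 := by
  have s0 := h.self_eq_zero
  have s := h.skew
  have e := h.eq
  simp only [coefC_eq] at e
  have e0 := e 2 2 0 1
  have e1 := e 2 2 1 2
  have e2 := e 2 2 3 0
  have e3 := e 0 0 1 2
  have e4 := e 0 3 2 2
  have e5 := e 0 0 3 0
  have e6 := e 0 1 2 0
  have e7 := e 1 1 3 0
  have e8 := e 1 0 2 0
  have e9 := e 1 1 0 1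
  have e10 := e 1 3 2 1
  have e11 := e 3 3 0 1
  have e12 := e 3 1 2 1
  have e13 := e 3 3 1 2
  have e14 := e 3 0 2 2
  clear e
  simp [Fin.sum_univ_four, Fin.sum_univ_three, s0] at e0 e1 e2 e3 e4 e5 e6 e7 e8 e9 e10 e11 e12 e13 e14
  have z0 := s 0 0 2
  have z1 := s 0 1 3
  have z2 := s 1 0 3
  have z3 := s 1 1 2
  have z4 := s 3 0 1
  have z5 := s 3 2 3
  have ha := ha 3
  have hp := hp 0
  clear s s0 h
  have u0 : w 0 1 3 = p 0 := by
    grind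
  have u1 : w 1 0 3 = (1 - L) * a 3 := by
    grind
  have u2 : w 1 1 2 = (L - 1) * a 3 := by
    grind
  have u3 : w 3 2 3 = -(1 + L) * a 3 := by
    grind
  have u4 : t 0 0 2 = 2 * (1 + L) * a 3 + 2 * p 0 := by
    grind
  have u5 : t 0 2 0 = 2 * (1 - L) * a 3 - 2 * p 0 := by
    grind
  have u6 : t 1 0 1 = -4 * a 3 := by
    grind
  have u7 : t 1 1 0 = (1 - L) ^ 2 * a 3 + 2 * L * p 0 := by
    grind
  have u8 : t 2 0 0 = -2 * (1 + L) * a 3 := by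
    grind
  have u9 : t 2 1 1 = 2 * p 0 := by
    grind
  have u10 : t 2 2 2 = 2 * (1 - L) * a 3 := by
    grind
  have u11 : t 3 1 2 = -(1 + L) ^ 2 * a 3 - 2 * L * p 0 := by
    grind
  have u12 : t 3 2 1 = 4 * a 3 := by
    grind
  exact ⟨u0, u1, u2, u3, u4, u5, u6, u7, u8, u9, u10, u11, u12⟩

set_option maxHeartbeats 1000000 in
theorem Codazzi.kahler_block_three {L : ℝ} (h : Codazzi ![1, L, -1] w t) (h0 : L ≠ 0)
    (h1 : 1 + L ≠ 0) {a p : Fin 4 → ℝ} (ha : ∀ c, w c 0 1 = (1 + L) * a c)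
    (hp : ∀ c, w c 0 2 = -p c) :
    w 0 0 3 = (L - 1) * a 2 ∧
    w 0 1 2 = (1 - L) * a 2 ∧
    w 1 1 3 = p 1 ∧
    w 2 2 3 = -(1 + L) * a 2 ∧
    t 0 0 1 = 4 * a 2 ∧
    t 0 1 0 = -(1 - L) ^ 2 * a 2 - 2 * p 1 ∧
    t 1 0 2 = 2 * (1 + L) * a 2 + 2 * p 1 ∧
    t 1 2 0 = -2 * (1 - L) * a 2 - 2 * p 1 ∧
    t 2 1 2 = -(1 + L) ^ 2 * a 2 - 2 * p 1 ∧
    t 2 2 1 = 4 * a 2 ∧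
    t 3 0 0 = 2 * (1 + L) * a 2 ∧
    t 3 1 1 = -2 * p 1 ∧
    t 3 2 2 = 2 * (1 - L) * a 2 := by
  have s0 := h.self_eq_zero
  have s := h.skew
  have e := h.eq
  simp only [coefC_eq] at e
  have e0 := e 3 3 0 2
  have e1 := e 3 3 1 1
  have e2 := e 3 3 2 0
  have e3 := e 0 0 1 1
  have e4 := e 0 2 3 1
  have e5 := e 0 0 2 0
  have e6 := e 0 1 3 0
  have e7 := e 1 1 2 0
  have e8 := e 1 0 3 0
  have e9 := e 1 1 0 2
  have e10 := e 1 2 3 2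
  have e11 := e 2 2 0 2
  have e12 := e 2 1 3 2
  have e13 := e 2 2 1 1
  have e14 := e 2 0 3 1
  clear e
  simp [Fin.sum_univ_four, Fin.sum_univ_three, s0] at e0 e1 e2 e3 e4 e5 e6 e7 e8 e9 e10 e11 e12 e13 e14
  have z0 := s 0 0 3
  have z1 := s 0 1 2
  have z2 := s 1 0 2
  have z3 := s 1 1 3
  have z4 := s 2 0 1
  have z5 := s 2 2 3
  have ha := ha 2
  have hp := hp 1
  clear s s0 h
  have u0 : w 0 0 3 = (L - 1) * a 2 := by
    grind
  have u1 : w 0 1 2 = (1 - L) * a 2 := by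
    grind
  have u2 : w 1 1 3 = p 1 := by
    grind
  have u3 : w 2 2 3 = -(1 + L) * a 2 := by
    grind
  have u4 : t 0 0 1 = 4 * a 2 := by
    grind
  have u5 : t 0 1 0 = -(1 - L) ^ 2 * a 2 - 2 * p 1 := by
    grind
  have u6 : t 1 0 2 = 2 * (1 + L) * a 2 + 2 * p 1 := by
    grind
  have u7 : t 1 2 0 = -2 * (1 - L) * a 2 - 2 * p 1 := by
    grind
  have u8 : t 2 1 2 = -(1 + L) ^ 2 * a 2 - 2 * p 1 := by
    grind
  have u9 : t 2 2 1 = 4 * a 2 := by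
    grind
  have u10 : t 3 0 0 = 2 * (1 + L) * a 2 := by
    grind
  have u11 : t 3 1 1 = -2 * p 1 := by
    grind
  have u12 : t 3 2 2 = 2 * (1 - L) * a 2 := by
    grind
  exact ⟨u0, u1, u2, u3, u4, u5, u6, u7, u8, u9, u10, u11, u12⟩

end

end Austere

namespace Austere

section
variable {w : Fin 4 → Fin 4 → Fin 4 → ℝ} {t : Fin 4 → Fin 3 → Fin 3 → ℝ}

/-- For L = 0 the entry of ν₁ at (1, 3) is zero, so w c 1 3 is no longer tied to w c 0 2. Each block
keeps a third free parameter, a value of f. -/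
theorem Codazzi.degenerate_block_zero (h : Codazzi ![1, 0, -1] w t)
    {a p f : Fin 4 → ℝ} (ha : ∀ c, w c 0 1 = a c) (hp : ∀ c, w c 0 2 = -p c)
    (hf : ∀ c, w c 1 3 = f c) :
    w 1 2 3 = -a 1 ∧
    w 3 0 3 = -a 1 ∧
    w 3 1 2 = a 1 ∧
    t 0 0 0 = 2 * a 1 ∧
    t 0 1 1 = -2 * p 2 ∧
    t 0 2 2 = -2 * a 1 ∧
    t 1 1 2 = -a 1 ∧
    t 1 2 1 = 4 * a 1 ∧
    t 2 0 2 = 2 * a 1 + p 2 + f 2 ∧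
    t 2 2 0 = 2 * a 1 - p 2 - f 2 ∧
    t 3 0 1 = 4 * a 1 ∧
    t 3 1 0 = -a 1 := by
  have s0 := h.self_eq_zero
  have s := h.skew
  have e := h.eq
  simp only [coefC_eq] at e
  have e0 := e 0 0 1 0
  have e1 := e 0 0 2 1
  have e2 := e 0 0 3 2
  have e3 := e 1 1 2 1
  have e4 := e 1 3 0 1
  have e5 := e 1 1 3 2
  have e6 := e 1 2 0 2
  have e7 := e 2 2 3 2
  have e8 := e 2 1 0 2
  have e9 := e 2 2 1 0
  have e10 := e 2 3 0 0
  have e11 := e 3 3 1 0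
  have e12 := e 3 2 0 0
  have e13 := e 3 3 2 1
  have e14 := e 3 1 0 1
  clear e
  simp [Fin.sum_univ_four, Fin.sum_univ_three, s0] at e0 e1 e2 e3 e4 e5 e6 e7 e8 e9 e10 e11 e12 e13 e14
  have z0 := s 1 0 1
  have z1 := s 1 2 3
  have z2 := s 2 0 2
  have z3 := s 2 1 3
  have z4 := s 3 0 3
  have z5 := s 3 1 2
  have ha := ha 1
  have hp := hp 2
  have hf := hf 2
  clear s s0 h
  refine ⟨?_, ?_, ?_, ?_, ?_, ?_, ?_, ?_, ?_, ?_, ?_, ?_⟩ <;> linarith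

theorem Codazzi.degenerate_block_one (h : Codazzi ![1, 0, -1] w t)
    {a p f : Fin 4 → ℝ} (ha : ∀ c, w c 0 1 = a c) (hp : ∀ c, w c 0 2 = -p c)
    (hf : ∀ c, w c 1 3 = f c) :
    w 0 2 3 = -a 0 ∧
    w 2 0 3 = a 0 ∧
    w 2 1 2 = -a 0 ∧
    t 0 1 2 = -a 0 - 2 * p 3 ∧
    t 0 2 1 = 4 * a 0 ∧
    t 1 0 0 = -2 * a 0 ∧
    t 1 1 1 = 2 * p 3 ∧
    t 1 2 2 = -2 * a 0 ∧
    t 2 0 1 = -4 * a 0 ∧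
    t 2 1 0 = a 0 + 2 * p 3 ∧
    t 3 0 2 = 2 * a 0 + p 3 + f 3 ∧
    t 3 2 0 = -2 * a 0 - p 3 - f 3 := by
  have s0 := h.self_eq_zero
  have s := h.skew
  have e := h.eq
  simp only [coefC_eq] at e
  have e0 := e 1 1 0 0
  have e1 := e 1 1 2 2
  have e2 := e 1 1 3 1
  have e3 := e 0 0 2 2
  have e4 := e 0 3 1 2
  have e5 := e 0 0 3 1
  have e6 := e 0 2 1 1
  have e7 := e 2 2 3 1
  have e8 := e 2 0 1 1
  have e9 := e 2 2 0 0
  have e10 := e 2 3 1 0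
  have e11 := e 3 3 0 0
  have e12 := e 3 2 1 0
  have e13 := e 3 3 2 2
  have e14 := e 3 0 1 2
  clear e
  simp [Fin.sum_univ_four, Fin.sum_univ_three, s0] at e0 e1 e2 e3 e4 e5 e6 e7 e8 e9 e10 e11 e12 e13 e14
  have z0 := s 0 0 1
  have z1 := s 0 2 3
  have z2 := s 2 0 3
  have z3 := s 2 1 2
  have z4 := s 3 0 2
  have z5 := s 3 1 3
  have ha := ha 0
  have hp := hp 3
  have hf := hf 3
  clear s s0 h
  refine ⟨?_, ?_, ?_, ?_, ?_, ?_, ?_, ?_, ?_, ?_, ?_, ?_⟩ <;> linarith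

theorem Codazzi.degenerate_block_two (h : Codazzi ![1, 0, -1] w t)
    {a p f : Fin 4 → ℝ} (ha : ∀ c, w c 0 1 = a c) (hp : ∀ c, w c 0 2 = -p c)
    (hf : ∀ c, w c 1 3 = f c) :
    w 1 0 3 = a 3 ∧
    w 1 1 2 = -a 3 ∧
    w 3 2 3 = -a 3 ∧
    t 0 0 2 = 2 * a 3 + p 0 + f 0 ∧
    t 0 2 0 = 2 * a 3 - p 0 - f 0 ∧
    t 1 0 1 = -4 * a 3 ∧
    t 1 1 0 = a 3 ∧
    t 2 0 0 = -2 * a 3 ∧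
    t 2 1 1 = 2 * p 0 ∧
    t 2 2 2 = 2 * a 3 ∧
    t 3 1 2 = -a 3 ∧
    t 3 2 1 = 4 * a 3 := by
  have s0 := h.self_eq_zero
  have s := h.skew
  have e := h.eq
  simp only [coefC_eq] at e
  have e0 := e 2 2 0 1
  have e1 := e 2 2 1 2
  have e2 := e 2 2 3 0
  have e3 := e 0 0 1 2
  have e4 := e 0 3 2 2
  have e5 := e 0 0 3 0
  have e6 := e 0 1 2 0
  have e7 := e 1 1 3 0
  have e8 := e 1 0 2 0
  have e9 := e 1 1 0 1
  have e10 := e 1 3 2 1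
  have e11 := e 3 3 0 1
  have e12 := e 3 1 2 1
  have e13 := e 3 3 1 2
  have e14 := e 3 0 2 2
  clear e
  simp [Fin.sum_univ_four, Fin.sum_univ_three, s0] at e0 e1 e2 e3 e4 e5 e6 e7 e8 e9 e10 e11 e12 e13 e14
  have z0 := s 0 0 2
  have z1 := s 0 1 3
  have z2 := s 1 0 3
  have z3 := s 1 1 2
  have z4 := s 3 0 1
  have z5 := s 3 2 3
  have ha := ha 3
  have hp := hp 0
  have hf := hf 0
  clear s s0 h
  refine ⟨?_, ?_, ?_, ?_, ?_, ?_, ?_, ?_, ?_, ?_, ?_, ?_⟩ <;> linarith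

theorem Codazzi.degenerate_block_three (h : Codazzi ![1, 0, -1] w t)
    {a p f : Fin 4 → ℝ} (ha : ∀ c, w c 0 1 = a c) (hp : ∀ c, w c 0 2 = -p c)
    (hf : ∀ c, w c 1 3 = f c) :
    w 0 0 3 = -a 2 ∧
    w 0 1 2 = a 2 ∧
    w 2 2 3 = -a 2 ∧
    t 0 0 1 = 4 * a 2 ∧
    t 0 1 0 = -a 2 - 2 * p 1 ∧
    t 1 0 2 = 2 * a 2 + p 1 + f 1 ∧
    t 1 2 0 = -2 * a 2 - p 1 - f 1 ∧
    t 2 1 2 = -a 2 - 2 * p 1 ∧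
    t 2 2 1 = 4 * a 2 ∧
    t 3 0 0 = 2 * a 2 ∧
    t 3 1 1 = -2 * p 1 ∧
    t 3 2 2 = 2 * a 2 := by
  have s0 := h.self_eq_zero
  have s := h.skew
  have e := h.eq
  simp only [coefC_eq] at e
  have e0 := e 3 3 0 2
  have e1 := e 3 3 1 1
  have e2 := e 3 3 2 0
  have e3 := e 0 0 1 1
  have e4 := e 0 2 3 1
  have e5 := e 0 0 2 0
  have e6 := e 0 1 3 0
  have e7 := e 1 1 2 0
  have e8 := e 1 0 3 0
  have e9 := e 1 1 0 2
  have e10 := e 1 2 3 2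
  have e11 := e 2 2 0 2
  have e12 := e 2 1 3 2
  have e13 := e 2 2 1 1
  have e14 := e 2 0 3 1
  clear e
  simp [Fin.sum_univ_four, Fin.sum_univ_three, s0] at e0 e1 e2 e3 e4 e5 e6 e7 e8 e9 e10 e11 e12 e13 e14
  have z0 := s 0 0 3
  have z1 := s 0 1 2
  have z2 := s 1 0 2
  have z3 := s 1 1 3
  have z4 := s 2 0 1
  have z5 := s 2 2 3
  have ha := ha 2
  have hp := hp 1
  have hf := hf 1
  clear s s0 h
  refine ⟨?_, ?_, ?_, ?_, ?_, ?_, ?_, ?_, ?_, ?_, ?_, ?_⟩ <;> linarith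

end

end Austere

/-! ### Elimination of the derivatives in the Kähler case -/

namespace Austere

section
open Complex in
/-- The algebraic core of the Kähler case: the derivatives `a, b` of the conjugate connection
coefficients along the two unitary directions are overdetermined. -/
theorem kahler_elimination {L A A' B B' s s' a b c d : ℂ}
    (h1 : A * a + B * b = -3 * I * s * (A * A' + B * B') - 10 * A' ^ 2 * B + 10 * L * A * A' * B')
    (h2 : L ^ 2 * (A * a) + B * b = I * s * (L ^ 2 * A * A' + B * B') -
      4 * I * s' * (A' * B - L * A * B') - 2 * (2 * L ^ 2 - 1) * A' ^ 2 * B +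
      2 * (4 * L + L ^ 3) * A * A' * B' + 8 * L * B * B' ^ 2)
    (h3 : A * b - L * B * a = I * s * (A * B' - L * A' * B) - 4 * I * s' * (A * A' + B * B') -
      2 * (2 * L ^ 2 - 1) * A' ^ 2 * A - 2 * (4 + L ^ 2) * A' * B * B' + 8 * L * A * B' ^ 2)
    (h4 : B * a - L * A * b = -3 * I * s * (A' * B - L * A * B') +
      10 * L * A' * (A * A' + B * B'))
    (k1 : A * c + B * d = -3 * I * s' * (A * A' + B * B') - 10 * A' * B * B' + 10 * L * A * B' ^ 2)
    (k2 : L ^ 2 * (A * c) + B * d = I * s' * (L ^ 2 * A * A' + B * B') +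
      4 * I * L * s * (A' * B - L * A * B') - 2 * (1 + 4 * L ^ 2) * A' * B * B' -
      2 * (L ^ 3 - 2 * L) * A * B' ^ 2 - 8 * L ^ 2 * A * A' ^ 2)
    (k3 : A * d - L * B * c = I * s' * (A * B' - L * A' * B) + 4 * I * L * s * (A * A' + B * B') -
      2 * (2 - L ^ 2) * B * B' ^ 2 - 2 * (1 + 4 * L ^ 2) * A * A' * B' + 8 * L * A' ^ 2 * B)
    (k4 : B * c - L * A * d = -3 * I * s' * (A' * B - L * A * B') +
      10 * L * B' * (A * A' + B * B'))
    (hq : B ^ 2 + L * A ^ 2 ≠ 0) (hL : 1 - L ^ 2 ≠ 0) : B' ^ 2 + L * A' ^ 2 = 0 := by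
  -- This combination cancels a and b, since h1 - h2 and h4 + L h3 are (1 - L²) times A a and B a on
  -- the left; the remainder is divisible by B² + L A².
  have e0 : -4 * I * s * B' + 4 * I * s' * A' - 2 * ((6 - 2 * L ^ 2) * A' ^ 2 + 4 * L * B' ^ 2)
      = 0 := by
    apply mul_left_cancel₀ hq
    linear_combination -B * (h1 - h2) + A * (h4 + L * h3)
  -- The same with c and d: k2 - L² k1 and k3 + L k4 start with (1 - L²) times B d and A d.
  have e1 : 4 * I * L * s' * A' - 4 * I * L * s * B' -
      2 * ((6 * L ^ 2 - 2) * B' ^ 2 + 4 * L * A' ^ 2) = 0 := by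
    apply mul_left_cancel₀ hq
    linear_combination -A * (k2 - L ^ 2 * k1) + B * (k3 + L * k4)
  -- In L e0 - e1 the terms with s and s' cancel, and -4(1 - L²)(B'² + L A'²) remains.
  apply mul_left_cancel₀ hL
  linear_combination (L * e0 - e1) / (-4)

end

end Austere

/-! ### Structure equations of an adapted frame; generic and skew parameters excluded -/

namespace Austere

section
/-- The derivative of `g` along the `c`-th field of a frame. -/
def frameDeriv {W : Type*} [NormedAddCommGroup W] [NormedSpace ℝ W] (X : Fin 4 → E 4 → E 4)
    (c : Fin 4) (g : E 4 → W) (x : E 4) : W := fderiv ℝ g x (X c x)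

/-- The Gauss equations at a point, for connection coefficients `w` with derivatives `dw` and
Gram matrix `G` of the normal frame. -/
def GaussEq (l : Fin 3 → ℝ) (w : Fin 4 → Fin 4 → Fin 4 → ℝ)
    (dw : Fin 4 → Fin 4 → Fin 4 → Fin 4 → ℝ) (G : Fin 3 → Fin 3 → ℝ) : Prop :=
  ∀ a b c d, dw c d b a - dw d c b a + ∑ k, (w d k a * w c b k - w c k a * w d b k) -
    ∑ k, (w c k d - w d k c) * w k b a =
    ∑ i, ∑ j, (coefC l i d a * coefC l j c b - coefC l i c a * coefC l j d b) * G i j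

/-- The structure equations satisfied by an adapted frame along an austere immersion of type C,
in terms of scalar functions. -/
structure FrameSystem (l : Fin 3 → ℝ) (X : Fin 4 → E 4 → E 4)
    (w : Fin 4 → Fin 4 → Fin 4 → E 4 → ℝ) (G : Fin 3 → Fin 3 → E 4 → ℝ) : Prop where
  smoothX : ∀ c, ContDiff ℝ ∞ (X c)
  smoothW : ∀ c a b, ContDiff ℝ ∞ (w c a b)
  smoothG : ∀ i j, ContDiff ℝ ∞ (G i j)
  pos : ∀ i x, 0 < G i i x
  symm : ∀ i j, G i j = G j i
  bracket : ∀ c d x, fderiv ℝ (X d) x (X c x) - fderiv ℝ (X c) x (X d x) =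
    ∑ b, (w c b d x - w d b c x) • X b x
  codazzi : ∀ x, ∃ t, Codazzi l (fun c a b => w c a b x) t ∧
    ∀ c i j, frameDeriv X c (G i j) x = ∑ k, (t c k i * G k j x + t c k j * G i k x)
  gauss : ∀ x, GaussEq l (fun c a b => w c a b x)
    (fun c d b a => frameDeriv X c (w d b a) x) (fun i j => G i j x)

section FrameDeriv

variable {X : Fin 4 → E 4 → E 4} {c : Fin 4} {f g : E 4 → ℝ}

theorem _root_.ContDiff.frameDeriv {W : Type*} [NormedAddCommGroup W] [NormedSpace ℝ W]
    {g : E 4 → W} (hg : ContDiff ℝ ∞ g) (hX : ContDiff ℝ ∞ (X c)) :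
    ContDiff ℝ ∞ (frameDeriv X c g) :=
  (hg.fderiv_right (m := ∞) (by simp)).clm_apply hX

theorem frameDeriv_const (k : ℝ) : frameDeriv X c (fun _ => k) = fun _ => 0 := by
  ext x; simp [frameDeriv]

theorem frameDeriv_add (hf : ContDiff ℝ ∞ f) (hg : ContDiff ℝ ∞ g) :
    frameDeriv X c (fun x => f x + g x) = fun x => frameDeriv X c f x + frameDeriv X c g x := by
  ext x
  simp only [frameDeriv]
  rw [fderiv_fun_add (hf.differentiable (by simp) x) (hg.differentiable (by simp) x)]; rfl

theorem frameDeriv_sub (hf : ContDiff ℝ ∞ f) (hg : ContDiff ℝ ∞ g) :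
    frameDeriv X c (fun x => f x - g x) = fun x => frameDeriv X c f x - frameDeriv X c g x := by
  ext x
  simp only [frameDeriv]
  rw [fderiv_fun_sub (hf.differentiable (by simp) x) (hg.differentiable (by simp) x)]; rfl

theorem frameDeriv_neg : frameDeriv X c (fun x => -f x) = fun x => -frameDeriv X c f x := by
  ext x
  simp only [frameDeriv]
  rw [fderiv_fun_neg]; rfl

theorem frameDeriv_mul (hf : ContDiff ℝ ∞ f) (hg : ContDiff ℝ ∞ g) :
    frameDeriv X c (fun x => f x * g x) =
      fun x => frameDeriv X c f x * g x + f x * frameDeriv X c g x := by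
  ext x
  simp only [frameDeriv]
  rw [fderiv_fun_mul (hf.differentiable (by simp) x) (hg.differentiable (by simp) x)]
  simp; ring

theorem frameDeriv_const_mul (k : ℝ) (hf : ContDiff ℝ ∞ f) :
    frameDeriv X c (fun x => k * f x) = fun x => k * frameDeriv X c f x := by
  ext x
  simp only [frameDeriv]
  rw [fderiv_const_mul (hf.differentiable (by simp) x)]; simp

theorem frameDeriv_sq (hf : ContDiff ℝ ∞ f) :
    frameDeriv X c (fun x => f x ^ 2) = fun x => 2 * f x * frameDeriv X c f x := by
  simp only [sq, frameDeriv_mul hf hf]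
  ext x; ring

/-- The commutator of two derivatives along a frame. -/
theorem frameDeriv_comm {W : Type*} [NormedAddCommGroup W] [NormedSpace ℝ W] {d : Fin 4}
    {g : E 4 → W} (hg : ContDiff ℝ ∞ g) (hc : ContDiff ℝ ∞ (X c)) (hd : ContDiff ℝ ∞ (X d))
    (x : E 4) :
    frameDeriv X c (frameDeriv X d g) x - frameDeriv X d (frameDeriv X c g) x =
      fderiv ℝ g x (fderiv ℝ (X d) x (X c x) - fderiv ℝ (X c) x (X d x)) := by
  have h1 : DifferentiableAt ℝ (fderiv ℝ g) x :=
    (hg.fderiv_right (m := ∞) (by simp)).differentiable (by simp) x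
  have h2 := hc.differentiable (by simp) x
  have h3 := hd.differentiable (by simp) x
  have hs : IsSymmSndFDerivAt ℝ g x :=
    (hg.contDiffAt (x := x)).isSymmSndFDerivAt (by simpa using (WithTop.coe_le_coe.2 le_top : ((2 : ℕ∞) : WithTop ℕ∞) ≤ ∞))
  have e : ∀ c d, DifferentiableAt ℝ (X d) x → frameDeriv X c (frameDeriv X d g) x =
      fderiv ℝ (fderiv ℝ g) x (X c x) (X d x) + fderiv ℝ g x (fderiv ℝ (X d) x (X c x)) := by
    intro c d h
    unfold frameDeriv
    rw [fderiv_clm_apply h1 h]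
    simp [add_comm]
  rw [e c d h3, e d c h2, map_sub, hs.eq]
  abel

theorem FrameSystem.comm {l : Fin 3 → ℝ} {w : Fin 4 → Fin 4 → Fin 4 → E 4 → ℝ}
    {G : Fin 3 → Fin 3 → E 4 → ℝ} (h : FrameSystem l X w G) (hg : ContDiff ℝ ∞ g) (c d : Fin 4)
    (x : E 4) :
    frameDeriv X c (frameDeriv X d g) x - frameDeriv X d (frameDeriv X c g) x =
      ∑ b, (w c b d x - w d b c x) * frameDeriv X b g x := by
  rw [frameDeriv_comm hg (h.smoothX c) (h.smoothX d), h.bracket, map_sum]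
  simp [frameDeriv]

end FrameDeriv

theorem FrameSystem.false_of_generic {l : Fin 3 → ℝ} {X : Fin 4 → E 4 → E 4}
    {w : Fin 4 → Fin 4 → Fin 4 → E 4 → ℝ}
    {G : Fin 3 → Fin 3 → E 4 → ℝ} (h : FrameSystem l X w G)
    (hl : l 0 * l 1 * l 2 + l 0 + l 1 + l 2 = 0) (h0 : ∀ i, l i ≠ 0)
    (hn : ∀ i, 1 + l i * l (i + 1) ≠ 0) : False := by
  have hw : ∀ c a b, w c a b = fun _ => 0 := fun c a b => funext fun x => by
    obtain ⟨t, ht, -⟩ := h.codazzi x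
    exact ht.eq_zero hl h0 hn c a b
  -- The connection vanishes, so the curvature of the plane e₀, e₁ is zero, whereas the right-hand
  -- side of its Gauss equation reduces to |ν₀|².
  have := h.gauss 0 1 0 0 1
  simp only [hw, frameDeriv_const, coefC_eq] at this
  simp [Fin.sum_univ_three] at this
  exact (h.pos 0 0).ne' this

theorem FrameSystem.false_of_skewPair {r : ℝ} {X : Fin 4 → E 4 → E 4}
    {w : Fin 4 → Fin 4 → Fin 4 → E 4 → ℝ}
    {G : Fin 3 → Fin 3 → E 4 → ℝ} (h : FrameSystem ![r, 0, -r] X w G)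
    (h0 : r ≠ 0) (h1 : r ^ 2 ≠ 1) : False := by
  have hc := fun x => (h.codazzi x).imp fun t ht => (And.intro ht.1 (ht.1.of_skewPair h0 h1))
  have hw : ∀ c, w c 0 2 = fun _ => 0 := fun c => funext fun x => (hc x).choose_spec.2.1 c
  have hw' : ∀ c, w c 2 0 = fun _ => 0 := fun c => funext fun x => by
    have := (hc x).choose_spec.1.skew c 2 0
    simpa [hw] using this
  have s0 : ∀ c a, w c a a 0 = 0 := fun c a => (hc 0).choose_spec.1.self_eq_zero c a
  obtain ⟨hs, -, e1, e2, e3, e4⟩ := (hc 0).choose_spec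
  have hs' := hs.skew
  -- The curvature component of e₁, e₃ against e₀, e₂: every term on the left contains a vanishing
  -- coefficient, and the right is -r(|ν₀|² + |ν₂|²).
  have := h.gauss 0 0 2 1 3
  simp only [hw', frameDeriv_const, coefC_eq] at this
  have p0 := h.pos 0 0
  have p2 := h.pos 2 0
  have z1 := hs' 1 1 0
  have z2 := hs' 3 1 0
  have z3 := hs' 1 3 0
  have z4 := hs' 3 3 0
  simp only [e1, e2, e3, e4, neg_zero] at z1 z2 z3 z4
  simp [Fin.sum_univ_three, Fin.sum_univ_four, hw', s0, z1, z2, z3, z4] at this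
  have : r * (G 0 0 0 + G 2 2 0) = 0 := by linarith
  simp [h0] at this
  linarith

end

end Austere

/-! ### The Kähler case: connection in terms of the free coefficients -/

namespace Austere

section
/-- The tangential connection coefficients in the Kähler case. -/
def connForm (L : ℝ) (a p f : Fin 4 → ℝ) (c : Fin 4) : Fin 4 → Fin 4 → ℝ :=
  let b : Fin 4 → ℝ := ![-a 2, a 3, a 0, -a 1]
  ![![0, (1 + L) * a c, -p c, (1 - L) * b c],
    ![-((1 + L) * a c), 0, -((1 - L) * b c), f c],
    ![p c, (1 - L) * b c, 0, -((1 + L) * a c)],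
    ![-((1 - L) * b c), -f c, (1 + L) * a c, 0]]

/-- The normal connection coefficients in the Kähler case. -/
def normalForm (L : ℝ) (a p f : Fin 4 → ℝ) (c : Fin 4) : Fin 3 → Fin 3 → ℝ :=
  ![![![2 * (1 + L) * a 1, 4 * a 2, 2 * (1 + L) * a 3 + p 0 + f 0],
      ![-(1 - L) ^ 2 * a 2 - 2 * p 1, -2 * p 2, -(1 + L) ^ 2 * a 0 - 2 * p 3],
      ![2 * (1 - L) * a 3 - p 0 - f 0, 4 * a 0, -2 * (1 - L) * a 1]],
    ![![-2 * (1 + L) * a 0, -4 * a 3, 2 * (1 + L) * a 2 + p 1 + f 1],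
      ![(1 - L) ^ 2 * a 3 + 2 * L * p 0, 2 * p 3, -(1 + L) ^ 2 * a 1 - 2 * L * p 2],
      ![-2 * (1 - L) * a 2 - p 1 - f 1, 4 * a 1, -2 * (1 - L) * a 0]],
    ![![-2 * (1 + L) * a 3, -4 * a 0, 2 * (1 + L) * a 1 + p 2 + f 2],
      ![(1 - L) ^ 2 * a 0 + 2 * p 3, 2 * p 0, -(1 + L) ^ 2 * a 2 - 2 * p 1],
      ![2 * (1 - L) * a 1 - p 2 - f 2, 4 * a 2, 2 * (1 - L) * a 3]],
    ![![2 * (1 + L) * a 2, 4 * a 1, 2 * (1 + L) * a 0 + p 3 + f 3],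
      ![-(1 - L) ^ 2 * a 1 - 2 * L * p 2, -2 * p 1, -(1 + L) ^ 2 * a 3 - 2 * L * p 0],
      ![-2 * (1 - L) * a 0 - p 3 - f 3, 4 * a 3, 2 * (1 - L) * a 2]]] c

/-- For L ≠ 0 the equations also force w c 1 3 = -w c 0 2, that is, f = p. The resulting w commutes
with the complex structure J e₀ = e₂, J e₁ = -e₃, so J is parallel and the metric is Kähler. -/
theorem Codazzi.kahler {L : ℝ} {w : Fin 4 → Fin 4 → Fin 4 → ℝ} {t : Fin 4 → Fin 3 → Fin 3 → ℝ}
    (h : Codazzi ![1, L, -1] w t) (h0 : L ≠ 0)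
    (h1 : 1 + L ≠ 0) {a p : Fin 4 → ℝ} (ha : ∀ c, w c 0 1 = (1 + L) * a c)
    (hp : ∀ c, w c 0 2 = -p c) :
    (∀ c i j, w c i j = connForm L a p p c i j) ∧ ∀ c i j, t c i j = normalForm L a p p c i j := by
  obtain ⟨a1, a2, a3, a4, a5, a6, a7, a8, a9, a10, a11, a12, a13⟩ :=
    h.kahler_block_zero h0 h1 ha hp
  obtain ⟨b1, b2, b3, b4, b5, b6, b7, b8, b9, b10, b11, b12, b13⟩ :=
    h.kahler_block_one h0 h1 ha hp
  obtain ⟨c1, c2, c3, c4, c5, c6, c7, c8, c9, c10, c11, c12, c13⟩ :=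
    h.kahler_block_two h0 h1 ha hp
  obtain ⟨d1, d2, d3, d4, d5, d6, d7, d8, d9, d10, d11, d12, d13⟩ :=
    h.kahler_block_three h0 h1 ha hp
  have s0 := h.self_eq_zero
  have s10 := fun c => h.skew c 1 0
  have s20 := fun c => h.skew c 2 0
  have s30 := fun c => h.skew c 3 0
  have s21 := fun c => h.skew c 2 1
  have s31 := fun c => h.skew c 3 1
  have s32 := fun c => h.skew c 3 2
  constructor
  · intro c i j
    fin_cases c <;> fin_cases i <;> fin_cases j <;>
      simp [connForm, *] <;> ring
  · intro c i j
    fin_cases c <;> fin_cases i <;> fin_cases j <;> simp [normalForm, *] <;> ring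

theorem Codazzi.degenerate {w : Fin 4 → Fin 4 → Fin 4 → ℝ} {t : Fin 4 → Fin 3 → Fin 3 → ℝ}
    (h : Codazzi ![1, 0, -1] w t) {a p f : Fin 4 → ℝ} (ha : ∀ c, w c 0 1 = a c)
    (hp : ∀ c, w c 0 2 = -p c) (hf : ∀ c, w c 1 3 = f c) :
    (∀ c i j, w c i j = connForm 0 a p f c i j) ∧ ∀ c i j, t c i j = normalForm 0 a p f c i j := by
  obtain ⟨a1, a2, a3, a4, a5, a6, a7, a8, a9, a10, a11, a12⟩ :=
    h.degenerate_block_zero ha hp hf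
  obtain ⟨b1, b2, b3, b4, b5, b6, b7, b8, b9, b10, b11, b12⟩ :=
    h.degenerate_block_one ha hp hf
  obtain ⟨c1, c2, c3, c4, c5, c6, c7, c8, c9, c10, c11, c12⟩ :=
    h.degenerate_block_two ha hp hf
  obtain ⟨d1, d2, d3, d4, d5, d6, d7, d8, d9, d10, d11, d12⟩ :=
    h.degenerate_block_three ha hp hf
  have s0 := h.self_eq_zero
  have s10 := fun c => h.skew c 1 0
  have s20 := fun c => h.skew c 2 0
  have s30 := fun c => h.skew c 3 0
  have s21 := fun c => h.skew c 2 1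
  have s31 := fun c => h.skew c 3 1
  have s32 := fun c => h.skew c 3 2
  constructor
  · intro c i j
    fin_cases c <;> fin_cases i <;> fin_cases j <;>
      simp [connForm, *]
  · intro c i j
    fin_cases c <;> fin_cases i <;> fin_cases j <;> simp [normalForm, *]

/-- The frame equations in the Kähler case, solved for the connection coefficients. -/
structure KahlerSystem (L : ℝ) (X : Fin 4 → E 4 → E 4) (a p f : Fin 4 → E 4 → ℝ)
    (G : Fin 3 → Fin 3 → E 4 → ℝ) : Prop where
  smoothX : ∀ c, ContDiff ℝ ∞ (X c)
  smoothA : ∀ c, ContDiff ℝ ∞ (a c)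
  smoothP : ∀ c, ContDiff ℝ ∞ (p c)
  smoothF : ∀ c, ContDiff ℝ ∞ (f c)
  smoothG : ∀ i j, ContDiff ℝ ∞ (G i j)
  pos : ∀ i x, 0 < G i i x
  symm : ∀ i j, G i j = G j i
  comm : ∀ (g : E 4 → ℝ), ContDiff ℝ ∞ g → ∀ c d x,
    frameDeriv X c (frameDeriv X d g) x - frameDeriv X d (frameDeriv X c g) x =
      ∑ b, (connForm L (a · x) (p · x) (f · x) c b d - connForm L (a · x) (p · x) (f · x) d b c) *
        frameDeriv X b g x
  deriv : ∀ c i j x, frameDeriv X c (G i j) x =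
    ∑ k, (normalForm L (a · x) (p · x) (f · x) c k i * G k j x +
      normalForm L (a · x) (p · x) (f · x) c k j * G i k x)
  gauss : ∀ x, GaussEq ![1, L, -1] (connForm L (a · x) (p · x) (f · x))
    (fun c => connForm L (fun d => frameDeriv X c (a d) x) (fun d => frameDeriv X c (p d) x)
      (fun d => frameDeriv X c (f d) x)) (fun i j => G i j x)

theorem frameDeriv_connForm {L : ℝ} {X : Fin 4 → E 4 → E 4} {a p f : Fin 4 → E 4 → ℝ}
    (ha : ∀ c, ContDiff ℝ ∞ (a c)) (c d i j : Fin 4) (x : E 4) :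
    frameDeriv X c (fun x => connForm L (a · x) (p · x) (f · x) d i j) x =
    connForm L (fun d => frameDeriv X c (a d) x) (fun d => frameDeriv X c (p d) x)
      (fun d => frameDeriv X c (f d) x) d i j := by
  fin_cases d <;> fin_cases i <;> fin_cases j <;>
    simp [connForm, frameDeriv_const, frameDeriv_neg, frameDeriv_const_mul, ha]

theorem FrameSystem.kahler {L : ℝ} {X : Fin 4 → E 4 → E 4}
    {w : Fin 4 → Fin 4 → Fin 4 → E 4 → ℝ} {G : Fin 3 → Fin 3 → E 4 → ℝ}
    (h : FrameSystem ![1, L, -1] X w G) (h1 : 1 + L ≠ 0) (a p f : Fin 4 → E 4 → ℝ)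
    (ha : ∀ c, a c = fun x => (1 + L)⁻¹ * w c 0 1 x) (hp : ∀ c, p c = fun x => -w c 0 2 x)
    (hf : ∀ c, f c = fun x => w c 1 3 x) (hf' : L ≠ 0 → f = p) :
    KahlerSystem L X a p f G := by
  have key : ∀ x, (∀ c i j, w c i j x = connForm L (a · x) (p · x) (f · x) c i j) ∧
      ∀ c i j, frameDeriv X c (G i j) x =
        ∑ k, (normalForm L (a · x) (p · x) (f · x) c k i * G k j x +
      normalForm L (a · x) (p · x) (f · x) c k j * G i k x) := by
    intro x
    obtain ⟨t, ht, hG⟩ := h.codazzi x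
    have ha' : ∀ c, w c 0 1 x = (1 + L) * a c x := fun c => by rw [ha]; field_simp
    have hp' : ∀ c, w c 0 2 x = - p c x := fun c => by rw [hp]; simp
    have hf'' : ∀ c, w c 1 3 x = f c x := fun c => by rw [hf]
    by_cases hL : L = 0
    · subst hL
      simp only [add_zero, one_mul] at ha'
      obtain ⟨e1, e2⟩ := ht.degenerate ha' hp' hf''
      exact ⟨e1, fun c i j => by simp only [hG, e2]⟩
    · rw [hf' hL]
      obtain ⟨e1, e2⟩ := ht.kahler hL h1 ha' hp'
      exact ⟨e1, fun c i j => by simp only [hG, e2]⟩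
  have hw : ∀ c i j, w c i j = fun x => connForm L (a · x) (p · x) (f · x) c i j :=
    fun c i j => funext fun x => (key x).1 c i j
  have sa : ∀ c, ContDiff ℝ ∞ (a c) := fun c => by
    rw [ha]; exact contDiff_const.mul (h.smoothW _ _ _)
  refine ⟨h.smoothX, sa, fun c => ?_, fun c => ?_, h.smoothG, h.pos, h.symm, ?_, ?_, ?_⟩
  · rw [hp]; exact (h.smoothW _ _ _).neg
  · rw [hf]; exact h.smoothW _ _ _
  · intro g hg c d x
    simpa only [hw] using h.comm hg c d x
  · exact fun c i j x => (key x).2 c i j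
  · intro x
    have := h.gauss x
    simpa only [hw, frameDeriv_connForm sa] using this

end

end Austere

/-! ### The Kähler case with L ≠ 0: Gauss equations -/

namespace Austere

section
section Pointwise

variable {L : ℝ} {a p : Fin 4 → ℝ} {d e : Fin 4 → Fin 4 → ℝ} {G : Fin 3 → Fin 3 → ℝ}

/-- As J is parallel and f = p, the curvature components occur in pairs equal up to sign. In each
sum of two such Gauss equations all derivatives of the connection cancel, and an algebraic relation
between G and a is left. -/
theorem GaussEq.kahler_gram (hG : ∀ i j, G i j = G j i)
    (h : GaussEq ![1, L, -1] (connForm L a p p) (fun c => connForm L (d c) (e c) (e c)) G) :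
    G 0 2 = 0 ∧ G 0 0 - G 2 2 = L * G 1 1 ∧
    (1 - L) * (G 0 1 - 4 * (1 + L) * (a 0 * a 3 + a 1 * a 2)) = 0 ∧
    (1 + L) * (G 1 2 - 4 * (1 - L) * (a 2 * a 3 - a 0 * a 1)) = 0 ∧
    G 1 1 - (G 0 0 + G 2 2) = 4 * (1 - L ^ 2) * (a 0 ^ 2 + a 2 ^ 2) ∧
    G 0 0 + G 2 2 - L ^ 2 * G 1 1 = 4 * (1 - L ^ 2) * (a 1 ^ 2 + a 3 ^ 2) := by
  have g10 := hG 1 0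
  have g20 := hG 2 0
  have g21 := hG 2 1
  have h1 := h 1 0 0 1
  have h2 := h 3 2 0 1
  have h3 := h 3 0 0 1
  have h4 := h 2 1 0 1
  have h5 := h 2 0 0 1
  have h6 := h 3 1 0 1
  have h7 := h 2 0 0 3
  have h8 := h 3 1 0 3
  have h9 := h 2 0 0 2
  have h10 := h 3 1 0 2
  have h11 := h 2 0 1 3
  have h12 := h 3 1 1 3
  clear h
  simp [connForm, coefC_eq, Fin.sum_univ_four, Fin.sum_univ_three]
    at h1 h2 h3 h4 h5 h6 h7 h8 h9 h10 h11 h12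
  rw [g10] at *
  rw [g20] at *
  rw [g21] at *
  refine ⟨?_, ?_, ?_, ?_, ?_, ?_⟩
  · linear_combination (h3 + h4) / 2
  · linear_combination h1 + h2
  · linear_combination h5 + h6
  · linear_combination h7 + h8
  · linear_combination h9 + h10
  · linear_combination -(h11 + h12)

/-- Once G is expressed through a, the Gauss equations for w 0 1 and w 0 3 give half of the first
derivatives of a; derivatives of p do not enter them. -/
theorem GaussEq.kahler_deriv (hG : ∀ i j, G i j = G j i) (hp : 1 + L ≠ 0) (hm : 1 - L ≠ 0)
    (h : GaussEq ![1, L, -1] (connForm L a p p) (fun c => connForm L (d c) (e c) (e c)) G) :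
    (d 0 0 + d 2 2 = 2 * (a 0 * a 1 - a 2 * a 3) + (p 0 * a 2 - p 2 * a 0)) ∧
    (d 0 2 - d 2 0 = -2 * (a 0 * a 3 + a 2 * a 1) - (p 0 * a 0 + p 2 * a 2)) ∧
    (d 0 1 - d 2 3 = -2 * L * (a 0 ^ 2 + a 2 ^ 2) - (p 0 * a 3 + p 2 * a 1)) ∧
    (-(d 0 3 + d 2 1) = p 2 * a 3 - p 0 * a 1) ∧
    (d 1 0 - d 3 2 = 2 * (a 1 ^ 2 + a 3 ^ 2) + (p 1 * a 2 + p 3 * a 0)) ∧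
    (d 1 2 + d 3 0 = p 3 * a 2 - p 1 * a 0) ∧
    (d 1 1 + d 3 3 = -2 * L * (a 0 * a 1 - a 2 * a 3) - (p 1 * a 3 - p 3 * a 1)) ∧
    (d 3 1 - d 1 3 = -2 * L * (a 0 * a 3 + a 2 * a 1) - (p 1 * a 1 + p 3 * a 3)) := by
  obtain ⟨k1, k2, k3, k4, k5, k6⟩ := h.kahler_gram hG
  have k3 := (mul_eq_zero.1 k3).resolve_left hm
  have k4 := (mul_eq_zero.1 k4).resolve_left hp
  have hL : 1 - L ^ 2 ≠ 0 := by
    have := mul_ne_zero hp hm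
    intro h0; apply this; linear_combination h0
  have kN : G 1 1 = 4 * (a 0 ^ 2 + a 1 ^ 2 + a 2 ^ 2 + a 3 ^ 2) := by
    apply mul_left_cancel₀ hL
    linear_combination k5 + k6
  have g10 := hG 1 0
  have g20 := hG 2 0
  have g21 := hG 2 1
  have h1 := h 1 0 0 1
  have h2 := h 3 0 0 1
  have h3 := h 1 0 2 3
  have h4 := h 3 0 2 3
  have h5 := h 1 0 0 3
  have h6 := h 3 0 0 3
  have h7 := h 1 0 1 2
  have h8 := h 3 0 1 2
  have h9 := h 1 0 0 2
  have h10 := h 3 0 0 2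
  have h11 := h 1 0 1 3
  have h12 := h 3 0 1 3
  clear h
  simp [connForm, coefC_eq, Fin.sum_univ_four, Fin.sum_univ_three]
    at h1 h2 h3 h4 h5 h6 h7 h8 h9 h10 h11 h12
  rw [g10] at *
  rw [g20] at *
  rw [g21] at *
  have G0 : G 0 0 = 2 * (1 + L) * (L * (a 0 ^ 2 + a 2 ^ 2) + a 1 ^ 2 + a 3 ^ 2) := by
    linear_combination (k2 - k5 + (1 + L) * kN) / 2
  have G2 : G 2 2 = 2 * (1 - L) * (a 1 ^ 2 + a 3 ^ 2 - L * (a 0 ^ 2 + a 2 ^ 2)) := by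
    linear_combination G0 - k2 - L * kN
  have G01 : G 0 1 = 4 * (1 + L) * (a 0 * a 3 + a 1 * a 2) := by linear_combination k3
  have G12 : G 1 2 = 4 * (1 - L) * (a 2 * a 3 - a 0 * a 1) := by linear_combination k4
  simp only [G0, G2, G01, G12, k1, kN] at h1 h2 h3 h4 h5 h6 h7 h8 h9 h10 h11 h12
  refine ⟨?_, ?_, ?_, ?_, ?_, ?_, ?_, ?_⟩
  · apply mul_left_cancel₀ hm; linear_combination h10
  · apply mul_left_cancel₀ hp; linear_combination h9
  · apply mul_left_cancel₀ hp; apply mul_left_cancel₀ hm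
    linear_combination (1 - L) * h1 + (1 + L) * h8
  · apply mul_left_cancel₀ hp; apply mul_left_cancel₀ hm
    linear_combination -(1 + L) * h2 + (1 - L) * h7
  · apply mul_left_cancel₀ hp; apply mul_left_cancel₀ hm
    linear_combination -(1 - L) * h1 - (1 + L) * h6
  · apply mul_left_cancel₀ hp; apply mul_left_cancel₀ hm
    linear_combination (1 + L) * h2 - (1 - L) * h5
  · apply mul_left_cancel₀ hm; linear_combination -h12
  · apply mul_left_cancel₀ hp; linear_combination -h11

end Pointwise

end

end Austere

namespace Austere

section
variable {L : ℝ} {X : Fin 4 → E 4 → E 4} {a p f : Fin 4 → E 4 → ℝ} {G : Fin 3 → Fin 3 → E 4 → ℝ}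

theorem KahlerSystem.gram_eq (h : KahlerSystem L X a p p G) (hp : 1 + L ≠ 0) (hm : 1 - L ≠ 0) :
    G 0 2 = (fun _ => 0) ∧
    G 1 1 = (fun x => 4 * (a 0 x ^ 2 + a 1 x ^ 2 + a 2 x ^ 2 + a 3 x ^ 2)) ∧
    G 0 0 = (fun x => 2 * (1 + L) * (L * (a 0 x ^ 2 + a 2 x ^ 2) + (a 1 x ^ 2 + a 3 x ^ 2))) ∧
    G 2 2 = (fun x => 2 * (1 - L) * ((a 1 x ^ 2 + a 3 x ^ 2) - L * (a 0 x ^ 2 + a 2 x ^ 2))) ∧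
    G 0 1 = (fun x => 4 * (1 + L) * (a 0 x * a 3 x + a 1 x * a 2 x)) ∧
    G 1 2 = (fun x => 4 * (1 - L) * (a 2 x * a 3 x - a 0 x * a 1 x)) := by
  have hL : 1 - L ^ 2 ≠ 0 := by
    have := mul_ne_zero hp hm
    intro h0; apply this; linear_combination h0
  have hN : ∀ x, G 1 1 x = 4 * (a 0 x ^ 2 + a 1 x ^ 2 + a 2 x ^ 2 + a 3 x ^ 2) := fun x => by
    obtain ⟨-, -, -, -, k5, k6⟩ := (h.gauss x).kahler_gram fun i j => by rw [h.symm]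
    apply mul_left_cancel₀ hL
    linear_combination k5 + k6
  refine ⟨?_, funext hN, ?_, ?_, ?_, ?_⟩ <;> ext x <;>
    obtain ⟨k1, k2, k3, k4, k5, k6⟩ := (h.gauss x).kahler_gram fun i j => by rw [h.symm]
  · exact k1
  · linear_combination (k2 - k5 + (1 + L) * hN x) / 2
  · linear_combination (-k2 - k5 + (1 - L) * hN x) / 2
  · linear_combination (mul_eq_zero.1 k3).resolve_left hm
  · linear_combination (mul_eq_zero.1 k4).resolve_left hp

/-- Two expressions for the derivative of G are compared: that of the quadratic formulas of
`gram_eq`, and that given by the normal connection. The entries G 0 0 and G 2 2 enter only through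
their sum. -/
theorem KahlerSystem.deriv_gram (h : KahlerSystem L X a p p G) (hp : 1 + L ≠ 0) (hm : 1 - L ≠ 0)
    (c : Fin 4) (x : E 4) :
    let d := fun e => frameDeriv X c (a e) x
    let t := normalForm L (a · x) (p · x) (p · x) c
    8 * (a 0 x * d 0 + a 1 x * d 1 + a 2 x * d 2 + a 3 x * d 3) =
      2 * (t 0 1 * G 0 1 x + t 1 1 * G 1 1 x + t 2 1 * G 1 2 x) ∧
    8 * (L ^ 2 * (a 0 x * d 0 + a 2 x * d 2) + a 1 x * d 1 + a 3 x * d 3) =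
      2 * (t 0 0 * G 0 0 x + t 1 0 * G 0 1 x + t 1 2 * G 1 2 x + t 2 2 * G 2 2 x) ∧
    4 * (1 + L) * (a 0 x * d 3 + a 3 x * d 0 + a 1 x * d 2 + a 2 x * d 1) =
      t 0 0 * G 0 1 x + t 1 0 * G 1 1 x + t 2 0 * G 1 2 x + t 0 1 * G 0 0 x + t 1 1 * G 0 1 x ∧
    4 * (1 - L) * (a 2 x * d 3 + a 3 x * d 2 - a 0 x * d 1 - a 1 x * d 0) =
      t 1 1 * G 1 2 x + t 2 1 * G 2 2 x + t 0 2 * G 0 1 x + t 1 2 * G 1 1 x + t 2 2 * G 1 2 x := by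
  intro d t
  obtain ⟨k1, k2, k3, k4, k5, k6⟩ := h.gram_eq hp hm
  have s10 := h.symm 1 0
  have s20 := h.symm 2 0
  have s21 := h.symm 2 1
  have z : G 0 2 x = 0 := by rw [k1]
  have e11 := h.deriv c 1 1 x
  have e00 := h.deriv c 0 0 x
  have e22 := h.deriv c 2 2 x
  have e01 := h.deriv c 0 1 x
  have e12 := h.deriv c 1 2 x
  rw [Fin.sum_univ_three] at e11 e00 e22 e01 e12
  change _ = t 0 1 * G 0 1 x + t 0 1 * G 1 0 x + (t 1 1 * G 1 1 x + t 1 1 * G 1 1 x) +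
    (t 2 1 * G 2 1 x + t 2 1 * G 1 2 x) at e11
  change _ = t 0 0 * G 0 0 x + t 0 0 * G 0 0 x + (t 1 0 * G 1 0 x + t 1 0 * G 0 1 x) +
    (t 2 0 * G 2 0 x + t 2 0 * G 0 2 x) at e00
  change _ = t 0 2 * G 0 2 x + t 0 2 * G 2 0 x + (t 1 2 * G 1 2 x + t 1 2 * G 2 1 x) +
    (t 2 2 * G 2 2 x + t 2 2 * G 2 2 x) at e22
  change _ = t 0 0 * G 0 1 x + t 0 1 * G 0 0 x + (t 1 0 * G 1 1 x + t 1 1 * G 0 1 x) +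
    (t 2 0 * G 2 1 x + t 2 1 * G 0 2 x) at e01
  change _ = t 0 1 * G 0 2 x + t 0 2 * G 1 0 x + (t 1 1 * G 1 2 x + t 1 2 * G 1 1 x) +
    (t 2 1 * G 2 2 x + t 2 2 * G 1 2 x) at e12
  rw [s10] at e11 e00 e12
  rw [s21] at e11 e22 e01
  rw [s20] at e00 e22
  rw [z] at e00 e22 e01 e12
  have sa := h.smoothA
  have q11 : frameDeriv X c (G 1 1) x =
      8 * (a 0 x * d 0 + a 1 x * d 1 + a 2 x * d 2 + a 3 x * d 3) := by
    rw [k2]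
    simp (disch := fun_prop) only [frameDeriv_add, frameDeriv_const_mul, frameDeriv_sq]
    ring
  have q00 : frameDeriv X c (G 0 0) x = 4 * (1 + L) *
      (L * (a 0 x * d 0 + a 2 x * d 2) + a 1 x * d 1 + a 3 x * d 3) := by
    rw [k3]
    simp (disch := fun_prop) only [frameDeriv_add, frameDeriv_const_mul, frameDeriv_sq]
    ring
  have q22 : frameDeriv X c (G 2 2) x = 4 * (1 - L) *
      (a 1 x * d 1 + a 3 x * d 3 - L * (a 0 x * d 0 + a 2 x * d 2)) := by
    rw [k4]
    simp (disch := fun_prop) only [frameDeriv_add, frameDeriv_sub, frameDeriv_const_mul,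
      frameDeriv_sq]
    ring
  have q01 : frameDeriv X c (G 0 1) x = 4 * (1 + L) *
      (a 0 x * d 3 + a 3 x * d 0 + a 1 x * d 2 + a 2 x * d 1) := by
    rw [k5]
    simp (disch := fun_prop) only [frameDeriv_add, frameDeriv_const_mul, frameDeriv_mul]
    ring
  have q12 : frameDeriv X c (G 1 2) x = 4 * (1 - L) *
      (a 2 x * d 3 + a 3 x * d 2 - a 0 x * d 1 - a 1 x * d 0) := by
    rw [k6]
    simp (disch := fun_prop) only [frameDeriv_sub, frameDeriv_const_mul, frameDeriv_mul]
    ring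
  refine ⟨?_, ?_, ?_, ?_⟩
  · linear_combination e11 - q11
  · linear_combination e00 + e22 - q00 - q22
  · linear_combination e01 - q01
  · linear_combination e12 - q12

end

end Austere

namespace Austere

section
variable {L : ℝ} {X : Fin 4 → E 4 → E 4} {a p f : Fin 4 → E 4 → ℝ} {G : Fin 3 → Fin 3 → E 4 → ℝ}

set_option maxHeartbeats 1000000 in
theorem KahlerSystem.false_of_ne (h : KahlerSystem L X a p p G) (hL : 0 < L) (hm : 1 - L ≠ 0) :
    False := by
  have hp : 1 + L ≠ 0 := by positivity
  obtain ⟨-, k2, k3, k4, k5, k6⟩ := h.gram_eq hp hm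
  -- Up to the factor 2(1 - L) this is |ν₂|²; the contradiction will be its vanishing.
  have hpos : (a 1 0 ^ 2 + a 3 0 ^ 2) - L * (a 0 0 ^ 2 + a 2 0 ^ 2) ≠ 0 := by
    intro h0
    have := h.pos 2 0
    rw [k4] at this
    simp [h0] at this
  obtain ⟨r1, r2, r3, r4, r5, r6, r7, r8⟩ :=
    (h.gauss 0).kahler_deriv (fun i j => by rw [h.symm]) hp hm
  have E0 := h.deriv_gram hp hm 0 0
  have E1 := h.deriv_gram hp hm 1 0
  have E2 := h.deriv_gram hp hm 2 0
  have E3 := h.deriv_gram hp hm 3 0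
  simp only [k2, k3, k4, k5, k6] at E0 E1 E2 E3
  simp only [normalForm, Matrix.cons_val] at E0 E1 E2 E3
  obtain ⟨n0, p0, u0, v0⟩ := E0
  obtain ⟨n1, p1, u1, v1⟩ := E1
  obtain ⟨n2, p2, u2, v2⟩ := E2
  obtain ⟨n3, p3, u3, v3⟩ := E3
  generalize hd : (fun c e => frameDeriv X c (a e) 0) = d at *
  have hd' : ∀ c e, frameDeriv X c (a e) 0 = d c e := fun c e => by rw [← hd]
  simp only [hd'] at *
  clear hd hd' k2 k3 k4 k5 k6 h
  generalize ha0 : (fun e => a e 0) = α at *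
  generalize hp0 : (fun e => p e 0) = π at *
  have ha' : ∀ e, a e 0 = α e := fun e => by rw [← ha0]
  have hp' : ∀ e, p e 0 = π e := fun e => by rw [← hp0]
  simp only [ha', hp'] at *
  clear ha0 hp0 ha' hp'
  -- Taking norms turns B² + L A² = 0, or its conjugate, into |B|² = L |A|², which contradicts
  -- `hpos`. This uses L > 0.
  have lam : ∀ (x y u v : ℝ), (⟨x, y⟩ : ℂ) ^ 2 + L * (⟨u, v⟩ : ℂ) ^ 2 = 0 →
      x ^ 2 + y ^ 2 = L * (u ^ 2 + v ^ 2) := by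
    intro x y u v hz
    have h1 := eq_neg_of_add_eq_zero_left hz
    have h2 := congrArg (‖·‖) h1
    simp only [norm_neg, norm_mul, norm_pow, Complex.norm_real, Real.norm_of_nonneg hL.le] at h2
    rw [Complex.sq_norm, Complex.sq_norm, Complex.normSq_mk, Complex.normSq_mk] at h2
    linear_combination h2
  by_cases hq : (⟨α 1, -α 3⟩ : ℂ) ^ 2 + L * (⟨α 0, α 2⟩ : ℂ) ^ 2 = 0
  · have := lam _ _ _ _ hq
    apply hpos; linear_combination this
  have hL2 : (1 - L ^ 2 : ℂ) ≠ 0 := by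
    have := mul_ne_zero hp hm
    intro h0
    apply this
    exact_mod_cast (by push_cast; linear_combination h0 :
      (((1 + L) * (1 - L) : ℝ) : ℂ) = ((0 : ℝ) : ℂ))
  -- The directions e₀, e₂ and e₁, e₃ are combined into complex ones: A = a₀ + i a₂, B = a₁ - i a₃,
  -- with A', B' their conjugates. The relations r1–r8 remove half of the derivatives; the other
  -- half are the complex unknowns a, b, c, d.
  have := lam _ _ _ _ (kahler_elimination (A := ⟨α 0, α 2⟩) (A' := ⟨α 0, -α 2⟩)
    (B := ⟨α 1, -α 3⟩) (B' := ⟨α 1, α 3⟩) (s := ⟨π 0, -π 2⟩) (s' := ⟨π 1, π 3⟩)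
    (a := ⟨d 0 0 - d 2 2, -(d 0 2 + d 2 0)⟩) (b := ⟨d 0 1 + d 2 3, d 0 3 - d 2 1⟩)
    (c := ⟨d 1 0 + d 3 2, d 3 0 - d 1 2⟩) (d := ⟨d 1 1 - d 3 3, d 1 3 + d 3 1⟩)
    ?_ ?_ ?_ ?_ ?_ ?_ ?_ ?_ hq hL2)
  · apply hpos; linear_combination this
  all_goals
    clear lam hq hL2
    simp only [Complex.ext_iff, sq, pow_three]
    simp
  · constructor
    · linear_combination n0 / 4 - (α 0 * r1 + α 2 * r2) - (α 1 * r3 - α 3 * r4)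
    · linear_combination -n2 / 4 - (α 0 * r2 - α 2 * r1) - (α 1 * r4 + α 3 * r3)
  · constructor
    · linear_combination p0 / 4 - L ^ 2 * (α 0 * r1 + α 2 * r2) - (α 1 * r3 - α 3 * r4)
    · linear_combination -p2 / 4 - L ^ 2 * (α 0 * r2 - α 2 * r1) - (α 1 * r4 + α 3 * r3)
  · constructor
    · linear_combination -v0 / 4 + u2 / 4 - (α 1 * r1 - α 3 * r2) + L * (α 0 * r3 + α 2 * r4)
    · linear_combination v2 / 4 + u0 / 4 - (α 1 * r2 + α 3 * r1) + L * (α 0 * r4 - α 2 * r3)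
  · constructor
    · linear_combination -v0 / 4 - u2 / 4 - (α 0 * r3 + α 2 * r4) + L * (α 1 * r1 - α 3 * r2)
    · linear_combination v2 / 4 - u0 / 4 - (α 0 * r4 - α 2 * r3) + L * (α 1 * r2 + α 3 * r1)
  · constructor
    · linear_combination n1 / 4 - (α 0 * r5 + α 2 * r6) - (α 1 * r7 - α 3 * r8)
    · linear_combination n3 / 4 - (α 0 * r6 - α 2 * r5) - (α 1 * r8 + α 3 * r7)
  · constructor
    · linear_combination p1 / 4 - L ^ 2 * (α 0 * r5 + α 2 * r6) - (α 1 * r7 - α 3 * r8)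
    · linear_combination p3 / 4 - L ^ 2 * (α 0 * r6 - α 2 * r5) - (α 1 * r8 + α 3 * r7)
  · constructor
    · linear_combination -v1 / 4 - u3 / 4 - (α 1 * r5 - α 3 * r6) + L * (α 0 * r7 + α 2 * r8)
    · linear_combination -v3 / 4 + u1 / 4 - (α 1 * r6 + α 3 * r5) + L * (α 0 * r8 - α 2 * r7)
  · constructor
    · linear_combination -v1 / 4 + u3 / 4 - (α 0 * r7 + α 2 * r8) + L * (α 1 * r5 - α 3 * r6)
    · linear_combination -v3 / 4 - u1 / 4 - (α 0 * r8 - α 2 * r7) + L * (α 1 * r6 + α 3 * r5)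

end

end Austere

/-! ### The degenerate Kähler case, parameters (1, 0, -1) -/

namespace Austere

section
variable {X : Fin 4 → E 4 → E 4} {a p f : Fin 4 → E 4 → ℝ} {G : Fin 3 → Fin 3 → E 4 → ℝ}

theorem KahlerSystem.degenerate_gram (h : KahlerSystem 0 X a p f G) :
    G 0 2 = (fun _ => 0) ∧ G 2 2 = G 0 0 := by
  constructor <;> ext x
  all_goals
    have h1 := h.gauss x 1 0 0 1
    have h2 := h.gauss x 3 2 0 1
    have h3 := h.gauss x 3 0 0 1
    have h4 := h.gauss x 2 1 0 1
    simp [connForm, coefC_eq, Fin.sum_univ_four, Fin.sum_univ_three] at h1 h2 h3 h4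
  · linear_combination (h3 + h4) / 2 + congrFun (h.symm 0 2) x
  · linear_combination -(h1 + h2)

theorem KahlerSystem.degenerate_deriv (h : KahlerSystem 0 X a p f G) (c : Fin 4) (x : E 4) :
    let t := normalForm 0 (a · x) (p · x) (f · x) c
    frameDeriv X c (G 0 0) x = 2 * (t 0 0 * G 0 0 x + t 1 0 * G 0 1 x) ∧
    frameDeriv X c (G 1 1) x = 2 * (t 0 1 * G 0 1 x + t 1 1 * G 1 1 x + t 2 1 * G 1 2 x) ∧
    frameDeriv X c (G 0 0) x = 2 * (t 1 2 * G 1 2 x + t 2 2 * G 0 0 x) ∧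
    frameDeriv X c (G 0 1) x = t 0 0 * G 0 1 x + t 1 0 * G 1 1 x + t 2 0 * G 1 2 x +
      t 0 1 * G 0 0 x + t 1 1 * G 0 1 x ∧
    frameDeriv X c (G 1 2) x = t 1 1 * G 1 2 x + t 2 1 * G 0 0 x + t 0 2 * G 0 1 x +
      t 1 2 * G 1 1 x + t 2 2 * G 1 2 x ∧
    t 1 0 * G 1 2 x + (t 2 0 + t 0 2) * G 0 0 x + t 1 2 * G 0 1 x = 0 := by
  intro t
  obtain ⟨k1, k2⟩ := h.degenerate_gram
  have s10 := h.symm 1 0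
  have s20 := h.symm 2 0
  have s21 := h.symm 2 1
  have e11 := h.deriv c 1 1 x
  have e00 := h.deriv c 0 0 x
  have e22 := h.deriv c 2 2 x
  have e01 := h.deriv c 0 1 x
  have e12 := h.deriv c 1 2 x
  have e02 := h.deriv c 0 2 x
  simp only [Fin.sum_univ_three, k1, k2, s10, s20, s21, mul_zero, add_zero, zero_add,
    frameDeriv_const] at e11 e00 e22 e01 e12 e02
  refine ⟨?_, ?_, ?_, ?_, ?_, ?_⟩
  · linear_combination e00
  · linear_combination e11
  · linear_combination e22
  · linear_combination e01
  · linear_combination e12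
  · linear_combination -e02

theorem eq_zero_of_sq_add_sq {x y : ℝ} (h : x ^ 2 + y ^ 2 = 0) : x = 0 ∧ y = 0 := by
  constructor <;> nlinarith [sq_nonneg x, sq_nonneg y]

/-- G 0 2 vanishes identically and G 2 2 = G 0 0, so the formula for the derivative of G 0 2 is an
algebraic relation in each of the four directions. The vector (G 0 1, G 1 2) either vanishes or can
be divided out. -/
theorem KahlerSystem.degenerate_vanish (h : KahlerSystem 0 X a p f G) (x : E 4) :
    a 1 x = 0 ∧ a 3 x = 0 ∧ (a 2 x + 2 * p 1 x) * (G 0 1 x ^ 2 + G 1 2 x ^ 2) = 0 ∧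
      (a 0 x + 2 * p 3 x) * (G 0 1 x ^ 2 + G 1 2 x ^ 2) = 0 := by
  obtain ⟨-, -, -, -, -, e0⟩ := h.degenerate_deriv 0 x
  obtain ⟨-, -, -, -, -, e1⟩ := h.degenerate_deriv 1 x
  obtain ⟨-, -, -, -, -, e2⟩ := h.degenerate_deriv 2 x
  obtain ⟨-, -, -, -, -, e3⟩ := h.degenerate_deriv 3 x
  simp only [normalForm, Matrix.cons_val] at e0 e1 e2 e3
  have hg := h.pos 0 x
  have main : a 1 x = 0 ∧ a 3 x = 0 := by
    by_cases hu : G 0 1 x ^ 2 + G 1 2 x ^ 2 = 0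
    · obtain ⟨u1, u2⟩ := eq_zero_of_sq_add_sq hu
      rw [u1, u2] at e0 e2
      constructor <;> apply mul_left_cancel₀ hg.ne' <;> linarith
    · have : (a 1 x ^ 2 + a 3 x ^ 2) * (G 0 1 x ^ 2 + G 1 2 x ^ 2) = 0 := by
        linear_combination (a 3 x * G 1 2 x - a 1 x * G 0 1 x) * e1 +
          (-a 1 x * G 1 2 x - a 3 x * G 0 1 x) * e3
      exact eq_zero_of_sq_add_sq ((mul_eq_zero.1 this).resolve_right hu)
  obtain ⟨m1, m3⟩ := main
  simp only [m1, m3] at e0 e2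
  refine ⟨m1, m3, ?_, ?_⟩
  · linear_combination -G 1 2 x * e0 - G 0 1 x * e2
  · linear_combination -G 0 1 x * e0 + G 1 2 x * e2

theorem KahlerSystem.degenerate_gauss (h : KahlerSystem 0 X a p f G) (x : E 4) :
    let da := fun c d => frameDeriv X c (a d) x
    let dp := fun c d => frameDeriv X c (p d) x
    let a := fun c => a c x
    let p := fun c => p c x
    let f := fun c => f c x
    let G := fun i j => G i j x
    (da 1 0 = G 0 0 - a 0 ^ 2 + a 2 ^ 2 + a 2 * f 1) ∧
    (da 1 2 = -2 * a 0 * a 2 - a 0 * f 1) ∧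
    (da 3 0 = 2 * a 0 * a 2 + a 2 * f 3) ∧
    (da 3 2 = -G 0 0 - a 0 ^ 2 + a 2 ^ 2 - a 0 * f 3) ∧
    (da 0 2 - da 2 0 = -G 0 1 - a 0 * f 0 - a 2 * f 2) ∧
    (da 0 0 + da 2 2 = -G 1 2 - a 0 * f 2 + a 2 * f 0) ∧
    (dp 3 1 - dp 1 3 = 2 * G 0 0 - f 1 * p 1 - f 3 * p 3) ∧
    (dp 2 0 - dp 0 2 = -G 1 1 + 2 * a 0 ^ 2 + 2 * a 2 ^ 2 - 2 * a 0 * p 3 - 2 * a 2 * p 1 +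
      p 0 ^ 2 + p 2 ^ 2) ∧
    (dp 1 0 - dp 0 1 = -G 0 1 - a 0 * p 0 + a 2 * p 2 + f 0 * p 3 + p 1 * p 2) ∧
    (dp 2 1 - dp 1 2 = G 1 2 + a 0 * p 2 + a 2 * p 0 - f 2 * p 3 + p 0 * p 1) := by
  have a1 : a 1 = fun _ => 0 := funext fun x => (h.degenerate_vanish x).1
  have a3 : a 3 = fun _ => 0 := funext fun x => (h.degenerate_vanish x).2.1
  obtain ⟨k1, k2⟩ := h.degenerate_gram
  have s10 := h.symm 1 0
  have s20 := h.symm 2 0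
  have s21 := h.symm 2 1
  have h1 := h.gauss x 1 0 0 1
  have h2 := h.gauss x 3 0 0 1
  have h3 := h.gauss x 1 0 0 3
  have h4 := h.gauss x 3 0 0 3
  have h5 := h.gauss x 1 0 0 2
  have h6 := h.gauss x 3 0 0 2
  have h7 := h.gauss x 2 0 1 3
  have h8 := h.gauss x 2 0 0 2
  have h9 := h.gauss x 2 0 0 1
  have h10 := h.gauss x 2 0 1 2
  simp [connForm, coefC_eq, Fin.sum_univ_four, Fin.sum_univ_three, a1, a3, k1, k2, s10, s20, s21,
    frameDeriv_const] at h1 h2 h3 h4 h5 h6 h7 h8 h9 h10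
  refine ⟨?_, ?_, ?_, ?_, ?_, ?_, ?_, ?_, ?_, ?_⟩
  · linear_combination -h1
  · linear_combination h2
  · linear_combination -h3
  · linear_combination h4
  · linear_combination h5
  · linear_combination h6
  · linear_combination h7
  · linear_combination h8
  · linear_combination h9
  · linear_combination h10

/-- Where (G 0 1, G 1 2) is nonzero, a₂ + 2p₁ and a₀ + 2p₃ vanish together with their derivatives,
and the Gauss equations then give |ν₀|² = 0. -/
theorem KahlerSystem.degenerate_offDiag (h : KahlerSystem 0 X a p f G) (x : E 4) :
    G 0 1 x = 0 ∧ G 1 2 x = 0 := by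
  by_cases hu : G 0 1 x ^ 2 + G 1 2 x ^ 2 = 0
  · exact eq_zero_of_sq_add_sq hu
  exfalso
  have sa := h.smoothA
  have sp := h.smoothP
  have sG := h.smoothG
  obtain ⟨-, -, q1, q3⟩ := h.degenerate_vanish x
  have q1 := (mul_eq_zero.1 q1).resolve_right hu
  have q3 := (mul_eq_zero.1 q3).resolve_right hu
  -- Differentiating a vanishing product at a point where the second factor is nonzero and hence k
  -- is zero.
  have key : ∀ (c : Fin 4) (k : E 4 → ℝ), ContDiff ℝ ∞ k →
      (∀ x, k x * (G 0 1 x ^ 2 + G 1 2 x ^ 2) = 0) → frameDeriv X c k x = 0 := by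
    intro c k hk hz
    have hkx := (mul_eq_zero.1 (hz x)).resolve_right hu
    have e := congrFun (frameDeriv_mul (X := X) (c := c) hk
      (((sG 0 1).pow 2).add ((sG 1 2).pow 2))) x
    simp only [hz, frameDeriv_const, hkx, zero_mul, add_zero] at e
    exact (mul_eq_zero.1 e.symm).resolve_right hu
  have d1 := key 3 (fun x => a 2 x + 2 * p 1 x) (by fun_prop)
    fun x => (h.degenerate_vanish x).2.2.1
  have d3 := key 1 (fun x => a 0 x + 2 * p 3 x) (by fun_prop)
    fun x => (h.degenerate_vanish x).2.2.2
  simp (disch := fun_prop) only [frameDeriv_add, frameDeriv_const_mul] at d1 d3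
  obtain ⟨g1, -, -, g4, -, -, g7, -⟩ := h.degenerate_gauss x
  have := h.pos 0 x
  have : G 0 0 x = 0 := by
    linear_combination -g7 + d1 / 2 - d3 / 2 + (g1 - g4) / 2 + f 1 x * q1 / 2 + f 3 x * q3 / 2
  linarith

end

end Austere

namespace Austere

section
variable {X : Fin 4 → E 4 → E 4} {a p f : Fin 4 → E 4 → ℝ} {G : Fin 3 → Fin 3 → E 4 → ℝ}

theorem KahlerSystem.degenerate_deriv_diag (h : KahlerSystem 0 X a p f G) :
    (frameDeriv X 0 (G 0 0) = fun _ => 0) ∧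
    (frameDeriv X 1 (G 0 0) = fun x => -4 * (a 0 x * G 0 0 x)) ∧
    (frameDeriv X 2 (G 0 0) = fun _ => 0) ∧
    (frameDeriv X 3 (G 0 0) = fun x => 4 * (a 2 x * G 0 0 x)) ∧
    (frameDeriv X 0 (G 1 1) = fun x => -4 * (p 2 x * G 1 1 x)) ∧
    (frameDeriv X 1 (G 1 1) = fun x => 4 * (p 3 x * G 1 1 x)) ∧
    (frameDeriv X 2 (G 1 1) = fun x => 4 * (p 0 x * G 1 1 x)) ∧
    (frameDeriv X 3 (G 1 1) = fun x => -4 * (p 1 x * G 1 1 x)) := by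
  refine ⟨?_, ?_, ?_, ?_, ?_, ?_, ?_, ?_⟩ <;> ext x <;>
    obtain ⟨z1, z2⟩ := h.degenerate_offDiag x <;>
    obtain ⟨v1, v2, -⟩ := h.degenerate_vanish x
  · simp [(h.degenerate_deriv 0 x).1, normalForm, z1, v1]
  · simp [(h.degenerate_deriv 1 x).1, normalForm, z1]; ring
  · simp [(h.degenerate_deriv 2 x).1, normalForm, z1, v2]
  · simp [(h.degenerate_deriv 3 x).1, normalForm, z1]; ring
  · simp [(h.degenerate_deriv 0 x).2.1, normalForm, z1, z2]; ring
  · simp [(h.degenerate_deriv 1 x).2.1, normalForm, z1, z2]; ring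
  · simp [(h.degenerate_deriv 2 x).2.1, normalForm, z1, z2]; ring
  · simp [(h.degenerate_deriv 3 x).2.1, normalForm, z1, z2]; ring

/-- The derivatives of G 0 1 = 0 along e₀ and e₂, given that G is now diagonal. -/
theorem KahlerSystem.degenerate_mul (h : KahlerSystem 0 X a p f G) (x : E 4) :
    2 * (p 1 x * G 1 1 x) = (4 * G 0 0 x - G 1 1 x) * a 2 x ∧
    2 * (p 3 x * G 1 1 x) = (4 * G 0 0 x - G 1 1 x) * a 0 x := by
  have z1 : G 0 1 = fun _ => 0 := funext fun x => (h.degenerate_offDiag x).1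
  have z2 : G 1 2 = fun _ => 0 := funext fun x => (h.degenerate_offDiag x).2
  have e0 := (h.degenerate_deriv 0 x).2.2.2.1
  have e2 := (h.degenerate_deriv 2 x).2.2.2.1
  simp [z1, z2, frameDeriv_const, normalForm] at e0 e2
  constructor
  · linear_combination e0
  · linear_combination -e2

/-- Here k is the value at x of the function 2 (G 0 0)/(G 1 1) - 1/2, and K is the derivative of
that function, read off from the logarithmic derivatives of G 0 0 and G 1 1. The proof
differentiates the relation cleared of denominators. -/
theorem KahlerSystem.degenerate_ratio (h : KahlerSystem 0 X a p f G) (x : E 4) {k : ℝ}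
    (hk : 2 * k * G 1 1 x = 4 * G 0 0 x - G 1 1 x) :
    p 1 x = k * a 2 x ∧ p 3 x = k * a 0 x ∧
    ∀ c, let K := (k + 1 / 2) * ![4 * p 2 x, -4 * (1 + k) * a 0 x, -4 * p 0 x,
        4 * (1 + k) * a 2 x] c
      frameDeriv X c (p 1) x = k * frameDeriv X c (a 2) x + a 2 x * K ∧
      frameDeriv X c (p 3) x = k * frameDeriv X c (a 0) x + a 0 x * K := by
  have hN := (h.pos 1 x).ne'
  obtain ⟨e1, e3⟩ := h.degenerate_mul x
  have p1 : p 1 x = k * a 2 x := by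
    apply mul_right_cancel₀ hN; linear_combination e1 / 2 - a 2 x * hk / 2
  have p3 : p 3 x = k * a 0 x := by
    apply mul_right_cancel₀ hN; linear_combination e3 / 2 - a 0 x * hk / 2
  refine ⟨p1, p3, fun c => ?_⟩
  have sa := h.smoothA
  have sp := h.smoothP
  have sG := h.smoothG
  have d1 := congrFun (congrArg (frameDeriv X c) (funext fun x => (h.degenerate_mul x).1)) x
  have d3 := congrFun (congrArg (frameDeriv X c) (funext fun x => (h.degenerate_mul x).2)) x
  simp (disch := fun_prop) only [frameDeriv_const_mul, frameDeriv_mul, frameDeriv_sub] at d1 d3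
  obtain ⟨g0, g1, g2, g3, n0, n1, n2, n3⟩ := h.degenerate_deriv_diag
  intro K
  constructor <;> apply mul_right_cancel₀ hN
  all_goals
    fin_cases c
    all_goals
      simp [K, g0, g1, g2, g3, n0, n1, n2, n3,
        -mul_eq_mul_right_iff] at d1 d3 ⊢
  · linear_combination d1 / 2 - frameDeriv X 0 (a 2) x / 2 * hk - (-4 * (p 2 x * G 1 1 x)) * p1
  · linear_combination d1 / 2 - frameDeriv X 1 (a 2) x / 2 * hk - (4 * (p 3 x * G 1 1 x)) * p1 - a 2 x * (k + 1 / 2) * 4 * G 1 1 x * p3 + 2 * a 0 x * a 2 x * hk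
  · linear_combination d1 / 2 - frameDeriv X 2 (a 2) x / 2 * hk - (4 * (p 0 x * G 1 1 x)) * p1
  · linear_combination d1 / 2 - frameDeriv X 3 (a 2) x / 2 * hk - (-4 * (p 1 x * G 1 1 x)) * p1 + a 2 x * (k + 1 / 2) * 4 * G 1 1 x * p1 - 2 * a 2 x * a 2 x * hk
  · linear_combination d3 / 2 - frameDeriv X 0 (a 0) x / 2 * hk - (-4 * (p 2 x * G 1 1 x)) * p3
  · linear_combination d3 / 2 - frameDeriv X 1 (a 0) x / 2 * hk - (4 * (p 3 x * G 1 1 x)) * p3 - a 0 x * (k + 1 / 2) * 4 * G 1 1 x * p3 + 2 * a 0 x * a 0 x * hk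
  · linear_combination d3 / 2 - frameDeriv X 2 (a 0) x / 2 * hk - (4 * (p 0 x * G 1 1 x)) * p3
  · linear_combination d3 / 2 - frameDeriv X 3 (a 0) x / 2 * hk - (-4 * (p 1 x * G 1 1 x)) * p3 + a 0 x * (k + 1 / 2) * 4 * G 1 1 x * p1 - 2 * a 2 x * a 0 x * hk

/-- With p₁ = k a₂ and p₃ = k a₀, the curvature component of e₁, e₃ gives the value of G 1 1.
Commutators of derivatives of G 1 1, combined with Gauss, make (p₀, p₂) orthogonal to both (a₀, a₂)
and (-a₂, a₀), and these span because G 1 1 > 0. -/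
theorem KahlerSystem.degenerate_special (h : KahlerSystem 0 X a p f G) (x : E 4) {k : ℝ}
    (hk : 2 * k * G 1 1 x = 4 * G 0 0 x - G 1 1 x) (hk0 : 0 < 2 * k + 1) :
    G 1 1 x = 4 * (a 0 x ^ 2 + a 2 x ^ 2) ∧ p 0 x = 0 ∧ p 2 x = 0 := by
  have sa := h.smoothA
  have sp := h.smoothP
  have sG := h.smoothG
  have hN := (h.pos 1 x)
  obtain ⟨z1, z2⟩ := h.degenerate_offDiag x
  obtain ⟨v1, v3, -⟩ := h.degenerate_vanish x
  obtain ⟨p1, p3, hd⟩ := h.degenerate_ratio x hk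
  obtain ⟨g1, g2, g3, g4, g5, g6, g7, -, g9, g10⟩ := h.degenerate_gauss x
  obtain ⟨-, -, -, -, n0, n1, n2, n3⟩ := h.degenerate_deriv_diag
  have c12 := h.comm (G 1 1) (sG 1 1) 1 2 x
  have c01 := h.comm (G 1 1) (sG 1 1) 0 1 x
  rw [n1, n2] at c12
  rw [n0, n1] at c01
  simp (disch := fun_prop) only [frameDeriv_const_mul, frameDeriv_mul] at c12 c01
  obtain ⟨d01, d03⟩ := hd 0
  obtain ⟨-, d13⟩ := hd 1
  obtain ⟨d21, d23⟩ := hd 2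
  obtain ⟨d31, -⟩ := hd 3
  simp only [Fin.sum_univ_four, n0, n1, n2, n3] at c12 c01
  simp [connForm, v1, v3] at c12 c01 d01 d03 d13 d21 d23 d31
  simp only [z1, z2] at g5 g6 g9 g10
  have hS : G 1 1 x = 4 * (a 0 x ^ 2 + a 2 x ^ 2) := by
    have : (2 * k + 1) * (1 + k) ≠ 0 := by
      have : 0 < 1 + k := by linarith
      positivity
    apply mul_left_cancel₀ this
    linear_combination -2 * g7 + 2 * d31 - 2 * d13 + 2 * k * g4 - 2 * k * g1 +
      (1 + k) * hk + 2 * f 1 x * p1 + 2 * f 3 x * p3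
  have b1 : frameDeriv X 1 (p 0) x - frameDeriv X 2 (p 3) x =
      p 1 x * p 2 x + a 2 x * p 2 x - a 0 x * p 0 x - f 2 x * p 1 x := by
    apply mul_right_cancel₀ hN.ne'
    linear_combination c12 / 4
  have b2 : frameDeriv X 0 (p 3) x + frameDeriv X 1 (p 2) x =
      -(a 0 x * p 2 x) - a 2 x * p 0 x + f 0 x * p 1 x - p 0 x * p 1 x := by
    apply mul_right_cancel₀ hN.ne'
    linear_combination c01 / 4
  have q1 : a 0 x * p 0 x + a 2 x * p 2 x = 0 := by
    have : 2 * (2 * k + 1) ≠ 0 := by positivity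
    apply mul_left_cancel₀ this
    linear_combination b1 - g9 - d01 + d23 - k * g5 - f 2 x * p1 - f 0 x * p3
  have q2 : a 0 x * p 2 x - a 2 x * p 0 x = 0 := by
    have : 2 * (2 * k + 1) ≠ 0 := by positivity
    apply mul_left_cancel₀ this
    linear_combination b2 + g10 - d03 - d21 - k * g6 + f 0 x * p1 - f 2 x * p3
  refine ⟨hS, ?_⟩
  apply eq_zero_of_sq_add_sq
  have : a 0 x ^ 2 + a 2 x ^ 2 ≠ 0 := by
    intro h0; rw [h0] at hS; linarith
  apply mul_left_cancel₀ this
  linear_combination (a 0 x * p 0 x + a 2 x * p 2 x) * q1 + (a 0 x * p 2 x - a 2 x * p 0 x) * q2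

theorem KahlerSystem.false_of_degenerate (h : KahlerSystem 0 X a p f G) : False := by
  -- The second claim holds because (2k + 1) G 1 1 = 4 G 0 0 > 0.
  have hkx : ∀ x, ∃ k, 2 * k * G 1 1 x = 4 * G 0 0 x - G 1 1 x ∧ 0 < 2 * k + 1 := by
    intro x
    have hN := h.pos 1 x
    have hg := h.pos 0 x
    have hk : 2 * ((4 * G 0 0 x - G 1 1 x) / (2 * G 1 1 x)) * G 1 1 x =
      4 * G 0 0 x - G 1 1 x := by field_simp
    refine ⟨_, hk, ?_⟩
    generalize (4 * G 0 0 x - G 1 1 x) / (2 * G 1 1 x) = k at hk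
    by_contra! hc
    nlinarith
  have p0 : p 0 = fun _ => 0 := funext fun x => by
    obtain ⟨k, hk, hk0⟩ := hkx x
    exact (h.degenerate_special x hk hk0).2.1
  have p2 : p 2 = fun _ => 0 := funext fun x => by
    obtain ⟨k, hk, hk0⟩ := hkx x
    exact (h.degenerate_special x hk hk0).2.2
  obtain ⟨k, hk, hk0⟩ := hkx 0
  have hS := (h.degenerate_special 0 hk hk0).1
  obtain ⟨p1, p3, -⟩ := h.degenerate_ratio 0 hk
  obtain ⟨-, -, -, -, -, -, -, g8, -⟩ := h.degenerate_gauss 0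
  simp only [p0, p2, frameDeriv_const, p1, p3] at g8
  have hN := h.pos 1 0
  -- With p₀ = p₂ = 0 everywhere, the Gauss equation of e₀, e₂ forces k = -1, against 2k + 1 > 0.
  have : (k + 1) * G 1 1 0 = 0 := by linear_combination 2 * g8 + (k - 1) * hS
  have : (2 * k + 2) * G 1 1 0 = 0 := by linear_combination 2 * this
  nlinarith

theorem FrameSystem.false_of_kahler {L : ℝ} {w : Fin 4 → Fin 4 → Fin 4 → E 4 → ℝ}
    (h : FrameSystem ![1, L, -1] X w G) (hL : 0 ≤ L) : False := by
  have h1 : 1 + L ≠ 0 := by positivity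
  rcases hL.eq_or_lt with rfl | hL
  · exact (h.kahler h1 _ _ (fun c x => w c 1 3 x) (fun _ => rfl) (fun _ => rfl) (fun _ => rfl)
      (fun h => absurd rfl h)).false_of_degenerate
  have hs : KahlerSystem L X (fun c x => (1 + L)⁻¹ * w c 0 1 x) (fun c x => -w c 0 2 x)
      (fun c x => -w c 0 2 x) G := by
    have hw : ∀ c x, w c 1 3 x = -w c 0 2 x := by
      intro c x
      obtain ⟨t, ht, -⟩ := h.codazzi x
      rw [(ht.kahler hL.ne' h1 (a := fun c => (1 + L)⁻¹ * w c 0 1 x) (p := fun c => -w c 0 2 x)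
        (fun c => by field_simp) (fun c => by simp)).1]
      simp [connForm]
    exact h.kahler h1 _ _ _ (fun _ => rfl) (fun _ => rfl) (fun c => by simp only [hw])
      (fun _ => rfl)
  by_cases hm : 1 - L = 0
  -- For L = 1 the Gram relations read G 0 0 - G 2 2 = G 1 1 and G 1 1 = G 0 0 + G 2 2, so |ν₂|² =
  -- 0.
  · obtain ⟨-, k2, -, -, k5, -⟩ := (hs.gauss 0).kahler_gram fun i j => by rw [h.symm]
    have : L = 1 := by linarith
    subst this
    have := h.pos 2 0
    norm_num at k5
    linarith
  · exact hs.false_of_ne hL hm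

end

end Austere

/-! ### Smooth families of rotations into a fixed space of matrices -/

namespace Austere

section
open Filter Topology

/-- The implicit function of a smooth equation is smooth near the base point. -/
theorem exists_eventually_contDiffAt_implicit {E₁ E₂ : Type*} [NormedAddCommGroup E₁]
    [NormedSpace ℝ E₁] [CompleteSpace E₁] [NormedAddCommGroup E₂] [NormedSpace ℝ E₂]
    [CompleteSpace E₂] {f : E₁ × E₂ → E₂} {u : E₁ × E₂}
    (hf : ∀ᶠ v in 𝓝 u, ContDiffAt ℝ ∞ f v) (h0 : f u = 0)
    (hd : fderiv ℝ f u ∘L .inr ℝ E₁ E₂ = .id ℝ E₂) :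
    ∃ φ : E₁ → E₂, (∀ᶠ x in 𝓝 u.1, ContDiffAt ℝ ∞ φ x) ∧ ∀ᶠ v in 𝓝 u, f v = 0 → φ v.1 = v.2 := by
  have hfu := hf.self_of_nhds
  have hinv : (fderiv ℝ f u ∘L .inr ℝ E₁ E₂).IsInvertible := by
    rw [hd]; exact ⟨ContinuousLinearEquiv.refl ℝ E₂, rfl⟩
  have hinv' : ∀ᶠ v in 𝓝 u, (fderiv ℝ f v ∘L .inr ℝ E₁ E₂).IsInvertible := by
    have hc : ContinuousAt (fun v => fderiv ℝ f v ∘L .inr ℝ E₁ E₂) u :=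
      ((hfu.fderiv_right (m := 0) (by simp)).continuousAt).clm_comp continuousAt_const
    have := ContinuousLinearEquiv.nhds (ContinuousLinearEquiv.refl ℝ E₂)
    have h2 := hc.eventually (p := fun A => A ∈ Set.range ((↑) : (E₂ ≃L[ℝ] E₂) → E₂ →L[ℝ] E₂))
      (by simp only [hd]; exact this)
    exact h2
  set φ := hfu.implicitFunction (by simp) hinv
  have hφ : ContDiffAt ℝ ∞ φ u.1 := hfu.contDiffAt_implicitFunction (by simp) hinv
  have hφu : φ u.1 = u.2 := hfu.implicitFunction_apply_self (by simp) hinv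
  have hc : ∀ᶠ x in 𝓝 u.1, ContinuousAt φ x :=
    ((hφ.of_le (m := 1) (by exact_mod_cast le_top)).eventually (by simp)).mono
      fun x hx => hx.continuousAt
  have ht : Tendsto (fun x => (x, φ x)) (𝓝 u.1) (𝓝 u) := by
    have : Tendsto (fun x => (x, φ x)) (𝓝 u.1) (𝓝 (u.1, φ u.1)) :=
      continuousAt_id.prodMk hφ.continuousAt
    rwa [hφu] at this
  have hz : ∀ᶠ x in 𝓝 u.1, f (x, φ x) = 0 := by
    filter_upwards [hfu.eventually_apply_implicitFunction (by simp) hinv] with x hx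
    rw [← h0]; exact hx
  refine ⟨φ, ?_, ?_⟩
  -- Smoothness away from the base point: the implicit function theorem is applied again at each
  -- nearby (x, φ x), and local uniqueness identifies the new implicit function with φ.
  · filter_upwards [hc, ht.eventually hf, ht.eventually hinv', hz, hz.eventually_nhds]
      with x hcx hfx hix hzx hzx'
    have hx := hfx.contDiffAt_implicitFunction (by simp) hix
    refine hx.congr_of_eventuallyEq ?_
    have ht' : Tendsto (fun x' => (x', φ x')) (𝓝 x) (𝓝 (x, φ x)) := continuousAt_id.prodMk hcx
    filter_upwards [ht'.eventually (hfx.eventually_apply_eq_iff_implicitFunction (by simp) hix),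
      hzx'] with x' h1 h2
    exact (h1.1 (by rw [h2, hzx])).symm
  · filter_upwards [hfu.eventually_apply_eq_iff_implicitFunction (by simp) hinv] with v hv hz
    exact hv.1 (by rw [hz, h0])

/-- Solutions of an overdetermined equation whose partial derivative is injective lie on a smooth
graph. -/
theorem exists_contDiffAt_of_injective {E₁ E₂ Y : Type*} [NormedAddCommGroup E₁] [NormedSpace ℝ E₁]
    [CompleteSpace E₁] [NormedAddCommGroup E₂] [NormedSpace ℝ E₂] [FiniteDimensional ℝ E₂]
    [NormedAddCommGroup Y] [NormedSpace ℝ Y] [FiniteDimensional ℝ Y] {Ψ : E₁ × E₂ → Y}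
    {u : E₁ × E₂} (hΨ : ∀ᶠ v in 𝓝 u, ContDiffAt ℝ ∞ Ψ v) (h0 : Ψ u = 0)
    (hinj : ∀ v, fderiv ℝ Ψ u (0, v) = 0 → v = 0) :
    ∃ φ : E₁ → E₂, (∀ᶠ x in 𝓝 u.1, ContDiffAt ℝ ∞ φ x) ∧ ∀ᶠ v in 𝓝 u, Ψ v = 0 → φ v.1 = v.2 := by
  have : CompleteSpace E₂ := FiniteDimensional.complete ℝ E₂
  set A : E₂ →L[ℝ] Y := fderiv ℝ Ψ u ∘L .inr ℝ E₁ E₂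
  have hA : LinearMap.ker A.toLinearMap = ⊥ := by
    rw [LinearMap.ker_eq_bot']
    intro v hv
    exact hinj v (by simpa [A] using hv)
  -- Composing with a left inverse of the injective partial derivative discards the redundant
  -- equations and makes that derivative the identity.
  obtain ⟨Λ, hΛ⟩ := LinearMap.exists_leftInverse_of_injective A.toLinearMap hA
  set Λ' : Y →L[ℝ] E₂ := LinearMap.toContinuousLinearMap Λ
  have hf : ∀ᶠ v in 𝓝 u, ContDiffAt ℝ ∞ (fun v => Λ' (Ψ v)) v :=
    hΨ.mono fun v hv => Λ'.contDiff.contDiffAt.comp v hv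
  have hd : fderiv ℝ (fun v => Λ' (Ψ v)) u ∘L .inr ℝ E₁ E₂ = .id ℝ E₂ := by
    have : fderiv ℝ (fun v => Λ' (Ψ v)) u = Λ' ∘L fderiv ℝ Ψ u :=
      (Λ'.hasFDerivAt.comp u (hΨ.self_of_nhds.differentiableAt (by simp)).hasFDerivAt).fderiv
    rw [this, ContinuousLinearMap.comp_assoc]
    ext v
    exact LinearMap.congr_fun hΛ v
  obtain ⟨φ, h1, h2⟩ := exists_eventually_contDiffAt_implicit hf (by simp [h0]) hd
  exact ⟨φ, h1, h2.mono fun v hv hz => hv (by simp [hz])⟩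

/-- A subspace of a finite-dimensional space is the kernel of a projection. -/
theorem exists_projection_ker {V : Type*} [NormedAddCommGroup V] [NormedSpace ℝ V]
    [FiniteDimensional ℝ V] (W : Submodule ℝ V) :
    ∃ π : V →L[ℝ] V, (∀ x, π x = 0 ↔ x ∈ W) ∧ ∀ x, x - π x ∈ W := by
  obtain ⟨q, hq⟩ := W.exists_isCompl
  refine ⟨LinearMap.toContinuousLinearMap (q.projection W hq.symm), fun x => ?_, fun x => ?_⟩
  · exact Submodule.projection_apply_eq_zero_iff hq.symm
  · exact Submodule.sub_projection_mem hq.symm x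

/-- A subspace that is stable under the commutator with `D` is stable under conjugation by
`exp (t D)`. -/
theorem exp_conj_mem {A : Type*} [NormedRing A] [NormedAlgebra ℝ A] [FiniteDimensional ℝ A]
    {W : Submodule ℝ A} {D : A}
    (hD : ∀ w ∈ W, w * D - D * w ∈ W) {w : A} (hw : w ∈ W) (t : ℝ) :
    NormedSpace.exp (t • -D) * w * NormedSpace.exp (t • D) ∈ W := by
  have : CompleteSpace A := FiniteDimensional.complete ℝ A
  obtain ⟨π, hπ, hπ'⟩ := exists_projection_ker W
  let M : A →L[ℝ] A := π ∘L ((ContinuousLinearMap.mul ℝ A).flip D - ContinuousLinearMap.mul ℝ A D)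
  have hM : ∀ v, M v = π (v * D - D * v) := fun v => by simp [M]
  -- Modulo W the commutator with D depends only on the class of v. The component of the conjugated
  -- curve outside W thus solves a linear ODE with initial value zero.
  have hM' : ∀ v, M (π v) = π (v * D - D * v) := fun v => by
    have := (hπ _).2 (hD _ (hπ' v))
    rw [← hM, ← sub_eq_zero, ← neg_sub, ← map_sub, hM, this, neg_zero]
  have hv : ∀ t : ℝ, HasDerivAt (fun t : ℝ => NormedSpace.exp (t • -D) * w *
      NormedSpace.exp (t • D)) (NormedSpace.exp (t • -D) * w * NormedSpace.exp (t • D) * D -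
        D * (NormedSpace.exp (t • -D) * w * NormedSpace.exp (t • D))) t := fun t => by
    have := ((hasDerivAt_exp_smul_const' (𝕂 := ℝ) (-D) t).mul_const w).mul
      (hasDerivAt_exp_smul_const (𝕂 := ℝ) D t)
    refine this.congr_deriv ?_
    noncomm_ring
  have key := ODE_solution_unique_univ (v := fun _ => M) (s := fun _ => Set.univ) (t₀ := 0)
    (K := ‖M‖₊) (f := fun t : ℝ => π (NormedSpace.exp (t • -D) * w * NormedSpace.exp (t • D)))
    (g := fun _ => 0)
    (fun _ => M.lipschitz.lipschitzOnWith)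
    (fun t => ⟨by
      simp only [hM']
      exact π.hasFDerivAt.comp_hasDerivAt t (hv t), trivial⟩)
    (fun t => ⟨by simpa using hasDerivAt_const t (0 : A), trivial⟩)
    (by simpa [hπ] using hw)
  exact (hπ _).1 (congrFun key t)

end

end Austere

namespace Austere

section
open Filter Topology Matrix

open scoped Matrix.Norms.Frobenius

variable {m ι : Type*} [Fintype m] [DecidableEq m] [Fintype ι]

theorem isCompact_orthogonal : IsCompact {h : Matrix m m ℝ | hᵀ * h = 1} := by
  refine IsCompact.of_isClosed_subset (isCompact_univ_pi fun _ => isCompact_univ_pi fun _ =>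
    isCompact_Icc (a := (-1 : ℝ)) (b := 1)) ?_ ?_
  · exact isClosed_eq (by fun_prop) continuous_const
  · intro h hh i _ j _
    have h1 := congrFun (congrFun hh j) j
    simp only [mul_apply, transpose_apply, one_apply_eq] at h1
    change h i j ∈ Set.Icc (-1 : ℝ) 1
    rw [Set.mem_Icc, ← abs_le, ← sq_le_one_iff_abs_le_one, sq, ← h1]
    exact Finset.single_le_sum (f := fun i => h i j * h i j) (fun _ _ => mul_self_nonneg _)
      (Finset.mem_univ i)

theorem eq_zero_of_trace_transpose_mul_self {A : Matrix m m ℝ} (h : (Aᵀ * A).trace = 0) :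
    A = 0 := by
  simp only [trace, diag_apply, mul_apply, transpose_apply] at h
  rw [Finset.sum_eq_zero_iff_of_nonneg
    (fun _ _ => Finset.sum_nonneg fun _ _ => mul_self_nonneg _)] at h
  ext i j
  have := h j (Finset.mem_univ _)
  rw [Finset.sum_eq_zero_iff_of_nonneg (fun _ _ => mul_self_nonneg _)] at this
  simpa using this i (Finset.mem_univ _)

theorem eq_one_of_trace {h : Matrix m m ℝ} (hh : hᵀ * h = 1)
    (ht : (1 : Matrix m m ℝ).trace ≤ h.trace) : h = 1 := by
  have e : ((h - 1)ᵀ * (h - 1)).trace = 2 * (1 : Matrix m m ℝ).trace - 2 * h.trace := by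
    rw [transpose_sub, sub_mul, mul_sub, mul_sub, hh]
    simp [trace_sub]; ring
  have h0 : 0 ≤ ((h - 1)ᵀ * (h - 1)).trace := by
    simp only [trace, diag_apply, mul_apply, transpose_apply]
    exact Finset.sum_nonneg fun _ _ => Finset.sum_nonneg fun _ _ => mul_self_nonneg _
  have := eq_zero_of_trace_transpose_mul_self (le_antisymm (by linarith) h0)
  exact sub_eq_zero.1 this

/-- The rotations that move the matrices `B k` into `W`. -/
def rotations (W : Submodule ℝ (Matrix m m ℝ)) (B : ι → Matrix m m ℝ) : Set (Matrix m m ℝ) :=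
  {h | hᵀ * h = 1 ∧ ∀ k, hᵀ * B k * h ∈ W}

/-- The skew matrices whose commutators preserve `W`. -/
def stabilizer (W : Submodule ℝ (Matrix m m ℝ)) : Submodule ℝ (Matrix m m ℝ) where
  carrier := {D | Dᵀ = -D ∧ ∀ w ∈ W, w * D - D * w ∈ W}
  zero_mem' := by simp
  add_mem' := by
    rintro a b ⟨h1, h2⟩ ⟨h3, h4⟩
    refine ⟨by rw [transpose_add, h1, h3, neg_add], fun w hw => ?_⟩
    convert W.add_mem (h2 w hw) (h4 w hw) using 1
    noncomm_ring
  smul_mem' := by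
    rintro c a ⟨h1, h2⟩
    refine ⟨by rw [transpose_smul, h1, smul_neg], fun w hw => ?_⟩
    convert W.smul_mem c (h2 w hw) using 1
    simp [smul_sub]

/-- A rotation of maximal trace is orthogonal to the stabilizer. -/
theorem trace_mul_eq_zero_of_isMaxOn {W : Submodule ℝ (Matrix m m ℝ)} {B : ι → Matrix m m ℝ}
    {h : Matrix m m ℝ} (hh : h ∈ rotations W B) (hmax : IsMaxOn trace (rotations W B) h)
    {D : Matrix m m ℝ} (hD : D ∈ stabilizer W) : (h * D).trace = 0 := by
  have e1 : ∀ t : ℝ, (NormedSpace.exp (t • D))ᵀ = NormedSpace.exp (t • -D) := fun t => by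
    rw [← Matrix.exp_transpose, transpose_smul, hD.1]
  have e2 : ∀ t : ℝ, NormedSpace.exp (t • -D) * NormedSpace.exp (t • D) = 1 := fun t => by
    rw [← Matrix.exp_add_of_commute _ _ (by simp)]
    simp
  have hmem : ∀ t : ℝ, h * NormedSpace.exp (t • D) ∈ rotations W B := fun t => by
    refine ⟨?_, fun k => ?_⟩
    · rw [transpose_mul, e1]
      calc _ = NormedSpace.exp (t • -D) * (hᵀ * h) * NormedSpace.exp (t • D) := by noncomm_ring
        _ = 1 := by rw [hh.1, mul_one, e2]
    · have := exp_conj_mem (fun w hw => hD.2 w hw) (hh.2 k) t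
      rw [transpose_mul, e1]
      convert this using 1
      noncomm_ring
  have hder : HasDerivAt (fun t : ℝ => (h * NormedSpace.exp (t • D)).trace) (h * D).trace 0 := by
    have h1 := (hasDerivAt_exp_smul_const (𝕂 := ℝ) D 0).const_mul h
    have h2 := (LinearMap.toContinuousLinearMap (traceLinearMap m ℝ ℝ)).hasFDerivAt.comp_hasDerivAt
      (0 : ℝ) h1
    refine h2.congr_deriv ?_
    rw [zero_smul, NormedSpace.exp_zero, one_mul]
    rfl
  have hloc : IsLocalMax (fun t : ℝ => (h * NormedSpace.exp (t • D)).trace) 0 :=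
    Eventually.of_forall fun t => by simpa using hmax (hmem t)
  exact hloc.hasDerivAt_eq_zero hder

/-- Rotations of maximal trace are close to the identity for parameters close to one at which the
matrices span `W`. -/
theorem eventually_rotations_near_one {Z : Type*} [TopologicalSpace Z] [FirstCountableTopology Z]
    {W : Submodule ℝ (Matrix m m ℝ)} {B : ι → Z → Matrix m m ℝ} {z : Z}
    (hB : ∀ k, ContinuousAt (B k) z) (hW : Submodule.span ℝ (Set.range fun k => B k z) = W)
    {U : Set (Matrix m m ℝ)} (hU : U ∈ 𝓝 1) :
    ∀ᶠ x in 𝓝 z, ∀ h ∈ rotations W (B · x), IsMaxOn trace (rotations W (B · x)) h → h ∈ U := by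
  have : FirstCountableTopology (Matrix m m ℝ) :=
    inferInstanceAs (FirstCountableTopology (m → m → ℝ))
  by_contra hcon
  obtain ⟨x, hx, hx'⟩ := exists_seq_forall_of_frequently (not_eventually.1 hcon)
  push Not at hx'
  choose h hh hmax hU' using hx'
  obtain ⟨h₀, h₀m, φ, hφ, hlim⟩ := isCompact_orthogonal.tendsto_subseq fun n => (hh n).1
  have hxφ : Tendsto (x ∘ φ) atTop (𝓝 z) := hx.comp hφ.tendsto_atTop
  have hclosed : IsClosed (W : Set (Matrix m m ℝ)) := Submodule.closed_of_finiteDimensional W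
  have h₀m : h₀ᵀ * h₀ = 1 := h₀m
  have h₀m' : h₀ * h₀ᵀ = 1 := mul_eq_one_comm.1 h₀m
  -- The limit h₀ of maximizers normalizes W, because the matrices at the limit parameter span W.
  have hconj : ∀ w ∈ W, h₀ᵀ * w * h₀ ∈ W := by
    intro w hw
    rw [← hW] at hw
    induction hw using Submodule.span_induction with
    | mem w hw =>
      obtain ⟨k, rfl⟩ := hw
      have : Tendsto (fun n => (h (φ n))ᵀ * B k (x (φ n)) * h (φ n)) atTop
          (𝓝 (h₀ᵀ * B k z * h₀)) := by
        refine Tendsto.mul (Tendsto.mul ?_ ((hB k).tendsto.comp hxφ)) hlim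
        exact (continuous_id.matrix_transpose.tendsto h₀).comp hlim
      exact hclosed.mem_of_tendsto this (Eventually.of_forall fun n => (hh (φ n)).2 k)
    | zero => simp
    | add a b _ _ ha hb => rw [mul_add, add_mul]; exact W.add_mem ha hb
    | smul c a _ ha => rw [mul_smul_comm, smul_mul_assoc]; exact W.smul_mem c ha
  let e : Matrix m m ℝ ≃ₗ[ℝ] Matrix m m ℝ :=
    { toFun := fun w => h₀ᵀ * w * h₀
      invFun := fun w => h₀ * w * h₀ᵀ
      map_add' := fun a b => by noncomm_ring
      map_smul' := fun c a => by simp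
      left_inv := fun w => by
        calc h₀ * (h₀ᵀ * w * h₀) * h₀ᵀ = (h₀ * h₀ᵀ) * w * (h₀ * h₀ᵀ) := by noncomm_ring
          _ = w := by rw [h₀m', one_mul, mul_one]
      right_inv := fun w => by
        calc h₀ᵀ * (h₀ * w * h₀ᵀ) * h₀ = (h₀ᵀ * h₀) * w * (h₀ᵀ * h₀) := by noncomm_ring
          _ = w := by rw [h₀m, one_mul, mul_one] }
  have hWe : W.map e.toLinearMap = W := by
    refine Submodule.eq_of_le_of_finrank_eq ?_ (LinearEquiv.finrank_map_eq e W)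
    rintro _ ⟨w, hw, rfl⟩
    exact hconj w hw
  have hconj' : ∀ w ∈ W, h₀ * w * h₀ᵀ ∈ W := by
    intro w hw
    rw [← hWe] at hw
    obtain ⟨v, hv, rfl⟩ := hw
    have : h₀ * e.toLinearMap v * h₀ᵀ = v := e.left_inv v
    rwa [this]
  have hmem : ∀ n, h (φ n) * h₀ᵀ ∈ rotations W (B · (x (φ n))) := fun n => by
    refine ⟨?_, fun k => ?_⟩
    · rw [transpose_mul, transpose_transpose]
      calc _ = h₀ * ((h (φ n))ᵀ * h (φ n)) * h₀ᵀ := by noncomm_ring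
        _ = 1 := by rw [(hh (φ n)).1, mul_one, h₀m']
    · convert hconj' _ ((hh (φ n)).2 k) using 1
      rw [transpose_mul, transpose_transpose]
      noncomm_ring
  -- As h₀ preserves W, h h₀ᵀ is admissible whenever h is, so its trace is at most that of h. In the
  -- limit tr 1 ≤ tr h₀, which forces h₀ = 1.
  have hle : (1 : Matrix m m ℝ).trace ≤ h₀.trace := by
    rw [← h₀m']
    have c : Continuous (trace : Matrix m m ℝ → ℝ) := continuous_id.matrix_trace
    refine le_of_tendsto_of_tendsto ((c.tendsto _).comp (hlim.mul_const h₀ᵀ))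
      ((c.tendsto _).comp hlim) (Eventually.of_forall fun n => ?_)
    exact hmax (φ n) (hmem n)
  rw [eq_one_of_trace h₀m hle] at hlim
  obtain ⟨n, hn⟩ := (hlim.eventually hU).exists
  exact hU' (φ n) hn

/-- A smooth family of matrices that can be rotated into `W` at every point, and that spans `W` at
one point, can be rotated into `W` smoothly near this point. -/
theorem exists_smooth_rotation {Z : Type*} [NormedAddCommGroup Z] [NormedSpace ℝ Z]
    [CompleteSpace Z] {W : Submodule ℝ (Matrix m m ℝ)} {B : ι → Z → Matrix m m ℝ} {z : Z}
    (hB : ∀ᶠ x in 𝓝 z, ∀ k, ContDiffAt ℝ ∞ (B k) x) (hW : Submodule.span ℝ (Set.range fun k => B k z) = W)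
    (hR : ∀ᶠ x in 𝓝 z, (rotations W (B · x)).Nonempty) :
    ∃ h : Z → Matrix m m ℝ, ∀ᶠ x in 𝓝 z, ContDiffAt ℝ ∞ h x ∧ h x ∈ rotations W (B · x) := by
  obtain ⟨π, hπ, -⟩ := exists_projection_ker W
  -- The slice: the trace-orthogonal complement of the stabilizer, which contains 1 and every
  -- admissible rotation of maximal trace.
  let S : Submodule ℝ (Matrix m m ℝ) :=
    { carrier := {h | ∀ D ∈ stabilizer W, (h * D).trace = 0}
      zero_mem' := by simp
      add_mem' := fun ha hb D hD => by rw [add_mul, trace_add, ha D hD, hb D hD, add_zero]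
      smul_mem' := fun c a ha D hD => by rw [smul_mul, trace_smul, ha D hD, smul_zero] }
  have hS1 : (1 : Matrix m m ℝ) ∈ S := fun D hD => by
    have := congrArg trace hD.1
    rw [trace_transpose, trace_neg] at this
    rw [one_mul]; linarith
  let T : Matrix m m ℝ →L[ℝ] Matrix m m ℝ :=
    LinearMap.toContinuousLinearMap (transposeLinearEquiv m m ℝ ℝ).toLinearMap
  let Ψ : Z × S → Matrix m m ℝ × (ι → Matrix m m ℝ) := fun v =>
    (T v.2 * v.2 - 1, fun k => π (T v.2 * B k v.1 * v.2))
  have hΨ' : ∀ᶠ u in 𝓝 ((z, ⟨1, hS1⟩) : Z × S), ContDiffAt ℝ ∞ Ψ u := by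
    have hfst : Tendsto Prod.fst (𝓝 ((z, ⟨1, hS1⟩) : Z × S)) (𝓝 z) := continuousAt_fst
    filter_upwards [hfst.eventually hB] with u hu
    have c1 : ContDiffAt ℝ ∞ (fun v : Z × S => (v.2 : Matrix m m ℝ)) u :=
      (S.subtypeL.contDiff.comp contDiff_snd).contDiffAt
    have c2 : ContDiffAt ℝ ∞ (fun v : Z × S => T v.2) u :=
      T.contDiff.contDiffAt.comp _ c1
    have c3 : ∀ k, ContDiffAt ℝ ∞ (fun v : Z × S => B k v.1) u := fun k =>
      ContDiffAt.comp u (hu k) contDiff_fst.contDiffAt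
    refine ((c2.mul c1).sub contDiffAt_const).prodMk (contDiffAt_pi.2 fun k => ?_)
    exact π.contDiff.contDiffAt.comp _ ((c2.mul (c3 k)).mul c1)
  have hΨ := hΨ'.self_of_nhds
  have hT : T 1 = 1 := transpose_one
  have hBW : ∀ k, B k z ∈ W := fun k => hW ▸ Submodule.subset_span ⟨k, rfl⟩
  have h0 : Ψ (z, ⟨1, hS1⟩) = 0 := by
    ext1
    · simp [Ψ, hT]
    · ext1 k
      simpa [Ψ, hT, hπ] using hBW k
  have hder : ∀ v : S, fderiv ℝ Ψ (z, ⟨1, hS1⟩) (0, v) =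
      (T v + v, fun k => π (T v * B k z + B k z * v)) := by
    intro v
    have p1 : HasDerivAt (fun t : ℝ => (1 : Matrix m m ℝ) + t • (v : Matrix m m ℝ)) v 0 := by
      have := ((hasDerivAt_id (0 : ℝ)).smul_const (v : Matrix m m ℝ)).const_add 1
      exact this.congr_deriv (one_smul _ _)
    have p2 : HasDerivAt (fun t : ℝ => T (1 + t • (v : Matrix m m ℝ))) (T v) 0 :=
      T.hasFDerivAt.comp_hasDerivAt (0 : ℝ) p1
    have l1 : HasDerivAt (fun t : ℝ => Ψ (z, ⟨1, hS1⟩ + t • v))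
        (T v + v, fun k => π (T v * B k z + B k z * v)) 0 := by
      refine HasDerivAt.prodMk ?_ (hasDerivAt_pi.2 fun k => ?_)
      · refine ((p2.mul p1).sub_const 1).congr_deriv ?_
        simp [hT]
      · refine (π.hasFDerivAt.comp_hasDerivAt (0 : ℝ)
          ((p2.mul_const (B k z)).mul p1)).congr_deriv ?_
        simp [hT]
    have l2 : HasDerivAt (fun t : ℝ => ((z, ⟨1, hS1⟩ + t • v) : Z × S)) (0, v) 0 := by
      refine HasDerivAt.prodMk (hasDerivAt_const _ _) ?_
      simpa using ((hasDerivAt_id (0 : ℝ)).smul_const v).const_add (⟨1, hS1⟩ : S)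
    have l3 := (hΨ.differentiableAt (by simp)).hasFDerivAt.comp_hasDerivAt_of_eq (0 : ℝ) l2
      (by simp)
    exact l3.unique l1
  -- A kernel vector is skew and its commutators with the spanning matrices lie in W, so it belongs
  -- to the stabilizer; being also in S it is orthogonal to itself.
  have hinj : ∀ v : S, fderiv ℝ Ψ (z, ⟨1, hS1⟩) (0, v) = 0 → v = 0 := by
    intro v hv
    rw [hder, Prod.mk_eq_zero] at hv
    have hskew : (v : Matrix m m ℝ)ᵀ = -v := eq_neg_of_add_eq_zero_left hv.1
    have hst : (v : Matrix m m ℝ) ∈ stabilizer W := by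
      refine ⟨hskew, fun w hw => ?_⟩
      rw [← hW] at hw
      induction hw using Submodule.span_induction with
      | mem w hw =>
        obtain ⟨k, rfl⟩ := hw
        have := (hπ _).1 (congrFun hv.2 k)
        convert this using 1
        change _ = (v : Matrix m m ℝ)ᵀ * B k z + B k z * v
        rw [hskew]; noncomm_ring
      | zero => simp
      | add a b _ _ ha hb =>
        convert W.add_mem ha hb using 1; noncomm_ring
      | smul c a _ ha =>
        convert W.smul_mem c ha using 1; simp [smul_sub]
    have := v.2 _ hst
    apply Subtype.ext
    apply eq_zero_of_trace_transpose_mul_self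
    rw [hskew, neg_mul, trace_neg, this, neg_zero]
  obtain ⟨φ, hφ, hφ'⟩ := exists_contDiffAt_of_injective hΨ' h0 hinj
  refine ⟨fun x => φ x, ?_⟩
  rw [nhds_prod_eq] at hφ'
  obtain ⟨p, hp, q, hq, hpq⟩ := eventually_prod_iff.1 hφ'
  rw [nhds_subtype_eq_comap] at hq
  obtain ⟨U, hU, hUq⟩ := mem_comap.1 hq
  filter_upwards [hφ, hp, hR, eventually_rotations_near_one
    (fun k => (hB.self_of_nhds k).continuousAt) hW hU] with x hxφ hx ⟨h₁, hh₁⟩ hxU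
  refine ⟨S.subtypeL.contDiff.contDiffAt.comp x hxφ, ?_⟩
  have hcomp : IsCompact (rotations W (B · x)) := by
    refine isCompact_orthogonal.of_isClosed_subset ?_ fun h hh => hh.1
    have hclosed : IsClosed (W : Set (Matrix m m ℝ)) := Submodule.closed_of_finiteDimensional W
    have e : rotations W (B · x) =
        {h | hᵀ * h = 1} ∩ ⋂ k, (fun h : Matrix m m ℝ => hᵀ * B k x * h) ⁻¹' W := by
      ext h; simp [rotations]
    rw [e]
    exact (isClosed_eq (by fun_prop) continuous_const).inter
      (isClosed_iInter fun k => hclosed.preimage (by fun_prop))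
  obtain ⟨h, hh, hmax⟩ := hcomp.exists_isMaxOn ⟨h₁, hh₁⟩
    (f := trace) continuous_id.matrix_trace.continuousOn
  have hS : h ∈ S := fun D hD => trace_mul_eq_zero_of_isMaxOn hh hmax hD
  have e : φ x = ⟨h, hS⟩ := by
    refine hpq hx (hUq (hxU h hh hmax)) ?_
    ext1
    · change hᵀ * h - 1 = 0
      rw [hh.1, sub_self]
    · ext1 k
      exact (hπ _).2 (hh.2 k)
  change ((φ x : S) : Matrix m m ℝ) ∈ _
  rw [e]
  exact hh

end

end Austere

/-! ### Second fundamental forms of maps from ℝ⁴ and smooth adapted frames -/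

namespace Austere

section
open Filter Topology

variable {n : ℕ}

/-- The second fundamental form of a map `ℝ⁴ → ℝⁿ`. -/
def sff (f : E 4 → E n) (x v w : E 4) : E n :=
  (LinearMap.range (fderiv ℝ f x).toLinearMap)ᗮ.starProjection (fderiv ℝ (fderiv ℝ f) x v w)

/-- The frame `e` is orthonormal for the metric induced by `f` at `x`, and the second fundamental
form of `f` has the shape of type C in this frame. -/
def IsAdaptedAt (l : Fin 3 → ℝ) (f : E 4 → E n) (x : E 4) (e : Fin 4 → E 4) : Prop :=
  (Orthonormal ℝ fun i => fderiv ℝ f x (e i)) ∧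
    ∀ i j, sff f x (e i) (e j) = ∑ k : Fin 3, coefC l k i j • sff f x (e 0) (e k.succ)

/-- The rank of the second fundamental form at `x`. -/
def sffRank (f : E 4 → E n) (x : E 4) : ℕ :=
  Module.finrank ℝ (Submodule.span ℝ {z | ∃ v w, sff f x v w = z})

section Pointwise

variable {f : E 4 → E n} {x : E 4} {e : Fin 4 → E 4}

theorem sff_smul_left (c : ℝ) (v w : E 4) : sff f x (c • v) w = c • sff f x v w := by
  simp [sff]

theorem sff_smul_right (c : ℝ) (v w : E 4) : sff f x v (c • w) = c • sff f x v w := by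
  simp [sff]

theorem sff_sum_left {ι : Type*} (s : Finset ι) (v : ι → E 4) (w : E 4) :
    sff f x (∑ i ∈ s, v i) w = ∑ i ∈ s, sff f x (v i) w := by
  simp only [sff, map_sum, sum_apply]

theorem sff_sum_right {ι : Type*} (s : Finset ι) (v : E 4) (w : ι → E 4) :
    sff f x v (∑ i ∈ s, w i) = ∑ i ∈ s, sff f x v (w i) := by
  simp only [sff, map_sum]

theorem span_eq_top_of_orthonormal (he : Orthonormal ℝ fun i => fderiv ℝ f x (e i)) :
    Submodule.span ℝ (Set.range e) = ⊤ := by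
  have : LinearIndependent ℝ e := LinearIndependent.of_comp (fderiv ℝ f x).toLinearMap
    he.linearIndependent
  exact this.span_eq_top_of_card_eq_finrank (by simp)

theorem range_fderiv_of_orthonormal (he : Orthonormal ℝ fun i => fderiv ℝ f x (e i)) :
    LinearMap.range (fderiv ℝ f x).toLinearMap =
      Submodule.span ℝ (Set.range fun i => fderiv ℝ f x (e i)) := by
  rw [LinearMap.range_eq_map, ← span_eq_top_of_orthonormal he, Submodule.map_span, ← Set.range_comp]
  rfl

theorem injective_fderiv_of_orthonormal (he : Orthonormal ℝ fun i => fderiv ℝ f x (e i)) :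
    Function.Injective (fderiv ℝ f x) := by
  rw [injective_iff_map_eq_zero]
  intro v hv
  obtain ⟨c, rfl⟩ := (Submodule.mem_span_range_iff_exists_fun ℝ).1
    ((span_eq_top_of_orthonormal he).ge (Submodule.mem_top (x := v)))
  have h4 : ∑ i, c i • fderiv ℝ f x (e i) = 0 := by simpa using hv
  have := Fintype.linearIndependent_iff.1 he.linearIndependent c h4
  simp [this]

/-- The normal projection, in an orthonormal frame. -/
theorem normal_projection_eq (he : Orthonormal ℝ fun i => fderiv ℝ f x (e i)) (z : E n) :
    (LinearMap.range (fderiv ℝ f x).toLinearMap)ᗮ.starProjection z =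
      z - ∑ i, inner ℝ (fderiv ℝ f x (e i)) z • fderiv ℝ f x (e i) := by
  apply Submodule.eq_starProjection_of_mem_orthogonal
  · rw [range_fderiv_of_orthonormal he]
    intro u hu
    induction hu using Submodule.span_induction with
    | mem u hu =>
      obtain ⟨j, rfl⟩ := hu
      rw [inner_sub_right, inner_sum]
      simp [inner_smul_right, orthonormal_iff_ite.1 he]
    | zero => simp
    | add a b _ _ ha hb => rw [inner_add_left, ha, hb, add_zero]
    | smul c a _ ha => rw [inner_smul_left, ha, mul_zero]
  · rw [sub_sub_cancel]
    refine Submodule.le_orthogonal_orthogonal _ (Submodule.sum_mem _ fun i _ => ?_)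
    exact Submodule.smul_mem _ _ ⟨e i, rfl⟩

theorem sff_eq (he : Orthonormal ℝ fun i => fderiv ℝ f x (e i)) (v w : E 4) :
    sff f x v w = fderiv ℝ (fderiv ℝ f) x v w -
      ∑ i, inner ℝ (fderiv ℝ f x (e i)) (fderiv ℝ (fderiv ℝ f) x v w) • fderiv ℝ f x (e i) :=
  normal_projection_eq he _

theorem inner_sff (v w u : E 4) : inner ℝ (fderiv ℝ f x u) (sff f x v w) = 0 := by
  have : sff f x v w ∈ (LinearMap.range (fderiv ℝ f x).toLinearMap)ᗮ :=
    Submodule.starProjection_apply_mem _ _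
  exact this _ ⟨u, rfl⟩

/-- A type C second fundamental form of rank three has linearly independent coefficients. -/
theorem IsAdaptedAt.linearIndependent {l : Fin 3 → ℝ} (h : IsAdaptedAt l f x e)
    (hr : sffRank f x = 3) :
    LinearIndependent ℝ fun k : Fin 3 => sff f x (e 0) (e k.succ) := by
  rw [linearIndependent_iff_card_eq_finrank_span, Fintype.card_fin]
  refine hr.symm.trans ?_
  rw [sffRank, Set.finrank]
  suffices Submodule.span ℝ {z | ∃ v w, sff f x v w = z} =
    Submodule.span ℝ (Set.range fun k : Fin 3 => sff f x (e 0) (e k.succ)) by rw [this]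
  apply le_antisymm
  · rw [Submodule.span_le]
    rintro _ ⟨v, w, rfl⟩
    have ht := fun v => (span_eq_top_of_orthonormal h.1).ge (Submodule.mem_top (x := v))
    obtain ⟨c, rfl⟩ := (Submodule.mem_span_range_iff_exists_fun ℝ).1 (ht v)
    obtain ⟨d, rfl⟩ := (Submodule.mem_span_range_iff_exists_fun ℝ).1 (ht w)
    simp only [sff_sum_left, sff_sum_right, sff_smul_left, sff_smul_right]
    refine Submodule.sum_mem _ fun i _ => Submodule.smul_mem _ _ (Submodule.sum_mem _ fun j _ =>
      Submodule.smul_mem _ _ ?_)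
    rw [h.2]
    refine Submodule.sum_mem _ fun k _ => Submodule.smul_mem _ _ ?_
    exact Submodule.subset_span ⟨k, rfl⟩
  · rw [Submodule.span_le]
    rintro _ ⟨k, rfl⟩
    exact Submodule.subset_span ⟨_, _, rfl⟩

end Pointwise

end

end Austere

namespace Austere

section
open Filter Topology

variable {n : ℕ} {f : E 4 → E n} {x₀ : E 4}

/-- Smooth Gram–Schmidt orthonormalisation. -/
theorem exists_orthonormal_frame (hf : ∀ᶠ x in 𝓝 x₀, ContDiffAt ℝ ∞ f x) {k : ℕ}
    (e : Fin k → E 4) (he : Orthonormal ℝ fun i => fderiv ℝ f x₀ (e i)) :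
    ∃ X : Fin k → E 4 → E 4, (∀ i, X i x₀ = e i) ∧
      ∀ᶠ x in 𝓝 x₀, (∀ i, ContDiffAt ℝ ∞ (X i) x) ∧
        Orthonormal ℝ fun i => fderiv ℝ f x (X i x) := by
  induction k with
  | zero =>
    refine ⟨fun i => i.elim0, fun i => i.elim0, Eventually.of_forall fun x => ⟨fun i => i.elim0, ?_⟩⟩
    exact ⟨fun i => i.elim0, fun i => i.elim0⟩
  | succ k ih =>
    obtain ⟨X, hX, hX'⟩ := ih (fun i => e i.castSucc) (he.comp _ (Fin.castSucc_injective k))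
    set Y : E 4 → E 4 := fun x => e (Fin.last k) -
      ∑ i, inner ℝ (fderiv ℝ f x (X i x)) (fderiv ℝ f x (e (Fin.last k))) • X i x with hY
    have hY0 : Y x₀ = e (Fin.last k) := by
      rw [hY]
      simp only [hX, sub_eq_self]
      refine Finset.sum_eq_zero fun i _ => ?_
      rw [he.2 (Fin.castSucc_lt_last i).ne, zero_smul]
    have hYs : ∀ᶠ x in 𝓝 x₀, ContDiffAt ℝ ∞ Y x := by
      filter_upwards [hf, hX'] with x hfx ⟨hx, _⟩
      have hd : ContDiffAt ℝ ∞ (fderiv ℝ f) x := hfx.fderiv_right (by simp)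
      refine contDiffAt_const.sub (ContDiffAt.sum fun i _ => ?_)
      exact ((hd.clm_apply (hx i)).inner ℝ (hd.clm_apply contDiffAt_const)).smul (hx i)
    have hds : ∀ᶠ x in 𝓝 x₀, ContDiffAt ℝ ∞ (fun x => fderiv ℝ f x (Y x)) x := by
      filter_upwards [hf, hYs] with x hfx hx
      exact (hfx.fderiv_right (m := ∞) (by simp)).clm_apply hx
    have hne : ∀ᶠ x in 𝓝 x₀, fderiv ℝ f x (Y x) ≠ 0 := by
      refine hds.self_of_nhds.continuousAt.eventually_ne ?_
      rw [hY0]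
      exact he.ne_zero _
    refine ⟨Fin.snoc (α := fun _ => E 4 → E 4) X (fun x => ‖fderiv ℝ f x (Y x)‖⁻¹ • Y x), ?_, ?_⟩
    · intro i
      induction i using Fin.lastCases with
      | last => simp [hY0, he.1 (Fin.last k)]
      | cast i => simp [hX]
    · filter_upwards [hX', hYs, hds, hne] with x ⟨hx1, hx2⟩ hx3 hx4 hx5
      constructor
      · intro i
        induction i using Fin.lastCases with
        | last =>
          rw [Fin.snoc_last]
          exact ((hx4.norm ℝ hx5).inv (by simpa using hx5)).smul hx3
        | cast i => simpa using hx1 i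
      · have horth : ∀ i, inner ℝ (fderiv ℝ f x (X i x)) (fderiv ℝ f x (Y x)) = 0 := by
          intro i
          simp only [hY, map_sub, map_sum, map_smul, inner_sub_right, inner_sum, inner_smul_right,
            orthonormal_iff_ite.1 hx2]
          simp
        rw [orthonormal_iff_ite]
        intro i j
        induction i using Fin.lastCases with
        | last =>
          induction j using Fin.lastCases with
          | last =>
            have : ‖fderiv ℝ f x (Y x)‖ ≠ 0 := by simpa using hx5
            simp only [Fin.snoc_last, map_smul, inner_smul_left, inner_smul_right,
              real_inner_self_eq_norm_sq]
            simp
            field_simp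
          | cast j =>
            have : Fin.last k ≠ j.castSucc := (Fin.castSucc_lt_last j).ne'
            simp only [Fin.snoc_last, Fin.snoc_castSucc, map_smul, inner_smul_left, this, if_false]
            rw [real_inner_comm, horth, mul_zero]
        | cast i =>
          induction j using Fin.lastCases with
          | last =>
            have : i.castSucc ≠ Fin.last k := (Fin.castSucc_lt_last i).ne
            simp only [Fin.snoc_last, Fin.snoc_castSucc, map_smul, inner_smul_right, this, if_false]
            rw [horth, mul_zero]
          | cast j =>
            simp only [Fin.snoc_castSucc, Fin.castSucc_inj]
            exact orthonormal_iff_ite.1 hx2 i j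

theorem matC_apply (l x : Fin 3 → ℝ) (i j : Fin 4) :
    matC l x i j = ∑ k, x k * coefC l k i j := by
  simp only [coefC_eq, Fin.sum_univ_three]
  fin_cases i <;> fin_cases j <;> simp [matC, mul_comm]

theorem coefC_zero_succ (l : Fin 3 → ℝ) (k j : Fin 3) :
    coefC l k 0 j.succ = if k = j then 1 else 0 := by
  rw [coefC_eq]
  fin_cases k <;> fin_cases j <;> simp

/-- The austere subspace of type C. -/
def spaceC (l : Fin 3 → ℝ) : Submodule ℝ (Matrix (Fin 4) (Fin 4) ℝ) :=
  LinearMap.range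
    ({ toFun := matC l
       map_add' := fun x y => by ext i j; simp [matC_apply, add_mul, Finset.sum_add_distrib]
       map_smul' := fun c x => by ext i j; simp [matC_apply, Finset.mul_sum, mul_assoc] } :
      (Fin 3 → ℝ) →ₗ[ℝ] Matrix (Fin 4) (Fin 4) ℝ)

theorem mem_spaceC {l : Fin 3 → ℝ} {A : Matrix (Fin 4) (Fin 4) ℝ} :
    A ∈ spaceC l ↔ ∃ x, matC l x = A := Iff.rfl

/-- 𝒬_C is a graph over the first row of its matrices, so membership becomes linear equations in the
entries. -/
theorem mem_spaceC_iff {l : Fin 3 → ℝ} {A : Matrix (Fin 4) (Fin 4) ℝ} :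
    A ∈ spaceC l ↔ ∀ i j, A i j = ∑ k : Fin 3, coefC l k i j * A 0 k.succ := by
  rw [mem_spaceC]
  constructor
  · rintro ⟨x, rfl⟩ i j
    rw [matC_apply]
    refine Finset.sum_congr rfl fun k _ => ?_
    rw [matC_apply]
    simp [coefC_zero_succ, mul_comm]
  · intro h
    refine ⟨fun k => A 0 k.succ, ?_⟩
    ext i j
    rw [matC_apply, h]
    exact Finset.sum_congr rfl fun k _ => mul_comm _ _

/-- The matrices of the coordinates of the second fundamental form. -/
def coordMatrix (f : E 4 → E n) (x : E 4) (e : Fin 4 → E 4) (k : Fin n) :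
    Matrix (Fin 4) (Fin 4) ℝ := Matrix.of fun i j => sff f x (e i) (e j) k

theorem isAdaptedAt_iff {l : Fin 3 → ℝ} {x : E 4} {e : Fin 4 → E 4}
    (he : Orthonormal ℝ fun i => fderiv ℝ f x (e i)) :
    IsAdaptedAt l f x e ↔ ∀ k, coordMatrix f x e k ∈ spaceC l := by
  simp only [IsAdaptedAt, he, true_and, mem_spaceC_iff, coordMatrix, Matrix.of_apply]
  constructor
  · intro h k i j
    have := congrArg (fun z : E n => z k) (h i j)
    simpa using this
  · intro h i j
    ext k
    simpa using h k i j

theorem span_coordMatrix {l : Fin 3 → ℝ} {x : E 4} {e : Fin 4 → E 4} (h : IsAdaptedAt l f x e)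
    (hr : sffRank f x = 3) :
    Submodule.span ℝ (Set.range (coordMatrix f x e)) = spaceC l := by
  apply le_antisymm
  · rw [Submodule.span_le]
    rintro _ ⟨k, rfl⟩
    exact (isAdaptedAt_iff h.1).1 h k
  · rintro _ ⟨z, rfl⟩
    have hli := h.linearIndependent hr
    set ν := fun k : Fin 3 => sff f x (e 0) (e k.succ) with hν
    let T : (Fin n → ℝ) →ₗ[ℝ] (Fin 3 → ℝ) :=
      LinearMap.pi fun c => ∑ k, (ν c k) • LinearMap.proj k
    have hT : ∀ y c, T y c = ∑ k, ν c k * y k := fun y c => by simp [T]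
    -- Row rank equals column rank: a functional that vanishes on the range of T would be a linear
    -- relation between the three independent normals.
    have hsurj : LinearMap.range T = ⊤ := by
      by_contra hne
      obtain ⟨g, hg0, hg⟩ := Submodule.exists_le_ker_of_lt_top _ (lt_top_iff_ne_top.2 hne)
      apply hg0
      have hgs : ∀ y : Fin 3 → ℝ, g y = ∑ c, g (Pi.single c 1) * y c := fun y => by
        conv_lhs => rw [pi_eq_sum_univ' y]
        simp [mul_comm]
      have hz : ∑ c, g (Pi.single c 1) • ν c = 0 := by
        ext k
        have := hg ⟨Pi.single k 1, rfl⟩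
        rw [LinearMap.mem_ker, hgs] at this
        simpa [hT, Pi.single_apply] using this
      have hc := Fintype.linearIndependent_iff.1 hli _ hz
      ext c
      simpa using hc c
    obtain ⟨y, rfl⟩ := LinearMap.range_eq_top.1 hsurj z
    have : matC l (T y) = ∑ k, y k • coordMatrix f x e k := by
      ext i j
      rw [matC_apply]
      simp only [hT, Matrix.sum_apply, Matrix.smul_apply, coordMatrix, Matrix.of_apply, smul_eq_mul]
      have hk : ∀ k, sff f x (e i) (e j) k = ∑ c, coefC l c i j * ν c k := fun k => by
        have := congrArg (fun z : E n => z k) (h.2 i j)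
        simpa using this
      simp only [hk, Finset.mul_sum, Finset.sum_mul]
      rw [Finset.sum_comm]
      refine Finset.sum_congr rfl fun k _ => Finset.sum_congr rfl fun c _ => by ring
    change matC l (T y) ∈ _
    rw [this]
    exact Submodule.sum_mem _ fun k _ => Submodule.smul_mem _ _ (Submodule.subset_span ⟨k, rfl⟩)

theorem coordMatrix_rotate {x : E 4} {e : Fin 4 → E 4} (h : Matrix (Fin 4) (Fin 4) ℝ) (k : Fin n) :
    coordMatrix f x (fun j => ∑ i, h i j • e i) k = h.transpose * coordMatrix f x e k * h := by
  ext i j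
  simp only [coordMatrix, Matrix.of_apply, Matrix.mul_apply, Matrix.transpose_apply, sff_sum_left,
    sff_sum_right, sff_smul_left, sff_smul_right, Finset.sum_mul]
  simp only [WithLp.ofLp_sum, Finset.sum_apply, WithLp.ofLp_smul, Pi.smul_apply, smul_eq_mul,
    Finset.mul_sum]
  refine Finset.sum_congr rfl fun a _ => Finset.sum_congr rfl fun b _ => by ring

theorem orthonormal_rotate {x : E 4} {e : Fin 4 → E 4}
    (he : Orthonormal ℝ fun i => fderiv ℝ f x (e i)) (h : Matrix (Fin 4) (Fin 4) ℝ) :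
    (Orthonormal ℝ fun j => fderiv ℝ f x (∑ i, h i j • e i)) ↔ h.transpose * h = 1 := by
  rw [orthonormal_iff_ite, ← Matrix.ext_iff]
  refine forall_congr' fun i => forall_congr' fun j => ?_
  simp only [map_sum, map_smul, sum_inner, inner_sum, inner_smul_left, inner_smul_right,
    orthonormal_iff_ite.1 he, Matrix.mul_apply, Matrix.transpose_apply, Matrix.one_apply]
  simp [mul_comm]

theorem sff_smooth {X : Fin 4 → E 4 → E 4} {Y Z : E 4 → E 4} {x : E 4}
    (hf : ContDiffAt ℝ ∞ f x) (hX : ∀ i, ContDiffAt ℝ ∞ (X i) x) (hY : ContDiffAt ℝ ∞ Y x)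
    (hZ : ContDiffAt ℝ ∞ Z x)
    (ho : ∀ᶠ x in 𝓝 x, Orthonormal ℝ fun i => fderiv ℝ f x (X i x)) :
    ContDiffAt ℝ ∞ (fun x => sff f x (Y x) (Z x)) x := by
  have h1 : ContDiffAt ℝ ∞ (fderiv ℝ f) x := hf.fderiv_right (by simp)
  have h2 : ContDiffAt ℝ ∞ (fderiv ℝ (fderiv ℝ f)) x := h1.fderiv_right (by simp)
  have h3 : ContDiffAt ℝ ∞ (fun x => fderiv ℝ (fderiv ℝ f) x (Y x) (Z x)) x :=
    (h2.clm_apply hY).clm_apply hZ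
  have h4 : ContDiffAt ℝ ∞ (fun x => fderiv ℝ (fderiv ℝ f) x (Y x) (Z x) -
      ∑ i, inner ℝ (fderiv ℝ f x (X i x)) (fderiv ℝ (fderiv ℝ f) x (Y x) (Z x)) •
        fderiv ℝ f x (X i x)) x := by
    refine h3.sub (ContDiffAt.sum fun i _ => ?_)
    have h5 := h1.clm_apply (hX i)
    exact (h5.inner ℝ h3).smul h5
  refine h4.congr_of_eventuallyEq ?_
  filter_upwards [ho] with x hx
  exact sff_eq hx _ _

open scoped Matrix.Norms.Frobenius in
theorem contDiffAt_matrix {B : E 4 → Matrix (Fin 4) (Fin 4) ℝ} {x : E 4}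
    (h : ∀ i j, ContDiffAt ℝ ∞ (fun x => B x i j) x) : ContDiffAt ℝ ∞ B x := by
  have : B = fun x => ∑ i, ∑ j, B x i j • Matrix.single i j (1 : ℝ) := by
    funext x
    conv_lhs => rw [Matrix.matrix_eq_sum_single (B x)]
    simp [Matrix.smul_single]
  rw [this]
  exact ContDiffAt.sum fun i _ => ContDiffAt.sum fun j _ => (h i j).smul contDiffAt_const

open scoped Matrix.Norms.Frobenius in
theorem ContDiffAt.matrix_entry {B : E 4 → Matrix (Fin 4) (Fin 4) ℝ} {x : E 4}
    (h : ContDiffAt ℝ ∞ B x) (i j : Fin 4) : ContDiffAt ℝ ∞ (fun x => B x i j) x :=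
  (LinearMap.toContinuousLinearMap (Matrix.entryLinearMap ℝ ℝ i j)).contDiff.contDiffAt.comp x h

open scoped Matrix.Norms.Frobenius in
/-- Pointwise adapted frames can be chosen smoothly. -/
theorem exists_adapted_frame {l : Fin 3 → ℝ} (hf : ∀ᶠ x in 𝓝 x₀, ContDiffAt ℝ ∞ f x)
    (ha : ∀ᶠ x in 𝓝 x₀, ∃ e, IsAdaptedAt l f x e) (hr : sffRank f x₀ = 3) :
    ∃ X : Fin 4 → E 4 → E 4, ∀ᶠ x in 𝓝 x₀, (∀ i, ContDiffAt ℝ ∞ (X i) x) ∧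
      IsAdaptedAt l f x fun i => X i x := by
  obtain ⟨e, he⟩ := ha.self_of_nhds
  obtain ⟨X, hX0, hX⟩ := exists_orthonormal_frame hf e he.1
  have hB : ∀ᶠ x in 𝓝 x₀, ∀ k, ContDiffAt ℝ ∞ (fun x => coordMatrix f x (fun i => X i x) k) x := by
    filter_upwards [hf, hX, hX.eventually_nhds] with x hfx hXx hXn k
    refine contDiffAt_matrix fun i j => ?_
    have := sff_smooth hfx hXx.1 (hXx.1 i) (hXx.1 j) (hXn.mono fun x hx => hx.2)
    exact contDiffAt_euclidean.1 this k
  have hW : Submodule.span ℝ (Set.range fun k => coordMatrix f x₀ (fun i => X i x₀) k) =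
      spaceC l := by
    simp only [hX0]
    exact span_coordMatrix he hr
  -- At each nearby point the given adapted frame, expanded in the smooth frame X, supplies a
  -- rotation into 𝒬_C; only its existence is used.
  obtain ⟨h, hh⟩ := exists_smooth_rotation hB hW (by
    filter_upwards [ha, hX] with x ⟨e', he'⟩ hXx
    have ht := fun v => (span_eq_top_of_orthonormal hXx.2).ge (Submodule.mem_top (x := v))
    choose c hc using fun j => (Submodule.mem_span_range_iff_exists_fun ℝ).1 (ht (e' j))
    have he'' : e' = fun j => ∑ i, (Matrix.of fun i j => c j i) i j • X i x :=
      funext fun j => (hc j).symm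
    rw [he''] at he'
    refine ⟨Matrix.of fun i j => c j i, (orthonormal_rotate hXx.2 _).1 he'.1, fun k => ?_⟩
    rw [← coordMatrix_rotate]
    exact (isAdaptedAt_iff he'.1).1 he' k)
  refine ⟨fun j x => ∑ i, h x i j • X i x, ?_⟩
  filter_upwards [hX, hh] with x hXx hhx
  constructor
  · intro j
    exact ContDiffAt.sum fun i _ => (ContDiffAt.matrix_entry hhx.1 i j).smul (hXx.1 i)
  · have ho := (orthonormal_rotate hXx.2 (h x)).2 hhx.2.1
    rw [isAdaptedAt_iff ho]
    intro k
    rw [coordMatrix_rotate]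
    exact hhx.2.2 k

end

end Austere

/-! ### Change of parameters, and from the manifold to local models -/

namespace Austere

section
open Filter Topology

variable {n : ℕ}

section ChainRule

variable {f g : E 4 → E n} {φ : E 4 → E 4} {y : E 4}

theorem fderiv_comp_eventually (hφ : ContDiffAt ℝ ∞ φ y) (hf : ContDiffAt ℝ ∞ f (φ y))
    (h : g =ᶠ[𝓝 y] f ∘ φ) :
    fderiv ℝ g =ᶠ[𝓝 y] fun x => (fderiv ℝ f (φ x)).comp (fderiv ℝ φ x) := by
  have h1 := (hφ.of_le (m := 1) (by simp)).eventually (by simp)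
  have h2 := hφ.continuousAt.eventually ((hf.of_le (m := 1) (by simp)).eventually (by simp))
  filter_upwards [h.eventuallyEq_nhds, h1, h2] with x hx h1x h2x
  rw [hx.fderiv_eq, fderiv_comp _ (h2x.differentiableAt (by simp))
    (h1x.differentiableAt (by simp))]

theorem fderiv_fderiv_comp (hφ : ContDiffAt ℝ ∞ φ y) (hf : ContDiffAt ℝ ∞ f (φ y))
    (h : g =ᶠ[𝓝 y] f ∘ φ) (v w : E 4) :
    fderiv ℝ (fderiv ℝ g) y v w =
      fderiv ℝ (fderiv ℝ f) (φ y) (fderiv ℝ φ y v) (fderiv ℝ φ y w) +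
        fderiv ℝ f (φ y) (fderiv ℝ (fderiv ℝ φ) y v w) := by
  rw [(fderiv_comp_eventually hφ hf h).fderiv_eq]
  have h1 : DifferentiableAt ℝ (fderiv ℝ φ) y :=
    (hφ.fderiv_right (m := ∞) (by simp)).differentiableAt (by simp)
  have h2 : DifferentiableAt ℝ (fderiv ℝ f) (φ y) :=
    (hf.fderiv_right (m := ∞) (by simp)).differentiableAt (by simp)
  have h3 : DifferentiableAt ℝ φ y := hφ.differentiableAt (by simp)
  have h4 : DifferentiableAt ℝ (fun x => fderiv ℝ f (φ x)) y := h2.comp y h3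
  rw [fderiv_clm_comp h4 h1, fderiv_fun_comp y h2 h3]
  simp [add_comm]

theorem fderiv_comp_apply (hφ : ContDiffAt ℝ ∞ φ y) (hf : ContDiffAt ℝ ∞ f (φ y))
    (h : g =ᶠ[𝓝 y] f ∘ φ) (v : E 4) : fderiv ℝ g y v = fderiv ℝ f (φ y) (fderiv ℝ φ y v) := by
  rw [(fderiv_comp_eventually hφ hf h).eq_of_nhds]
  rfl

/-- The second derivative of the transition map only contributes a tangent vector, which the normal
projection kills. -/
theorem sff_comp (hφ : ContDiffAt ℝ ∞ φ y) (hf : ContDiffAt ℝ ∞ f (φ y))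
    (h : g =ᶠ[𝓝 y] f ∘ φ) (hs : Function.Surjective (fderiv ℝ φ y)) (v w : E 4) :
    sff g y v w = sff f (φ y) (fderiv ℝ φ y v) (fderiv ℝ φ y w) := by
  have hr : LinearMap.range (fderiv ℝ g y).toLinearMap =
      LinearMap.range (fderiv ℝ f (φ y)).toLinearMap := by
    ext z
    simp only [LinearMap.mem_range, ContinuousLinearMap.coe_coe, fderiv_comp_apply hφ hf h]
    constructor
    · rintro ⟨v, rfl⟩
      exact ⟨_, rfl⟩
    · rintro ⟨v, rfl⟩
      obtain ⟨u, rfl⟩ := hs v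
      exact ⟨u, rfl⟩
  have hp : ∀ z, (LinearMap.range (fderiv ℝ g y).toLinearMap)ᗮ.starProjection z =
      (LinearMap.range (fderiv ℝ f (φ y)).toLinearMap)ᗮ.starProjection z := by
    intro z
    congr 2
    rw [hr]
  rw [sff, sff, hp, fderiv_fderiv_comp hφ hf h, map_add]
  have hm := LinearMap.mem_range_self (fderiv ℝ f (φ y)).toLinearMap
    (fderiv ℝ (fderiv ℝ φ) y v w)
  rw [ContinuousLinearMap.coe_coe] at hm
  rw [Submodule.starProjection_orthogonal_apply_eq_zero hm, add_zero]

theorem isAdaptedAt_comp {l : Fin 3 → ℝ} {e : Fin 4 → E 4} (hφ : ContDiffAt ℝ ∞ φ y)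
    (hf : ContDiffAt ℝ ∞ f (φ y)) (h : g =ᶠ[𝓝 y] f ∘ φ)
    (hs : Function.Surjective (fderiv ℝ φ y)) :
    IsAdaptedAt l g y e ↔ IsAdaptedAt l f (φ y) fun i => fderiv ℝ φ y (e i) := by
  simp only [IsAdaptedAt, sff_comp hφ hf h hs, fderiv_comp_apply hφ hf h]

theorem sffRank_comp (hφ : ContDiffAt ℝ ∞ φ y)
    (hf : ContDiffAt ℝ ∞ f (φ y)) (h : g =ᶠ[𝓝 y] f ∘ φ)
    (hs : Function.Surjective (fderiv ℝ φ y)) : sffRank g y = sffRank f (φ y) := by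
  suffices {z | ∃ v w, sff g y v w = z} = {z | ∃ v w, sff f (φ y) v w = z} by
    rw [sffRank, sffRank, this]
  ext z
  simp only [Set.mem_ofPred_eq, sff_comp hφ hf h hs]
  constructor
  · rintro ⟨v, w, rfl⟩
    exact ⟨_, _, rfl⟩
  · rintro ⟨v, w, rfl⟩
    obtain ⟨v, rfl⟩ := hs v
    obtain ⟨w, rfl⟩ := hs w
    exact ⟨v, w, rfl⟩

end ChainRule

/-- A map `ℝ⁴ → ℝⁿ` with a global smooth orthonormal frame in which its second fundamental form
has the shape of type C and rank three. -/
structure AdaptedFrame (l : Fin 3 → ℝ) (f : E 4 → E n) (X : Fin 4 → E 4 → E 4) : Prop where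
  smooth : ContDiff ℝ ∞ f
  smoothX : ∀ i, ContDiff ℝ ∞ (X i)
  adapted : ∀ x, IsAdaptedAt l f x fun i => X i x
  rank : ∀ x, sffRank f x = 3

/-- A map with adapted frames is, near every point, a reparametrisation of one with a global
adapted frame. -/
theorem exists_global_frame {l : Fin 3 → ℝ} {f : E 4 → E n} {x₀ : E 4}
    (hf : ∀ᶠ x in 𝓝 x₀, ContDiffAt ℝ ∞ f x) (ha : ∀ᶠ x in 𝓝 x₀, ∃ e, IsAdaptedAt l f x e)
    (hr : ∀ᶠ x in 𝓝 x₀, sffRank f x = 3) :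
    ∃ g : E 4 → E n, (∃ X, AdaptedFrame l g X) ∧ ∀ᶠ x in 𝓝 x₀, f x ∈ Set.range g := by
  obtain ⟨X, hX⟩ := exists_adapted_frame hf ha hr.self_of_nhds
  obtain ⟨ρ, hρ, hall⟩ := Metric.eventually_nhds_iff_ball.1 (hf.and (hr.and hX))
  -- A diffeomorphism of ℝ⁴ onto a small ball makes the frame global, so that the later calculus
  -- needs no neighbourhoods.
  set φ := OpenPartialHomeomorph.univBall x₀ ρ with hφdef
  have hsource : φ.source = Set.univ := OpenPartialHomeomorph.univBall_source x₀ ρ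
  have htarget : φ.target = Metric.ball x₀ ρ := OpenPartialHomeomorph.univBall_target x₀ hρ
  have hφ : ContDiff ℝ ∞ φ := OpenPartialHomeomorph.contDiff_univBall
  have hφs : ContDiffOn ℝ ∞ φ.symm (Metric.ball x₀ ρ) :=
    OpenPartialHomeomorph.contDiffOn_univBall_symm
  have hmem : ∀ y, φ y ∈ Metric.ball x₀ ρ := fun y =>
    htarget ▸ φ.map_source (hsource ▸ Set.mem_univ y)
  have hinv : ∀ y, (fderiv ℝ φ y).IsInvertible := by
    intro y
    have h1 : ContDiffAt ℝ ∞ φ.symm (φ y) :=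
      hφs.contDiffAt (Metric.isOpen_ball.mem_nhds (hmem y))
    have h2 : DifferentiableAt ℝ φ.symm (φ y) := h1.differentiableAt (by simp)
    have h3 : DifferentiableAt ℝ φ y := hφ.contDiffAt.differentiableAt (by simp)
    have h4 : (fderiv ℝ φ.symm (φ y)).comp (fderiv ℝ φ y) = ContinuousLinearMap.id ℝ (E 4) := by
      rw [← fderiv_comp _ h2 h3]
      have : φ.symm ∘ φ = id := funext fun z => φ.left_inv (hsource ▸ Set.mem_univ z)
      rw [this, fderiv_id]
    have h5 : Function.Injective (fderiv ℝ φ y) := by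
      intro u v huv
      have := congrArg (fderiv ℝ φ.symm (φ y)) huv
      have h6 := fun u => DFunLike.congr_fun h4 u
      simp only [ContinuousLinearMap.comp_apply, ContinuousLinearMap.id_apply] at h6
      rwa [h6, h6] at this
    exact ⟨(LinearEquiv.ofInjectiveEndo (fderiv ℝ φ y).toLinearMap h5).toContinuousLinearEquiv,
      by ext; rfl⟩
  have hinvX : ∀ i y, fderiv ℝ φ y ((fderiv ℝ φ y).inverse (X i (φ y))) = X i (φ y) := by
    intro i y
    exact (hinv y).self_apply_inverse _
  have hsurj : ∀ y, Function.Surjective (fderiv ℝ φ y) := fun y => (hinv y).bijective.surjective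
  have hfφ : ∀ y, ContDiffAt ℝ ∞ f (φ y) := fun y => (hall _ (hmem y)).1
  refine ⟨f ∘ φ, ⟨fun i y => (fderiv ℝ φ y).inverse (X i (φ y)), ?_, ?_, ?_, ?_⟩, ?_⟩
  · exact contDiff_iff_contDiffAt.2 fun y => (hfφ y).comp y hφ.contDiffAt
  · refine fun i => contDiff_iff_contDiffAt.2 fun y => ?_
    have h1 : ContDiffAt ℝ ∞ (fun y => X i (φ y)) y :=
      ((hall _ (hmem y)).2.2.1 i).comp y hφ.contDiffAt
    have h2 : ContDiffAt ℝ ∞ (fun y => (fderiv ℝ φ y).inverse) y :=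
      ContDiffAt.comp (g := ContinuousLinearMap.inverse) y (hinv y).contDiffAt_map_inverse
        (hφ.contDiffAt.fderiv_right (by simp))
    exact h2.clm_apply h1
  · intro y
    rw [isAdaptedAt_comp hφ.contDiffAt (hfφ y) EventuallyEq.rfl (hsurj y)]
    simp only [hinvX]
    exact (hall _ (hmem y)).2.2.2
  · intro y
    rw [sffRank_comp hφ.contDiffAt (hfφ y) EventuallyEq.rfl (hsurj y)]
    exact (hall _ (hmem y)).2.1
  · filter_upwards [Metric.ball_mem_nhds x₀ hρ] with x hx
    exact ⟨φ.symm x, congrArg f (φ.right_inv (htarget ▸ hx))⟩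

section Manifold

variable {M : Type*} [TopologicalSpace M] [ChartedSpace (E 4) M]

theorem differential_eq_fderiv {F : M → E n} (hF : IsImmersed F) (p : M) :
    differential F p = fderiv ℝ (localRep F p) (extChartAt 𝓘(ℝ, E 4) p p) := by
  rw [differential, ((hF.smooth p).mdifferentiableAt (by simp)).mfderiv]
  simp only [writtenInExtChartAt, localRep, modelWithCornersSelf_coe, Set.range_id,
    fderivWithin_univ, extChartAt_model_space_eq_id]
  rfl

theorem secondFundamentalForm_eq {F : M → E n} (hF : IsImmersed F) (p : M) (v w : E 4) :
    secondFundamentalForm F p v w =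
      sff (localRep F p) (extChartAt 𝓘(ℝ, E 4) p p) v w := by
  rw [secondFundamentalForm, sff]
  have : normalSpace F p = (LinearMap.range
      (fderiv ℝ (localRep F p) (extChartAt 𝓘(ℝ, E 4) p p)).toLinearMap)ᗮ := by
    rw [normalSpace, tangentPlane, differential_eq_fderiv hF]
  congr 2

theorem normalRank_eq {F : M → E n} (hF : IsImmersed F) (p : M) :
    normalRank F p = sffRank (localRep F p) (extChartAt 𝓘(ℝ, E 4) p p) := by
  suffices {z | ∃ v w, secondFundamentalForm F p v w = z} =
      {z | ∃ v w, sff (localRep F p) (extChartAt 𝓘(ℝ, E 4) p p) v w = z} by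
    rw [normalRank, firstNormalSpace, sffRank, this]
  simp only [secondFundamentalForm_eq hF]

theorem exists_isAdaptedAt {F : M → E n} (hF : IsImmersed F) {l : Fin 3 → ℝ}
    (hC : IsTypeC F fun _ => l) (p : M) :
    ∃ e, IsAdaptedAt l (localRep F p) (extChartAt 𝓘(ℝ, E 4) p p) e := by
  obtain ⟨e, he, hm⟩ := hC.conj p
  refine ⟨e, by simpa only [IsTangentFrame, differential_eq_fderiv hF] using he, fun i j => ?_⟩
  simp only [← secondFundamentalForm_eq hF]
  -- Let ν be the defect of the normal form. It is normal, so the matrix of II_ν lies in 𝒬_C, and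
  -- the linear relations that define 𝒬_C say precisely that ⟨ν, ν⟩ = 0.
  rw [← sub_eq_zero, ← inner_self_eq_zero (𝕜 := ℝ)]
  set ν := secondFundamentalForm F p (e i) (e j) - ∑ k : Fin 3, coefC l k i j •
    secondFundamentalForm F p (e 0) (e k.succ) with hν
  have hsn : ∀ v w, secondFundamentalForm F p v w ∈ normalSpace F p := fun v w =>
    Submodule.starProjection_apply_mem _ _
  obtain ⟨x, hx⟩ := hm ν (Submodule.sub_mem _ (hsn _ _) (Submodule.sum_mem _ fun k _ =>
    Submodule.smul_mem _ _ (hsn _ _)))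
  have h1 : ∀ i j, inner ℝ ν (secondFundamentalForm F p (e i) (e j)) = matC l x i j := by
    intro i j
    rw [hx]
    rfl
  rw (occs := .pos [2]) [hν]
  rw [inner_sub_right, inner_sum]
  simp only [inner_smul_right, h1, matC_apply]
  simp [coefC_zero_succ, mul_comm]

theorem localRep_eventuallyEq (F : M → E n) (p q : M)
    (hq : q ∈ (extChartAt 𝓘(ℝ, E 4) p).source) :
    localRep F q =ᶠ[𝓝 (extChartAt 𝓘(ℝ, E 4) q q)]
      localRep F p ∘ (extChartAt 𝓘(ℝ, E 4) p ∘ (extChartAt 𝓘(ℝ, E 4) q).symm) := by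
  have hc : ContinuousAt (extChartAt 𝓘(ℝ, E 4) q).symm (extChartAt 𝓘(ℝ, E 4) q q) :=
    continuousAt_extChartAt_symm q
  have h1 := hc.preimage_mem_nhds (by
    rw [extChartAt_to_inv]
    exact (isOpen_extChartAt_source (I := 𝓘(ℝ, E 4)) p).mem_nhds hq)
  filter_upwards [h1] with x hx
  simp only [localRep, Function.comp_apply, PartialEquiv.left_inv _ (Set.mem_preimage.1 hx)]

variable [IsManifold 𝓘(ℝ, E 4) ∞ M]

theorem localRep_contDiffAt {F : M → E n} (hF : IsImmersed F) (p : M) {x : E 4}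
    (hx : x ∈ (extChartAt 𝓘(ℝ, E 4) p).target) : ContDiffAt ℝ ∞ (localRep F p) x := by
  have h1 : ContMDiffAt 𝓘(ℝ, E 4) 𝓘(ℝ, E 4) ∞ (extChartAt 𝓘(ℝ, E 4) p).symm x :=
    (contMDiffOn_extChartAt_symm p).contMDiffAt ((isOpen_extChartAt_target p).mem_nhds hx)
  exact (hF.smooth.contMDiffAt.comp x h1).contDiffAt

theorem contDiffAt_transition (p q : M) (hq : q ∈ (extChartAt 𝓘(ℝ, E 4) p).source) :
    ContDiffAt ℝ ∞ (extChartAt 𝓘(ℝ, E 4) p ∘ (extChartAt 𝓘(ℝ, E 4) q).symm)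
      (extChartAt 𝓘(ℝ, E 4) q q) := by
  have h1 : ContMDiffAt 𝓘(ℝ, E 4) 𝓘(ℝ, E 4) ∞ (extChartAt 𝓘(ℝ, E 4) q).symm
      (extChartAt 𝓘(ℝ, E 4) q q) :=
    (contMDiffOn_extChartAt_symm q).contMDiffAt
      ((isOpen_extChartAt_target q).mem_nhds (mem_extChartAt_target q))
  have h2 : ContMDiffAt 𝓘(ℝ, E 4) 𝓘(ℝ, E 4) ∞ (extChartAt 𝓘(ℝ, E 4) p)
      ((extChartAt 𝓘(ℝ, E 4) q).symm (extChartAt 𝓘(ℝ, E 4) q q)) := by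
    rw [extChartAt_to_inv]
    exact contMDiffAt_extChartAt' (by simpa using hq)
  exact (h2.comp _ h1).contDiffAt

theorem surjective_fderiv_transition (p q : M) (hq : q ∈ (extChartAt 𝓘(ℝ, E 4) p).source) :
    Function.Surjective (fderiv ℝ (extChartAt 𝓘(ℝ, E 4) p ∘ (extChartAt 𝓘(ℝ, E 4) q).symm)
      (extChartAt 𝓘(ℝ, E 4) q q)) := by
  set φ := extChartAt 𝓘(ℝ, E 4) p ∘ (extChartAt 𝓘(ℝ, E 4) q).symm
  set ψ := extChartAt 𝓘(ℝ, E 4) q ∘ (extChartAt 𝓘(ℝ, E 4) p).symm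
  set y := extChartAt 𝓘(ℝ, E 4) q q
  have hφ : DifferentiableAt ℝ φ y := (contDiffAt_transition p q hq).differentiableAt (by simp)
  have hx : extChartAt 𝓘(ℝ, E 4) p q ∈ (extChartAt 𝓘(ℝ, E 4) p).target :=
    (extChartAt 𝓘(ℝ, E 4) p).map_source hq
  have hψ : DifferentiableAt ℝ ψ (extChartAt 𝓘(ℝ, E 4) p q) := by
    have h1 : ContMDiffAt 𝓘(ℝ, E 4) 𝓘(ℝ, E 4) ∞ (extChartAt 𝓘(ℝ, E 4) p).symm
        (extChartAt 𝓘(ℝ, E 4) p q) :=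
      (contMDiffOn_extChartAt_symm p).contMDiffAt ((isOpen_extChartAt_target p).mem_nhds hx)
    have h2 : ContMDiffAt 𝓘(ℝ, E 4) 𝓘(ℝ, E 4) ∞ (extChartAt 𝓘(ℝ, E 4) q)
        ((extChartAt 𝓘(ℝ, E 4) p).symm (extChartAt 𝓘(ℝ, E 4) p q)) := by
      rw [PartialEquiv.left_inv _ hq]
      exact contMDiffAt_extChartAt
    exact (h2.comp _ h1).contDiffAt.differentiableAt (by simp)
  have hy : ψ (extChartAt 𝓘(ℝ, E 4) p q) = y := by
    simp only [ψ, Function.comp_apply, PartialEquiv.left_inv _ hq, y]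
  have hid : φ ∘ ψ =ᶠ[𝓝 (extChartAt 𝓘(ℝ, E 4) p q)] id := by
    have hc : ContinuousAt (extChartAt 𝓘(ℝ, E 4) p).symm (extChartAt 𝓘(ℝ, E 4) p q) :=
      continuousAt_extChartAt_symm'' hx
    have h1 := hc.preimage_mem_nhds (by
      rw [PartialEquiv.left_inv _ hq]
      exact extChartAt_source_mem_nhds (I := 𝓘(ℝ, E 4)) q)
    filter_upwards [h1, (isOpen_extChartAt_target (I := 𝓘(ℝ, E 4)) p).mem_nhds hx] with x h1x h2x
    simp only [φ, ψ, Function.comp_apply, PartialEquiv.left_inv _ (Set.mem_preimage.1 h1x), id,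
      PartialEquiv.right_inv _ h2x]
  intro v
  refine ⟨fderiv ℝ ψ (extChartAt 𝓘(ℝ, E 4) p q) v, ?_⟩
  have h3 := hid.fderiv_eq (𝕜 := ℝ)
  rw [fderiv_comp _ (hy ▸ hφ) hψ, hy, fderiv_id] at h3
  exact DFunLike.congr_fun h3 v

/-- An immersion of type C and normal rank three is locally parametrised by maps with global
adapted frames. -/
theorem exists_local_model {F : M → E n} (hF : IsImmersed F) {l : Fin 3 → ℝ}
    (hC : IsTypeC F fun _ => l) (hrank : ∀ p, normalRank F p = 3) (p : M) :
    ∃ g : E 4 → E n, (∃ X, AdaptedFrame l g X) ∧ ∀ᶠ q in 𝓝 p, F q ∈ Set.range g := by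
  have key : ∀ᶠ x in 𝓝 (extChartAt 𝓘(ℝ, E 4) p p), ContDiffAt ℝ ∞ (localRep F p) x ∧
      (∃ e, IsAdaptedAt l (localRep F p) x e) ∧ sffRank (localRep F p) x = 3 := by
    filter_upwards [extChartAt_target_mem_nhds (I := 𝓘(ℝ, E 4)) p] with x hx
    set q := (extChartAt 𝓘(ℝ, E 4) p).symm x
    have hq : q ∈ (extChartAt 𝓘(ℝ, E 4) p).source := (extChartAt 𝓘(ℝ, E 4) p).map_target hx
    set φ := extChartAt 𝓘(ℝ, E 4) p ∘ (extChartAt 𝓘(ℝ, E 4) q).symm with hφ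
    have hφx : φ (extChartAt 𝓘(ℝ, E 4) q q) = x := by
      simp only [hφ, Function.comp_apply, extChartAt_to_inv]
      exact (extChartAt 𝓘(ℝ, E 4) p).right_inv hx
    have hs := localRep_contDiffAt hF p hx
    have h1 := contDiffAt_transition p q hq
    have h2 := surjective_fderiv_transition p q hq
    have h3 := localRep_eventuallyEq F p q hq
    have h4 : ContDiffAt ℝ ∞ (localRep F p) (φ (extChartAt 𝓘(ℝ, E 4) q q)) := by rwa [hφx]
    obtain ⟨e, he⟩ := exists_isAdaptedAt hF hC q
    rw [isAdaptedAt_comp h1 h4 h3 h2] at he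
    have hr := hrank q
    rw [normalRank_eq hF, sffRank_comp h1 h4 h3 h2] at hr
    rw [← hφ, hφx] at he hr
    exact ⟨hs, ⟨_, he⟩, hr⟩
  obtain ⟨g, hg, hev⟩ := exists_global_frame (key.mono fun x hx => hx.1)
    (key.mono fun x hx => hx.2.1) (key.mono fun x hx => hx.2.2)
  refine ⟨g, hg, ?_⟩
  filter_upwards [(continuousAt_extChartAt (I := 𝓘(ℝ, E 4)) p).eventually hev,
    extChartAt_source_mem_nhds (I := 𝓘(ℝ, E 4)) p] with q h1 h2
  simpa only [localRep, Function.comp_apply, PartialEquiv.left_inv _ h2] using h1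

end Manifold

end

end Austere

/-! ### Gauss and Codazzi equations of an adapted frame -/

namespace Austere

section
open Filter Topology

variable {n : ℕ}

section FrameDerivVector

variable {W : Type*} [NormedAddCommGroup W] [NormedSpace ℝ W] {X : Fin 4 → E 4 → E 4} {c : Fin 4}

theorem frameDeriv_fun_add {f g : E 4 → W} (hf : ContDiff ℝ ∞ f) (hg : ContDiff ℝ ∞ g) (x : E 4) :
    frameDeriv X c (fun x => f x + g x) x = frameDeriv X c f x + frameDeriv X c g x := by
  simp only [frameDeriv]
  rw [fderiv_fun_add (hf.differentiable (by simp) x) (hg.differentiable (by simp) x)]; rfl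

theorem frameDeriv_fun_sub {f g : E 4 → W} (hf : ContDiff ℝ ∞ f) (hg : ContDiff ℝ ∞ g) (x : E 4) :
    frameDeriv X c (fun x => f x - g x) x = frameDeriv X c f x - frameDeriv X c g x := by
  simp only [frameDeriv]
  rw [fderiv_fun_sub (hf.differentiable (by simp) x) (hg.differentiable (by simp) x)]; rfl

theorem frameDeriv_sum {ι : Type*} (s : Finset ι) {f : ι → E 4 → W}
    (hf : ∀ i, ContDiff ℝ ∞ (f i)) (x : E 4) :
    frameDeriv X c (fun x => ∑ i ∈ s, f i x) x = ∑ i ∈ s, frameDeriv X c (f i) x := by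
  simp only [frameDeriv]
  rw [fderiv_fun_sum fun i _ => (hf i).differentiable (by simp) x, sum_apply]

theorem frameDeriv_smul {f : E 4 → ℝ} {g : E 4 → W} (hf : ContDiff ℝ ∞ f) (hg : ContDiff ℝ ∞ g)
    (x : E 4) :
    frameDeriv X c (fun x => f x • g x) x =
      frameDeriv X c f x • g x + f x • frameDeriv X c g x := by
  simp only [frameDeriv]
  rw [fderiv_fun_smul (hf.differentiable (by simp) x) (hg.differentiable (by simp) x)]
  simp [add_comm]

theorem frameDeriv_const_smul (k : ℝ) {g : E 4 → W} (hg : ContDiff ℝ ∞ g) (x : E 4) :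
    frameDeriv X c (fun x => k • g x) x = k • frameDeriv X c g x := by
  simp only [frameDeriv]
  rw [fderiv_fun_const_smul (hg.differentiable (by simp) x)]
  simp

theorem frameDeriv_inner {f g : E 4 → E n} (hf : ContDiff ℝ ∞ f) (hg : ContDiff ℝ ∞ g) (x : E 4) :
    frameDeriv X c (fun x => inner ℝ (f x) (g x)) x =
      inner ℝ (frameDeriv X c f x) (g x) + inner ℝ (f x) (frameDeriv X c g x) := by
  simp only [frameDeriv]
  rw [fderiv_inner_apply ℝ (hf.differentiable (by simp) x) (hg.differentiable (by simp) x)]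
  exact add_comm _ _

end FrameDerivVector

variable (f : E 4 → E n) (X : Fin 4 → E 4 → E 4)

/-- The fields of a frame as tangent vectors of the ambient space. -/
def tangentField (a : Fin 4) (x : E 4) : E n := fderiv ℝ f x (X a x)

/-- The normal fields `II(X₀, Xᵢ₊₁)`. -/
def normalField (i : Fin 3) (x : E 4) : E n := sff f x (X 0 x) (X i.succ x)

/-- The connection coefficients `⟨∇_c X_b, X_a⟩`. -/
def connCoef (c a b : Fin 4) (x : E 4) : ℝ :=
  inner ℝ (tangentField f X a x) (frameDeriv X c (tangentField f X b) x)

/-- The Gram matrix of the normal fields. -/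
def gramCoef (i j : Fin 3) (x : E 4) : ℝ := inner ℝ (normalField f X i x) (normalField f X j x)

variable {f X} {l : Fin 3 → ℝ}

theorem coefC_symm (l : Fin 3 → ℝ) (k : Fin 3) (a b : Fin 4) : coefC l k a b = coefC l k b a := by
  rw [coefC_eq]
  fin_cases k <;> fin_cases a <;> fin_cases b <;> simp

/-- A symmetric trilinear form whose contractions have the shape of type C vanishes. -/
theorem eq_zero_of_symmetric {Z : Fin 4 → Fin 3 → ℝ}
    (key : ∀ c d a, ∑ k, coefC l k d a * Z c k = ∑ k, coefC l k c a * Z d k)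
    (c : Fin 4) (i : Fin 3) : Z c i = 0 := by
  simp only [coefC_eq, Fin.sum_univ_three] at key
  have a1 := key 0 1 0
  have a2 := key 0 2 0
  have a3 := key 0 3 0
  have b1 := key 1 0 1
  have b2 := key 2 0 2
  have b3 := key 3 0 3
  have c12 := key 1 0 2
  have c13 := key 1 0 3
  have c23 := key 2 0 3
  have c21 := key 2 0 1
  have c31 := key 3 0 1
  have c32 := key 3 0 2
  simp at a1 a2 a3 b1 b2 b3 c12 c13 c23 c21 c31 c32
  fin_cases c <;> fin_cases i <;> simp_all

namespace AdaptedFrame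

variable (h : AdaptedFrame l f X)
include h

theorem smooth_tangentField (a : Fin 4) : ContDiff ℝ ∞ (tangentField f X a) :=
  (h.smooth.fderiv_right (m := ∞) (by simp)).clm_apply (h.smoothX a)

theorem smooth_normalField (i : Fin 3) : ContDiff ℝ ∞ (normalField f X i) :=
  contDiff_iff_contDiffAt.2 fun x => sff_smooth h.smooth.contDiffAt
    (fun i => (h.smoothX i).contDiffAt) (h.smoothX 0).contDiffAt (h.smoothX i.succ).contDiffAt
    (Eventually.of_forall fun x => (h.adapted x).1)

theorem smooth_connCoef (c a b : Fin 4) : ContDiff ℝ ∞ (connCoef f X c a b) :=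
  (h.smooth_tangentField a).inner ℝ ((h.smooth_tangentField b).frameDeriv (h.smoothX c))

theorem smooth_gramCoef (i j : Fin 3) : ContDiff ℝ ∞ (gramCoef f X i j) :=
  (h.smooth_normalField i).inner ℝ (h.smooth_normalField j)

theorem inner_tangentField (a b : Fin 4) (x : E 4) :
    inner ℝ (tangentField f X a x) (tangentField f X b x) = if a = b then 1 else 0 :=
  orthonormal_iff_ite.1 (h.adapted x).1 a b

omit h in
theorem _root_.Austere.inner_tangentField_normalField (a : Fin 4) (i : Fin 3) (x : E 4) :
    inner ℝ (tangentField f X a x) (normalField f X i x) = 0 := inner_sff (x := x) _ _ _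

theorem linearIndependent_normalField (x : E 4) :
    LinearIndependent ℝ fun i => normalField f X i x :=
  (h.adapted x).linearIndependent (h.rank x)

/-- The Gauss formula. -/
theorem frameDeriv_tangentField (c a : Fin 4) (x : E 4) :
    frameDeriv X c (tangentField f X a) x =
      ∑ b, connCoef f X c b a x • tangentField f X b x +
        ∑ k, coefC l k c a • normalField f X k x := by
  set z := frameDeriv X c (tangentField f X a) x with hz
  have hp := normal_projection_eq (h.adapted x).1 z
  have h1 : z = fderiv ℝ (fderiv ℝ f) x (X c x) (X a x) +
      fderiv ℝ f x (fderiv ℝ (X a) x (X c x)) := by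
    rw [hz]
    unfold frameDeriv tangentField
    rw [fderiv_clm_apply ((h.smooth.fderiv_right (m := ∞) (by simp)).differentiable (by simp) x)
      ((h.smoothX a).differentiable (by simp) x)]
    simp [add_comm]
  have hm := LinearMap.mem_range_self (fderiv ℝ f x).toLinearMap (fderiv ℝ (X a) x (X c x))
  rw [ContinuousLinearMap.coe_coe] at hm
  have h2 : (LinearMap.range (fderiv ℝ f x).toLinearMap)ᗮ.starProjection z =
      sff f x (X c x) (X a x) := by
    rw [h1, map_add, Submodule.starProjection_orthogonal_apply_eq_zero hm, add_zero]
    rfl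
  rw [h2, (h.adapted x).2] at hp
  have h3 := eq_add_of_sub_eq hp.symm
  rw [h3, add_comm]
  rfl

theorem connCoef_skew (c a b : Fin 4) (x : E 4) :
    connCoef f X c a b x = -connCoef f X c b a x := by
  have h1 := frameDeriv_inner (X := X) (c := c) (h.smooth_tangentField a)
    (h.smooth_tangentField b) x
  simp only [h.inner_tangentField, frameDeriv_const] at h1
  rw [real_inner_comm] at h1
  unfold connCoef
  linarith

theorem inner_tangentField_frameDeriv_normalField (c b : Fin 4) (i : Fin 3) (x : E 4) :
    inner ℝ (tangentField f X b x) (frameDeriv X c (normalField f X i) x) =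
      -∑ k, coefC l k c b * gramCoef f X k i x := by
  have h1 := frameDeriv_inner (X := X) (c := c) (h.smooth_tangentField b)
    (h.smooth_normalField i) x
  simp only [inner_tangentField_normalField, frameDeriv_const, h.frameDeriv_tangentField,
    inner_add_left, sum_inner, inner_smul_left, mul_zero, Finset.sum_const_zero, zero_add] at h1
  simp only [gramCoef]
  simp only [conj_trivial] at h1
  linarith

theorem bracket (c d : Fin 4) (x : E 4) :
    fderiv ℝ (X d) x (X c x) - fderiv ℝ (X c) x (X d x) =
      ∑ b, (connCoef f X c b d x - connCoef f X d b c x) • X b x := by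
  apply injective_fderiv_of_orthonormal (h.adapted x).1
  rw [← frameDeriv_comm h.smooth (h.smoothX c) (h.smoothX d)]
  have h1 := h.frameDeriv_tangentField
  have hs : ∀ k, coefC l k c d = coefC l k d c := fun k => coefC_symm l k c d
  change frameDeriv X c (tangentField f X d) x - frameDeriv X d (tangentField f X c) x = _
  rw [h1, h1, map_sum]
  simp only [hs, map_sub, map_smul, sub_smul, Finset.sum_sub_distrib]
  change _ = ∑ b, connCoef f X c b d x • tangentField f X b x -
    ∑ b, connCoef f X d b c x • tangentField f X b x
  abel

theorem comm {W : Type*} [NormedAddCommGroup W] [NormedSpace ℝ W] {g : E 4 → W}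
    (hg : ContDiff ℝ ∞ g) (c d : Fin 4) (x : E 4) :
    frameDeriv X c (frameDeriv X d g) x - frameDeriv X d (frameDeriv X c g) x =
      ∑ b, (connCoef f X c b d x - connCoef f X d b c x) • frameDeriv X b g x := by
  rw [frameDeriv_comm hg (h.smoothX c) (h.smoothX d), h.bracket, map_sum]
  simp only [map_smul]
  rfl

theorem frameDeriv_frameDeriv_tangentField (c d a : Fin 4) (x : E 4) :
    frameDeriv X c (frameDeriv X d (tangentField f X a)) x =
      ∑ b, (frameDeriv X c (connCoef f X d b a) x • tangentField f X b x +
        connCoef f X d b a x • frameDeriv X c (tangentField f X b) x) +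
        ∑ k, coefC l k d a • frameDeriv X c (normalField f X k) x := by
  have h1 : frameDeriv X d (tangentField f X a) = fun x =>
      ∑ b, connCoef f X d b a x • tangentField f X b x +
        ∑ k, coefC l k d a • normalField f X k x := funext fun x => h.frameDeriv_tangentField d a x
  have s1 : ∀ b, ContDiff ℝ ∞ fun x => connCoef f X d b a x • tangentField f X b x := fun b =>
    (h.smooth_connCoef d b a).smul (h.smooth_tangentField b)
  have s2 : ∀ k, ContDiff ℝ ∞ fun x => coefC l k d a • normalField f X k x := fun k =>
    (h.smooth_normalField k).const_smul _
  rw [h1, frameDeriv_fun_add (ContDiff.sum fun b _ => s1 b) (ContDiff.sum fun k _ => s2 k),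
    frameDeriv_sum _ s1, frameDeriv_sum _ s2]
  congr 1
  · exact Finset.sum_congr rfl fun b _ =>
      frameDeriv_smul (h.smooth_connCoef d b a) (h.smooth_tangentField b) x
  · exact Finset.sum_congr rfl fun k _ => frameDeriv_const_smul _ (h.smooth_normalField k) x

theorem comm_tangentField (c d a : Fin 4) (x : E 4) :
    (∑ b, (frameDeriv X c (connCoef f X d b a) x • tangentField f X b x +
        connCoef f X d b a x • frameDeriv X c (tangentField f X b) x) +
        ∑ k, coefC l k d a • frameDeriv X c (normalField f X k) x) -
      (∑ b, (frameDeriv X d (connCoef f X c b a) x • tangentField f X b x +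
        connCoef f X c b a x • frameDeriv X d (tangentField f X b) x) +
        ∑ k, coefC l k c a • frameDeriv X d (normalField f X k) x) =
      ∑ b, (connCoef f X c b d x - connCoef f X d b c x) •
        frameDeriv X b (tangentField f X a) x := by
  rw [← frameDeriv_frameDeriv_tangentField h, ← frameDeriv_frameDeriv_tangentField h,
    h.comm (h.smooth_tangentField a)]

/-- The span of the tangent and first normal spaces is parallel. -/
theorem exists_frameDeriv_normalField (x : E 4) : ∃ t : Fin 4 → Fin 3 → Fin 3 → ℝ, ∀ c i,
    frameDeriv X c (normalField f X i) x = ∑ j, t c j i • normalField f X j x -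
      ∑ b, (∑ k, coefC l k c b * gramCoef f X k i x) • tangentField f X b x := by
  set S := Submodule.span ℝ (Set.range fun j => normalField f X j x) ⊔
    Submodule.span ℝ (Set.range fun b => tangentField f X b x) with hS
  -- Pair the commutator identity for the tangent fields with a vector z orthogonal to tangent and
  -- first normal space. Only the z-components of the derivatives of νₖ survive, and their symmetry
  -- forces them to vanish by `eq_zero_of_symmetric`.
  have hperp : ∀ z ∈ Sᗮ, ∀ c i, inner ℝ (frameDeriv X c (normalField f X i) x) z = 0 := by
    intro z hz
    have hν : ∀ i, inner ℝ (normalField f X i x) z = 0 := fun i =>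
      hz _ (Submodule.mem_sup_left (Submodule.subset_span ⟨i, rfl⟩))
    have hu : ∀ b, inner ℝ (tangentField f X b x) z = 0 := fun i =>
      hz _ (Submodule.mem_sup_right (Submodule.subset_span ⟨i, rfl⟩))
    have hdu : ∀ c b, inner ℝ (frameDeriv X c (tangentField f X b) x) z = 0 := fun c b => by
      simp [h.frameDeriv_tangentField, inner_add_left, sum_inner, inner_smul_left, hν, hu]
    have key : ∀ c d a, ∑ k, coefC l k d a * inner ℝ (frameDeriv X c (normalField f X k) x) z =
        ∑ k, coefC l k c a * inner ℝ (frameDeriv X d (normalField f X k) x) z := by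
      intro c d a
      have := congrArg (fun y => inner ℝ y z) (h.comm_tangentField c d a x)
      simp only [inner_sub_left, inner_add_left, sum_inner, inner_smul_left, hu, hdu, mul_zero,
        Finset.sum_const_zero, add_zero, zero_add, conj_trivial] at this
      linarith
    generalize hZ : (fun c i => inner ℝ (frameDeriv X c (normalField f X i) x) z) = Z
    have hZ' : ∀ c i, inner ℝ (frameDeriv X c (normalField f X i) x) z = Z c i := fun c i => by
      rw [← hZ]
    simp only [hZ'] at key ⊢
    exact eq_zero_of_symmetric key
  have hmem : ∀ c i, ∃ (t : Fin 3 → ℝ) (s : Fin 4 → ℝ), frameDeriv X c (normalField f X i) x =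
      ∑ j, t j • normalField f X j x + ∑ b, s b • tangentField f X b x := by
    intro c i
    have h1 : frameDeriv X c (normalField f X i) x ∈ S := by
      rw [← Submodule.orthogonal_orthogonal S]
      intro z hz
      rw [real_inner_comm]
      exact hperp z hz c i
    obtain ⟨y, hy, y', hy', he⟩ := Submodule.mem_sup.1 h1
    obtain ⟨t, rfl⟩ := (Submodule.mem_span_range_iff_exists_fun ℝ).1 hy
    obtain ⟨s, rfl⟩ := (Submodule.mem_span_range_iff_exists_fun ℝ).1 hy'
    exact ⟨t, s, he.symm⟩
  choose t s hts using hmem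
  refine ⟨fun c j i => t c i j, fun c i => ?_⟩
  rw [hts, sub_eq_add_neg, ← Finset.sum_neg_distrib]
  congr 1
  refine Finset.sum_congr rfl fun b _ => ?_
  have h1 := h.inner_tangentField_frameDeriv_normalField c b i x
  rw [hts] at h1
  simp only [inner_add_right, inner_sum, inner_smul_right, inner_tangentField_normalField,
    h.inner_tangentField] at h1
  simp only [mul_zero, Finset.sum_const_zero, mul_ite, mul_one, Finset.sum_ite_eq,
    Finset.mem_univ, if_true, zero_add] at h1
  rw [h1, neg_smul]

theorem gauss (x : E 4) : GaussEq l (fun c a b => connCoef f X c a b x)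
    (fun c d b a => frameDeriv X c (connCoef f X d b a) x) (fun i j => gramCoef f X i j x) := by
  intro a b c d
  have h1 := congrArg (inner ℝ (tangentField f X b x)) (h.comm_tangentField c d a x)
  have h2 : ∀ c a, inner ℝ (tangentField f X b x) (frameDeriv X c (tangentField f X a) x) =
      connCoef f X c b a x := fun c a => rfl
  simp only [inner_sub_right, inner_add_right, inner_sum, inner_smul_right, h2,
    h.inner_tangentField, h.inner_tangentField_frameDeriv_normalField, mul_ite, mul_one, mul_zero,
    Finset.sum_add_distrib, Finset.sum_ite_eq, Finset.mem_univ, if_true] at h1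
  simp only [mul_neg, Finset.sum_neg_distrib, Finset.mul_sum, Finset.sum_sub_distrib,
    sub_mul] at h1 ⊢
  have h3 : ∀ c d, ∑ i, ∑ j, coefC l i d a * coefC l j c b * gramCoef f X i j x =
      ∑ i, ∑ j, coefC l i d a * (coefC l j c b * gramCoef f X j i x) := fun c d => by
    simp only [mul_assoc, gramCoef, real_inner_comm]
  rw [h3, h3]
  linarith

theorem frameDeriv_gramCoef {x : E 4} {t : Fin 4 → Fin 3 → Fin 3 → ℝ}
    (ht : ∀ c i, frameDeriv X c (normalField f X i) x = ∑ j, t c j i • normalField f X j x -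
      ∑ b, (∑ k, coefC l k c b * gramCoef f X k i x) • tangentField f X b x) (c : Fin 4)
    (i j : Fin 3) : frameDeriv X c (gramCoef f X i j) x =
      ∑ k, (t c k i * gramCoef f X k j x + t c k j * gramCoef f X i k x) := by
  have h1 : ∀ b i, inner ℝ (normalField f X i x) (tangentField f X b x) = 0 := fun b i => by
    rw [real_inner_comm, inner_tangentField_normalField]
  refine (frameDeriv_inner (h.smooth_normalField i) (h.smooth_normalField j) x).trans ?_
  rw [ht, ht]
  simp only [inner_sub_left, inner_sub_right, sum_inner, inner_sum, inner_smul_left,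
    inner_smul_right, h1, inner_tangentField_normalField, mul_zero, Finset.sum_const_zero,
    sub_zero, conj_trivial, Finset.sum_add_distrib, gramCoef]

theorem codazzi {x : E 4} {t : Fin 4 → Fin 3 → Fin 3 → ℝ}
    (ht : ∀ c i, frameDeriv X c (normalField f X i) x = ∑ j, t c j i • normalField f X j x -
      ∑ b, (∑ k, coefC l k c b * gramCoef f X k i x) • tangentField f X b x) :
    Codazzi l (fun c a b => connCoef f X c a b x) t := by
  refine ⟨fun c a b => h.connCoef_skew c a b x, fun a b c j => ?_⟩
  have hp : ∀ c d a, ∑ j, (∑ b, connCoef f X d b a x * coefC l j c b +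
      ∑ k, coefC l k d a * t c j k - ∑ b, connCoef f X c b a x * coefC l j d b -
      ∑ k, coefC l k c a * t d j k - ∑ b, (connCoef f X c b d x - connCoef f X d b c x) *
        coefC l j b a) • normalField f X j x = 0 := by
    intro c d a
    set P := (LinearMap.range (fderiv ℝ f x).toLinearMap)ᗮ.starProjection
    have hu : ∀ b, P (tangentField f X b x) = 0 := fun b =>
      Submodule.starProjection_orthogonal_apply_eq_zero ⟨X b x, rfl⟩
    have hν : ∀ k, P (normalField f X k x) = normalField f X k x := fun k =>
      Submodule.starProjection_eq_self_iff.2 (Submodule.starProjection_apply_mem _ _)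
    have h1 := congrArg P (h.comm_tangentField c d a x)
    simp only [h.frameDeriv_tangentField, ht, map_sub, map_add, map_sum, map_smul, hu, hν,
      smul_zero, Finset.sum_const_zero, zero_add, sub_zero] at h1
    rw [← sub_eq_zero] at h1
    refine Eq.trans ?_ h1
    simp only [Fin.sum_univ_three, Fin.sum_univ_four]
    module
  have h1 := Fintype.linearIndependent_iff.1 (h.linearIndependent_normalField x) _ (hp c a b) j
  simp only [sub_mul, Finset.sum_sub_distrib] at h1
  have h2 : ∀ a b, coefC l j a b = coefC l j b a := coefC_symm l j
  simp only [h2 _ b] at h1 ⊢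
  linarith

theorem frameSystem : FrameSystem l X (connCoef f X) (gramCoef f X) where
  smoothX := h.smoothX
  smoothW := h.smooth_connCoef
  smoothG := h.smooth_gramCoef
  pos i x := real_inner_self_pos.2 ((h.linearIndependent_normalField x).ne_zero i)
  symm i j := funext fun x => real_inner_comm _ _
  bracket := h.bracket
  codazzi x := by
    obtain ⟨t, ht⟩ := h.exists_frameDeriv_normalField x
    exact ⟨t, h.codazzi ht, h.frameDeriv_gramCoef ht⟩
  gauss := h.gauss

end AdaptedFrame

end

end Austere

/-! ### The parameters vanish -/

namespace Austere

section
variable {n : ℕ} {f : E 4 → E n} {X : Fin 4 → E 4 → E 4} {l : Fin 3 → ℝ}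

theorem coefC_swap (l : Fin 3 → ℝ) (k : Fin 3) (i j : Fin 4) :
    coefC l k (Equiv.swap 1 2 i) (Equiv.swap 1 2 j) =
      coefC ![l 1, l 0, l 2] (Equiv.swap 0 1 k) i j := by
  rw [coefC_eq, coefC_eq]
  have a0 : (Equiv.swap (1 : Fin 4) 2) 0 = 0 := by decide
  have a1 : (Equiv.swap (1 : Fin 4) 2) 3 = 3 := by decide
  have a2 : (Equiv.swap (0 : Fin 3) 1) 2 = 2 := by decide
  fin_cases k <;> fin_cases i <;> fin_cases j <;> simp [a0, a1, a2]

theorem IsAdaptedAt.swap {x : E 4} {e : Fin 4 → E 4} (h : IsAdaptedAt l f x e) :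
    IsAdaptedAt ![l 1, l 0, l 2] f x fun i => e (Equiv.swap 1 2 i) := by
  refine ⟨h.1.comp _ (Equiv.swap 1 2).injective, fun i j => ?_⟩
  rw [h.2]
  simp only [coefC_swap]
  refine Fintype.sum_equiv (Equiv.swap 0 1) _ _ fun k => ?_
  have : Equiv.swap (1 : Fin 4) 2 (Equiv.swap 0 1 k).succ = k.succ := by
    revert k; decide
  have h0 : Equiv.swap (1 : Fin 4) 2 0 = 0 := by decide
  simp only [this, h0]

/-- Exchanging e₁ and e₂ exchanges the first two parameters, so either of them may be the one equal
to 1 in the Kähler case. -/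
theorem AdaptedFrame.swap (h : AdaptedFrame l f X) :
    AdaptedFrame ![l 1, l 0, l 2] f fun i => X (Equiv.swap 1 2 i) :=
  ⟨h.smooth, fun _ => h.smoothX _, fun x => (h.adapted x).swap, h.rank⟩

/-- The parameters of an austere immersion of type C, with constant parameters and rank three,
vanish. -/
theorem AdaptedFrame.param_eq_zero (h : AdaptedFrame l f X) (hl : IsParamC l) : l = 0 := by
  obtain ⟨h01, h1, h2, hc⟩ := hl
  have hvec : l = ![l 0, l 1, l 2] := by ext i; fin_cases i <;> rfl
  by_cases z1 : l 1 = 0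
  · have e2 : l 2 = -l 0 := by rw [z1] at hc; linarith
    by_cases z0 : l 0 = 0
    · ext i; fin_cases i <;> simp [z0, z1, e2]
    · exfalso
      have hl' : l = ![l 0, 0, -l 0] := by rw [← e2, ← z1]; exact hvec
      have hpos : 0 < l 0 := lt_of_le_of_ne (z1 ▸ h01) (Ne.symm z0)
      by_cases h1' : l 0 = 1
      · rw [h1'] at hl'
        exact (hl' ▸ h.frameSystem).false_of_kahler le_rfl
      · have := h.frameSystem
        rw [hl'] at this
        exact this.false_of_skewPair z0 fun hsq => h1' (by nlinarith)
  · exfalso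
    have p1 : 0 < l 1 := lt_of_le_of_ne h1 (Ne.symm z1)
    have p0 : 0 < l 0 := lt_of_lt_of_le p1 h01
    have z2 : l 2 ≠ 0 := by
      intro z2
      rw [z2] at hc
      linarith
    by_cases n1 : 1 + l 1 * l 2 = 0
    -- Inserting 1 + λ₂λ₃ = 0 into the cubic relation leaves λ₂ + λ₃ = 0, so λ₂ = 1 and λ₃ = -1. The
    -- other exceptional case is analogous.
    · have e2 : l 2 = -l 1 := by
        have : l 0 * (1 + l 1 * l 2) + l 1 + l 2 = 0 := by linarith
        rw [n1] at this
        linarith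
      have e1 : l 1 = 1 := by rw [e2] at n1; nlinarith
      have := h.swap.frameSystem
      rw [e2, e1] at this
      exact this.false_of_kahler p0.le
    by_cases n2 : 1 + l 0 * l 2 = 0
    · have e2 : l 2 = -l 0 := by
        have : l 1 * (1 + l 0 * l 2) + l 0 + l 2 = 0 := by linarith
        rw [n2] at this
        linarith
      have e1 : l 0 = 1 := by rw [e2] at n2; nlinarith
      have := h.frameSystem
      rw [hvec, e2, e1] at this
      exact this.false_of_kahler h1
    · refine h.frameSystem.false_of_generic hc ?_ ?_
      · intro i; fin_cases i
        exacts [p0.ne', z1, z2]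
      · intro i; fin_cases i
        · exact (by positivity : 0 < 1 + l 0 * l 1).ne'
        · exact n1
        · rw [mul_comm] at n2; exact n2

end

end Austere

/-! ### Vanishing parameters: the leaves and their infinitesimal rotation -/

namespace Austere

section
variable {n : ℕ} {f : E 4 → E n} {X : Fin 4 → E 4 → E 4}

section FrameDerivOperator

variable {c : Fin 4} {A B : E 4 → E n →L[ℝ] E n}

theorem frameDeriv_clm_apply {g : E 4 → E n} (hA : ContDiff ℝ ∞ A) (hg : ContDiff ℝ ∞ g)
    (x : E 4) :
    frameDeriv X c (fun x => A x (g x)) x = frameDeriv X c A x (g x) + A x (frameDeriv X c g x) := by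
  simp only [frameDeriv]
  rw [fderiv_clm_apply (hA.differentiable (by simp) x) (hg.differentiable (by simp) x)]
  simp [add_comm]

theorem frameDeriv_clm_apply_const (hA : ContDiff ℝ ∞ A) (z : E n) (x : E 4) :
    frameDeriv X c (fun x => A x z) x = frameDeriv X c A x z := by
  simp only [frameDeriv]
  rw [fderiv_clm_apply (hA.differentiable (by simp) x) (differentiableAt_const z)]
  simp

theorem frameDeriv_clm_mul (hA : ContDiff ℝ ∞ A) (hB : ContDiff ℝ ∞ B) (x : E 4) :
    frameDeriv X c (fun x => A x * B x) x =
      frameDeriv X c A x * B x + A x * frameDeriv X c B x := by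
  ext1 z
  have hAB : ContDiff ℝ ∞ fun x => A x * B x := hA.clm_comp hB
  rw [← frameDeriv_clm_apply_const hAB]
  refine (frameDeriv_clm_apply hA (hB.clm_apply contDiff_const) x).trans ?_
  rw [frameDeriv_clm_apply_const hB]
  rfl

end FrameDerivOperator

variable (f X) in
/-- The orthogonal projection onto the span of the last three fields of an adapted frame. -/
def proj (x : E 4) : E n →L[ℝ] E n :=
  ∑ i : Fin 3, (innerSL ℝ (tangentField f X i.succ x)).smulRight (tangentField f X i.succ x)

theorem proj_apply (x : E 4) (z : E n) :
    proj f X x z =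
      ∑ i : Fin 3, inner ℝ (tangentField f X i.succ x) z • tangentField f X i.succ x := by
  simp [proj, sum_apply]

variable (f X) in
/-- The derivative of the projection along the first field. -/
def projDeriv : E 4 → E n →L[ℝ] E n := frameDeriv X 0 (proj f X)

variable (f X) in
/-- The infinitesimal rotation of the image of the projection along the first field. -/
def spin (x : E 4) : E n →L[ℝ] E n :=
  projDeriv f X x * proj f X x - proj f X x * projDeriv f X x

variable (f X) in
/-- The logarithmic derivatives of `spin`. -/
def spinCoef (i : Fin 3) (x : E 4) : ℝ := -connCoef f X 0 0 i.succ x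

namespace AdaptedFrame

section Projection

variable {l : Fin 3 → ℝ} (h : AdaptedFrame l f X)
include h

theorem smooth_proj : ContDiff ℝ ∞ (proj f X) := by
  rw [contDiff_clm_apply_iff]
  intro z
  simp only [proj_apply]
  exact ContDiff.sum fun i _ => ((h.smooth_tangentField _).inner ℝ contDiff_const).smul
    (h.smooth_tangentField _)

theorem smooth_projDeriv : ContDiff ℝ ∞ (projDeriv f X) := h.smooth_proj.frameDeriv (h.smoothX 0)

theorem smooth_spin : ContDiff ℝ ∞ (spin f X) :=
  (h.smooth_projDeriv.mul h.smooth_proj).sub (h.smooth_proj.mul h.smooth_projDeriv)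

theorem smooth_spinCoef (i : Fin 3) : ContDiff ℝ ∞ (spinCoef f X i) :=
  (h.smooth_connCoef 0 0 i.succ).neg

theorem proj_succ (x : E 4) (i : Fin 3) :
    proj f X x (tangentField f X i.succ x) = tangentField f X i.succ x := by
  simp [proj_apply, h.inner_tangentField]

theorem proj_zero (x : E 4) : proj f X x (tangentField f X 0 x) = 0 := by
  simp [proj_apply, h.inner_tangentField]

omit h in
theorem proj_normalField (x : E 4) (k : Fin 3) : proj f X x (normalField f X k x) = 0 := by
  simp [proj_apply, inner_tangentField_normalField]

theorem proj_mul_self (x : E 4) : proj f X x * proj f X x = proj f X x := by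
  ext1 z
  rw [mul_apply_eq_comp]
  conv_lhs => rw [proj_apply x z]
  simp only [map_sum, map_smul, h.proj_succ]
  rw [proj_apply]

omit h in
theorem inner_proj (x : E 4) (z z' : E n) :
    inner ℝ (proj f X x z) z' = inner ℝ z (proj f X x z') := by
  simp only [proj_apply, sum_inner, inner_sum, inner_smul_left, inner_smul_right, conj_trivial]
  refine Finset.sum_congr rfl fun i _ => ?_
  rw [real_inner_comm z]
  ring

theorem inner_projDeriv (x : E 4) (z z' : E n) :
    inner ℝ (projDeriv f X x z) z' = inner ℝ z (projDeriv f X x z') := by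
  have s : ∀ z, ContDiff ℝ ∞ fun x => proj f X x z := fun z => h.smooth_proj.clm_apply contDiff_const
  have h1 := frameDeriv_inner (X := X) (c := 0) (s z) (contDiff_const (c := z')) x
  have h2 := frameDeriv_inner (X := X) (c := 0) (contDiff_const (c := z)) (s z') x
  simp only [inner_proj] at h1
  rw [h1] at h2
  have h3 : ∀ z : E n, frameDeriv X 0 (fun _ => z) x = 0 := fun z => by simp [frameDeriv]
  simp only [h3, map_zero, inner_zero_left, inner_zero_right, add_zero, zero_add,
    frameDeriv_clm_apply_const h.smooth_proj] at h2
  exact h2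

theorem projDeriv_eq (x : E 4) :
    projDeriv f X x * proj f X x + proj f X x * projDeriv f X x = projDeriv f X x := by
  rw [projDeriv, ← frameDeriv_clm_mul h.smooth_proj h.smooth_proj]
  simp only [h.proj_mul_self]

theorem proj_projDeriv_proj (x : E 4) : proj f X x * projDeriv f X x * proj f X x = 0 := by
  have h1 := congrArg (fun T => proj f X x * T) (h.projDeriv_eq x)
  simp only [mul_add, ← mul_assoc, h.proj_mul_self] at h1
  simpa using h1

theorem inner_spin (x : E 4) (z z' : E n) :
    inner ℝ (spin f X x z) z' = -inner ℝ z (spin f X x z') := by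
  simp only [spin, sub_apply, mul_apply_eq_comp, inner_sub_left,
    inner_sub_right, inner_proj, h.inner_projDeriv]
  ring

theorem spin_mul_proj (x : E 4) : spin f X x * proj f X x = projDeriv f X x * proj f X x := by
  rw [spin, sub_mul, mul_assoc, h.proj_mul_self, h.proj_projDeriv_proj, sub_zero]

theorem proj_mul_spin (x : E 4) : proj f X x * spin f X x = -(proj f X x * projDeriv f X x) := by
  rw [spin, mul_sub, ← mul_assoc, ← mul_assoc, h.proj_mul_self, h.proj_projDeriv_proj, zero_sub]

/-- Differentiating P² = P shows that D₀P exchanges the image and the kernel of P. Hence A = [D₀P,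
P] is skew and off-diagonal, and it generates the motion: D₀P = [A, P]. -/
theorem projDeriv_eq_spin (x : E 4) :
    projDeriv f X x = spin f X x * proj f X x - proj f X x * spin f X x := by
  rw [h.spin_mul_proj, h.proj_mul_spin, sub_neg_eq_add, h.projDeriv_eq]

theorem spin_eq (x : E 4) :
    spin f X x = spin f X x * proj f X x + proj f X x * spin f X x := by
  rw [h.spin_mul_proj, h.proj_mul_spin, spin]
  abel

theorem proj_spin_proj (x : E 4) : proj f X x * spin f X x * proj f X x = 0 := by
  rw [h.proj_mul_spin]
  ext1 z
  have := congrArg (fun T => T z) (h.proj_projDeriv_proj x)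
  simp only [mul_apply_eq_comp, zero_apply, neg_apply] at this ⊢
  rw [this, neg_zero]

theorem spin_zero (x : E 4) :
    spin f X x (tangentField f X 0 x) = proj f X x (frameDeriv X 0 (tangentField f X 0) x) := by
  have h1 := frameDeriv_clm_apply (X := X) (c := 0) h.smooth_proj (h.smooth_tangentField 0) x
  simp only [h.proj_zero] at h1
  have h2 : frameDeriv X 0 (fun _ => (0 : E n)) x = 0 := by simp [frameDeriv]
  rw [h2] at h1
  have h3 : projDeriv f X x (tangentField f X 0 x) =
      -proj f X x (frameDeriv X 0 (tangentField f X 0) x) := eq_neg_of_add_eq_zero_left h1.symm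
  have h4 := congrArg (fun T => T (frameDeriv X 0 (tangentField f X 0) x)) (h.proj_mul_self x)
  simp only [mul_apply_eq_comp] at h4
  simp only [spin, sub_apply, mul_apply_eq_comp, h.proj_zero,
    map_zero, h3, map_neg, h4, zero_sub, neg_neg]

theorem spin_succ_eq (x : E 4) (i : Fin 3) :
    spin f X x (tangentField f X i.succ x) =
      frameDeriv X 0 (tangentField f X i.succ) x -
        proj f X x (frameDeriv X 0 (tangentField f X i.succ) x) := by
  have h1 := frameDeriv_clm_apply (X := X) (c := 0) h.smooth_proj (h.smooth_tangentField i.succ) x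
  simp only [h.proj_succ] at h1
  have h3 : projDeriv f X x (tangentField f X i.succ x) =
      frameDeriv X 0 (tangentField f X i.succ) x -
        proj f X x (frameDeriv X 0 (tangentField f X i.succ) x) := eq_sub_of_add_eq h1.symm
  have h4 := congrArg (fun T => T (frameDeriv X 0 (tangentField f X i.succ) x)) (h.proj_mul_self x)
  simp only [mul_apply_eq_comp] at h4
  simp only [spin, sub_apply, mul_apply_eq_comp, h.proj_succ,
    h3, map_sub, h4, sub_self, sub_zero]

end Projection

section Zero

variable (h : AdaptedFrame 0 f X)
include h

theorem connCoef_eq_zero {i j : Fin 4} (hi : i ≠ 0) (hj : j ≠ 0) (x : E 4) :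
    connCoef f X i 0 j x = 0 := by
  obtain ⟨t, ht⟩ := h.exists_frameDeriv_normalField x
  exact (h.codazzi ht).of_zero hi hj

theorem connCoef_self (c a : Fin 4) (x : E 4) : connCoef f X c a a x = 0 := by
  have := h.connCoef_skew c a a x
  linarith

theorem frameDeriv_succ_succ (i j : Fin 3) (x : E 4) :
    frameDeriv X i.succ (tangentField f X j.succ) x =
      ∑ k : Fin 3, connCoef f X i.succ k.succ j.succ x • tangentField f X k.succ x := by
  rw [h.frameDeriv_tangentField, Fin.sum_univ_succ,
    h.connCoef_eq_zero (Fin.succ_ne_zero i) (Fin.succ_ne_zero j)]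
  have : ∀ k, coefC 0 k i.succ j.succ = 0 := fun k => by
    rw [coefC_eq]; fin_cases k <;> fin_cases i <;> fin_cases j <;> simp
  simp [this]

theorem frameDeriv_succ_zero (i : Fin 3) (x : E 4) :
    frameDeriv X i.succ (tangentField f X 0) x = normalField f X i x := by
  have h1 : ∀ b, connCoef f X i.succ b 0 x = 0 := fun b => by
    rw [h.connCoef_skew]
    by_cases hb : b = 0
    · rw [hb, h.connCoef_self, neg_zero]
    · rw [h.connCoef_eq_zero (Fin.succ_ne_zero i) hb, neg_zero]
  rw [h.frameDeriv_tangentField]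
  simp [h1, coefC_symm _ _ i.succ 0, coefC_zero_succ]

theorem frameDeriv_zero_zero (x : E 4) :
    frameDeriv X 0 (tangentField f X 0) x =
      ∑ k : Fin 3, connCoef f X 0 k.succ 0 x • tangentField f X k.succ x := by
  rw [h.frameDeriv_tangentField, Fin.sum_univ_succ, h.connCoef_self]
  have : ∀ k, coefC 0 k 0 0 = 0 := fun k => by
    rw [coefC_eq]; fin_cases k <;> simp
  simp [this]

theorem frameDeriv_zero_succ (i : Fin 3) (x : E 4) :
    frameDeriv X 0 (tangentField f X i.succ) x =
      ∑ k : Fin 3, connCoef f X 0 k.succ i.succ x • tangentField f X k.succ x +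
        (normalField f X i x - spinCoef f X i x • tangentField f X 0 x) := by
  rw [h.frameDeriv_tangentField, Fin.sum_univ_succ]
  simp only [coefC_zero_succ, spinCoef]
  simp only [ite_smul, one_smul, zero_smul, Finset.sum_ite_eq', Finset.mem_univ, if_true, neg_smul]
  abel

theorem spin_succ (x : E 4) (i : Fin 3) :
    spin f X x (tangentField f X i.succ x) =
      normalField f X i x - spinCoef f X i x • tangentField f X 0 x := by
  rw [h.spin_succ_eq, h.frameDeriv_zero_succ]
  simp [map_sum, map_smul, h.proj_succ, proj_normalField, h.proj_zero]

/-- Along a leaf e₁, e₂, e₃ only rotate among themselves, with skew coefficients, so their span is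
constant. -/
theorem frameDeriv_proj (i : Fin 3) (x : E 4) : frameDeriv X i.succ (proj f X) x = 0 := by
  ext1 z
  rw [← frameDeriv_clm_apply_const h.smooth_proj]
  simp only [proj_apply]
  have s : ∀ j : Fin 3, ContDiff ℝ ∞ fun x => inner ℝ (tangentField f X j.succ x) z := fun j =>
    (h.smooth_tangentField _).inner ℝ contDiff_const
  have s' : ∀ j : Fin 3, ContDiff ℝ ∞ fun x =>
      inner ℝ (tangentField f X j.succ x) z • tangentField f X j.succ x := fun j =>
    (s j).smul (h.smooth_tangentField _)
  rw [frameDeriv_sum _ s']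
  have h1 : ∀ j : Fin 3, frameDeriv X i.succ (fun x => inner ℝ (tangentField f X j.succ x) z) x =
      ∑ k : Fin 3, connCoef f X i.succ k.succ j.succ x *
        inner ℝ (tangentField f X k.succ x) z := fun j => by
    rw [frameDeriv_inner (h.smooth_tangentField _) contDiff_const, h.frameDeriv_succ_succ]
    have : frameDeriv X i.succ (fun _ => z) x = 0 := by simp [frameDeriv]
    simp [this, sum_inner, inner_smul_left]
  simp only [frameDeriv_smul (s _) (h.smooth_tangentField _), h1, h.frameDeriv_succ_succ]
  have hs := fun a b : Fin 3 => h.connCoef_skew i.succ a.succ b.succ x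
  simp only [Finset.sum_add_distrib, Finset.sum_smul, Finset.smul_sum]
  rw [Finset.sum_comm, ← Finset.sum_add_distrib]
  refine (Finset.sum_congr rfl fun a _ => ?_).trans (Finset.sum_const_zero)
  rw [← Finset.sum_add_distrib]
  refine (Finset.sum_congr rfl fun b _ => ?_).trans (Finset.sum_const_zero)
  rw [hs, smul_smul]
  module

/-- Commutation of the derivatives along the first field and another one. -/
theorem comm_zero {W : Type*} [NormedAddCommGroup W] [NormedSpace ℝ W] {g : E 4 → W}
    (hg : ContDiff ℝ ∞ g) (i : Fin 3) (x : E 4) :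
    frameDeriv X i.succ (frameDeriv X 0 g) x = frameDeriv X 0 (frameDeriv X i.succ g) x +
      (spinCoef f X i x • frameDeriv X 0 g x -
        ∑ j : Fin 3, connCoef f X 0 j.succ i.succ x • frameDeriv X j.succ g x) := by
  rw [← sub_eq_iff_eq_add', h.comm hg, Fin.sum_univ_succ, h.connCoef_self]
  have h1 : ∀ j : Fin 3, connCoef f X i.succ j.succ 0 x = 0 := fun j => by
    rw [h.connCoef_skew, h.connCoef_eq_zero (Fin.succ_ne_zero i) (Fin.succ_ne_zero j), neg_zero]
  simp only [h1, spinCoef, zero_sub, neg_smul, Finset.sum_neg_distrib]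
  abel

theorem frameDeriv_projDeriv (i : Fin 3) (x : E 4) :
    frameDeriv X i.succ (projDeriv f X) x = spinCoef f X i x • projDeriv f X x := by
  rw [projDeriv, h.comm_zero h.smooth_proj]
  have : frameDeriv X i.succ (proj f X) = fun _ => 0 := funext fun x => h.frameDeriv_proj i x
  rw [this]
  simp only [h.frameDeriv_proj]
  simp [frameDeriv]

/-- P is constant along the leaves, so only the e₀-component of the bracket [eᵢ, e₀] contributes; it
is the factor `spinCoef`. -/
theorem frameDeriv_spin (i : Fin 3) (x : E 4) :
    frameDeriv X i.succ (spin f X) x = spinCoef f X i x • spin f X x := by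
  have s1 := h.smooth_projDeriv.mul h.smooth_proj
  have s2 := h.smooth_proj.mul h.smooth_projDeriv
  refine (frameDeriv_fun_sub s1 s2 x).trans ?_
  rw [frameDeriv_clm_mul h.smooth_projDeriv h.smooth_proj,
    frameDeriv_clm_mul h.smooth_proj h.smooth_projDeriv, h.frameDeriv_projDeriv, h.frameDeriv_proj,
    spin]
  ext1 z
  simp [smul_sub]

end Zero

end AdaptedFrame

end

end Austere

/-! ### Vanishing parameters: constancy along the first field -/

namespace Austere

section
variable {n : ℕ} {f : E 4 → E n} {X : Fin 4 → E 4 → E 4}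

theorem commute_of_off_diagonal {R : Type*} [Ring R] {A P : R} (h1 : A = A * P + P * A)
    (h2 : P * A * P = 0) : A * A * P = P * A * A := by
  have h3 : A * A * P = P * A * A * P := by
    calc A * A * P = (A * P + P * A) * A * P := by rw [← h1]
      _ = A * (P * A * P) + P * A * A * P := by noncomm_ring
      _ = P * A * A * P := by rw [h2]; simp
  have h4 : P * A * A = P * A * A * P := by
    calc P * A * A = P * A * (A * P + P * A) := by rw [← h1]
      _ = P * A * A * P + (P * A * P) * A := by noncomm_ring
      _ = P * A * A * P := by rw [h2]; simp
  rw [h3, ← h4]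

theorem frameDeriv_position (f : E 4 → E n) (X : Fin 4 → E 4 → E 4) (a : Fin 4) : frameDeriv X a f = tangentField f X a := rfl

variable (f X) in
/-- The translational part of the infinitesimal motion of the leaves. -/
def drift (x : E 4) : E n := tangentField f X 0 x - spin f X x (f x)

/-- The covariant derivatives of the logarithmic derivatives of `spin`. -/
def spinCoefDeriv (f : E 4 → E n) (X : Fin 4 → E 4 → E 4) (i : Fin 3) (x : E 4) : ℝ :=
  frameDeriv X 0 (spinCoef f X i) x -
    ∑ j : Fin 3, connCoef f X 0 j.succ i.succ x * spinCoef f X j x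

namespace AdaptedFrame

variable (h : AdaptedFrame 0 f X)
include h

theorem smooth_drift : ContDiff ℝ ∞ (drift f X) :=
  (h.smooth_tangentField 0).sub (h.smooth_spin.clm_apply h.smooth)

theorem frameDeriv_drift (i : Fin 3) (x : E 4) :
    frameDeriv X i.succ (drift f X) x = spinCoef f X i x • drift f X x := by
  refine (frameDeriv_fun_sub (h.smooth_tangentField 0) (h.smooth_spin.clm_apply h.smooth) x).trans ?_
  rw [frameDeriv_clm_apply h.smooth_spin h.smooth, h.frameDeriv_succ_zero, h.frameDeriv_spin,
    frameDeriv_position f, h.spin_succ, drift, smul_apply, smul_sub]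
  abel

/-- The terms D₀e₀ and A e₀ cancel, since D₀e₀ is tangent to the leaf and A e₀ is its leaf
component. -/
theorem frameDeriv_zero_drift (x : E 4) :
    frameDeriv X 0 (drift f X) x + frameDeriv X 0 (spin f X) x (f x) = 0 := by
  have h1 := frameDeriv_fun_sub (X := X) (c := 0) (h.smooth_tangentField 0)
    (h.smooth_spin.clm_apply h.smooth) x
  rw [frameDeriv_clm_apply h.smooth_spin h.smooth, frameDeriv_position f, h.spin_zero,
    h.frameDeriv_zero_zero] at h1
  simp only [map_sum, map_smul, h.proj_succ] at h1
  refine (congrArg (· + _) h1).trans ?_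
  abel

/-- The second derivatives of a field whose derivatives along the leaves are proportional to it. -/
theorem frameDeriv_frameDeriv_of_proportional {W : Type*} [NormedAddCommGroup W] [NormedSpace ℝ W]
    {g : E 4 → W} (hg : ContDiff ℝ ∞ g)
    (hp : ∀ (i : Fin 3) x, frameDeriv X i.succ g x = spinCoef f X i x • g x) (i : Fin 3) (x : E 4) :
    frameDeriv X i.succ (frameDeriv X 0 g) x =
      spinCoefDeriv f X i x • g x + (2 * spinCoef f X i x) • frameDeriv X 0 g x := by
  rw [h.comm_zero hg]
  have : frameDeriv X i.succ g = fun x => spinCoef f X i x • g x := funext fun x => hp i x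
  rw [this, frameDeriv_smul (h.smooth_spinCoef i) hg]
  simp only [hp, spinCoefDeriv, smul_smul, sub_smul, Finset.sum_smul, two_mul, add_smul]
  abel

/-- `frameDeriv_zero_drift` is differentiated along the leaf. Drift and spin obey the same law
there, and their sum drift + A f is e₀. -/
theorem frameDeriv_zero_spin_succ (i : Fin 3) (x : E 4) :
    frameDeriv X 0 (spin f X) x (tangentField f X i.succ x) =
      -(spinCoefDeriv f X i x • tangentField f X 0 x) := by
  have s1 := h.smooth_drift.frameDeriv (h.smoothX 0)
  have s2 := h.smooth_spin.frameDeriv (h.smoothX 0)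
  have h1 := frameDeriv_fun_add (X := X) (c := i.succ) s1 (s2.clm_apply h.smooth) x
  have h2 : (fun x => frameDeriv X 0 (drift f X) x + frameDeriv X 0 (spin f X) x (f x)) =
    fun _ => 0 := funext h.frameDeriv_zero_drift
  have h3 : frameDeriv X i.succ (fun _ => (0 : E n)) x = 0 := by simp [frameDeriv]
  rw [h2, h3, frameDeriv_clm_apply s2 h.smooth,
    h.frameDeriv_frameDeriv_of_proportional h.smooth_drift h.frameDeriv_drift,
    h.frameDeriv_frameDeriv_of_proportional h.smooth_spin h.frameDeriv_spin,
    frameDeriv_position f] at h1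
  have h4 := h.frameDeriv_zero_drift x
  have h5 : tangentField f X 0 x = drift f X x + spin f X x (f x) := (sub_add_cancel _ _).symm
  rw [h5, eq_neg_iff_add_eq_zero, h1]
  simp only [add_apply, smul_apply]
  rw [eq_neg_of_add_eq_zero_left h4]
  module

/-- Differentiate `frameDeriv_zero_spin_succ` once more along eᵢ and take the νᵢ-component. With κ
the quantity in question, the two sides give -κ|νᵢ|² and κ|νᵢ|². -/
theorem spinCoefDeriv_eq_zero (i : Fin 3) (x : E 4) : spinCoefDeriv f X i x = 0 := by
  have s2 := h.smooth_spin.frameDeriv (h.smoothX 0)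
  have hk : ContDiff ℝ ∞ (spinCoefDeriv f X i) :=
    ((h.smooth_spinCoef i).frameDeriv (h.smoothX 0)).sub
      (ContDiff.sum fun j _ => (h.smooth_connCoef _ _ _).mul (h.smooth_spinCoef j))
  have h1 := frameDeriv_clm_apply (X := X) (c := i.succ) s2 (h.smooth_tangentField i.succ) x
  have h2 := frameDeriv_smul (X := X) (c := i.succ) hk (h.smooth_tangentField 0) x
  have h3 : (fun x => frameDeriv X 0 (spin f X) x (tangentField f X i.succ x)) =
      fun x => -(1 : ℝ) • (spinCoefDeriv f X i x • tangentField f X 0 x) :=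
    funext fun x => by rw [h.frameDeriv_zero_spin_succ, neg_one_smul]
  have s3 : ContDiff ℝ ∞ fun x => spinCoefDeriv f X i x • tangentField f X 0 x :=
    hk.smul (h.smooth_tangentField 0)
  rw [h3, frameDeriv_const_smul _ s3, h2,
    h.frameDeriv_frameDeriv_of_proportional h.smooth_spin h.frameDeriv_spin,
    h.frameDeriv_succ_succ, h.frameDeriv_succ_zero] at h1
  simp only [add_apply, smul_apply, map_sum, map_smul, h.frameDeriv_zero_spin_succ,
    h.spin_succ] at h1
  have h4 := congrArg (inner ℝ (normalField f X i x)) h1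
  have h5 : ∀ a, inner ℝ (normalField f X i x) (tangentField f X a x) = 0 := fun a => by
    rw [real_inner_comm, inner_tangentField_normalField]
  simp only [inner_smul_right, inner_add_right, inner_sub_right, inner_neg_right, inner_sum, h5,
    mul_zero, neg_zero, Finset.sum_const_zero, sub_zero, zero_add, add_zero] at h4
  have h6 : 0 < inner ℝ (normalField f X i x) (normalField f X i x) :=
    real_inner_self_pos.2 ((h.linearIndependent_normalField x).ne_zero i)
  nlinarith

theorem inner_frameDeriv_spin (c : Fin 4) (x : E 4) (z z' : E n) :
    inner ℝ (frameDeriv X c (spin f X) x z) z' = -inner ℝ z (frameDeriv X c (spin f X) x z') := by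
  have s : ∀ z, ContDiff ℝ ∞ fun x => spin f X x z := fun z => h.smooth_spin.clm_apply contDiff_const
  have h1 := frameDeriv_inner (X := X) (c := c) (s z) (contDiff_const (c := z')) x
  have h2 := frameDeriv_inner (X := X) (c := c) (contDiff_const (c := z)) (s z') x
  have h3 : ∀ z : E n, frameDeriv X c (fun _ => z) x = 0 := fun z => by simp [frameDeriv]
  have h4 : frameDeriv X c (fun x => inner ℝ (spin f X x z) z') x =
      -frameDeriv X c (fun x => inner ℝ z (spin f X x z')) x := by
    simp only [h.inner_spin]
    rw [frameDeriv_neg]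
  rw [h1, h2] at h4
  simp only [h3, inner_zero_left, inner_zero_right, add_zero, zero_add,
    frameDeriv_clm_apply_const h.smooth_spin] at h4
  exact h4

/-- Now T = D₀A kills the leaf directions, and by skewness its image avoids them. Differentiating A
= A P + P A leaves T = A(D₀P) + (D₀P)A, which is [A², P] = 0 because A² is block diagonal. -/
theorem frameDeriv_zero_spin (x : E 4) : frameDeriv X 0 (spin f X) x = 0 := by
  set T := frameDeriv X 0 (spin f X) x with hT
  have hTP : T * proj f X x = 0 := by
    ext1 z
    simp only [mul_apply_eq_comp, proj_apply, map_sum, map_smul, hT, h.frameDeriv_zero_spin_succ,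
      h.spinCoefDeriv_eq_zero]
    simp
  have hPT : proj f X x * T = 0 := by
    ext1 z
    refine ext_inner_right ℝ fun z' => ?_
    have := congrArg (fun S => S z') hTP
    simp only [mul_apply_eq_comp, zero_apply] at this ⊢
    rw [inner_proj, hT, h.inner_frameDeriv_spin, ← hT, this]
    simp
  have s1 := h.smooth_spin.clm_comp h.smooth_proj
  have s2 := h.smooth_proj.clm_comp h.smooth_spin
  have h1 := frameDeriv_fun_add (X := X) (c := 0) s1 s2 x
  have h2 : (fun x => spin f X x * proj f X x + proj f X x * spin f X x) = spin f X :=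
    funext fun x => (h.spin_eq x).symm
  change frameDeriv X 0 (fun x => spin f X x * proj f X x + proj f X x * spin f X x) x =
    frameDeriv X 0 (fun x => spin f X x * proj f X x) x +
      frameDeriv X 0 (fun x => proj f X x * spin f X x) x at h1
  rw [h2, frameDeriv_clm_mul h.smooth_spin h.smooth_proj,
    frameDeriv_clm_mul h.smooth_proj h.smooth_spin, ← hT, hTP, hPT] at h1
  change T = 0 + spin f X x * projDeriv f X x + (projDeriv f X x * spin f X x + 0) at h1
  rw [h1, zero_add, add_zero, h.projDeriv_eq_spin]
  have e1 := h.spin_eq x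
  have e2 := h.proj_spin_proj x
  set A := spin f X x
  set P := proj f X x
  have e3 := commute_of_off_diagonal e1 e2
  rw [mul_sub, sub_mul]
  simp only [← mul_assoc]
  rw [e3]
  abel

theorem frameDeriv_zero_drift_eq (x : E 4) : frameDeriv X 0 (drift f X) x = 0 := by
  have := h.frameDeriv_zero_drift x
  rwa [h.frameDeriv_zero_spin, zero_apply, add_zero] at this

end AdaptedFrame

end

end Austere

/-! ### Vanishing parameters: the screw motion -/

namespace Austere

section
variable {n : ℕ} {f : E 4 → E n} {X : Fin 4 → E 4 → E 4}

namespace AdaptedFrame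

theorem eq_of_frameDeriv_eq_zero {l : Fin 3 → ℝ} (h : AdaptedFrame l f X) {W : Type*}
    [NormedAddCommGroup W] [NormedSpace ℝ W] {g : E 4 → W} (hg : ContDiff ℝ ∞ g)
    (h0 : ∀ c x, frameDeriv X c g x = 0) (x y : E 4) : g x = g y := by
  refine is_const_of_fderiv_eq_zero (𝕜 := ℝ) (hg.differentiable (by simp)) (fun x => ?_) x y
  ext1 v
  obtain ⟨c, rfl⟩ := (Submodule.mem_span_range_iff_exists_fun ℝ).1
    ((span_eq_top_of_orthonormal (h.adapted x).1).ge (Submodule.mem_top (x := v)))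
  simp only [map_sum, map_smul]
  refine Finset.sum_congr rfl fun a _ => ?_
  rw [show fderiv ℝ g x (X a x) = 0 from h0 a x, zero_apply]

variable (h : AdaptedFrame 0 f X)
include h

/-- The image of the infinitesimal rotation meets the first field only trivially. -/
theorem eq_zero_of_spin_eq_smul {x : E 4} {z : E n} {s : ℝ}
    (hz : spin f X x z = s • tangentField f X 0 x) :
    s = 0 ∧ ∀ i : Fin 3, inner ℝ (tangentField f X i.succ x) z = 0 := by
  have h1 := congrArg (fun T => T z) (h.spin_eq x)
  simp only [add_apply, mul_apply_eq_comp] at h1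
  have h2 : ∀ i : Fin 3, inner ℝ (tangentField f X i.succ x) z = 0 := by
    set N := (LinearMap.range (fderiv ℝ f x).toLinearMap)ᗮ.starProjection
    have hu : ∀ b, N (tangentField f X b x) = 0 := fun b =>
      Submodule.starProjection_orthogonal_apply_eq_zero ⟨X b x, rfl⟩
    have hν : ∀ k, N (normalField f X k x) = normalField f X k x := fun k =>
      Submodule.starProjection_eq_self_iff.2 (Submodule.starProjection_apply_mem _ _)
    have h3 := congrArg N h1
    rw [map_add, proj_apply x (spin f X x z), proj_apply x z, hz, map_smul, hu, smul_zero] at h3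
    simp only [map_sum, map_smul, hu, smul_zero, Finset.sum_const_zero, add_zero, h.spin_succ,
      map_sub, hν, sub_zero] at h3
    exact Fintype.linearIndependent_iff.1 (h.linearIndependent_normalField x) _ h3.symm
  refine ⟨?_, h2⟩
  have h4 : proj f X x z = 0 := by simp [proj_apply, h2]
  rw [h4, map_zero, zero_add, hz, map_smul, h.proj_zero, smul_zero] at h1
  have h5 := congrArg (inner ℝ (tangentField f X 0 x)) h1
  rw [inner_smul_right, h.inner_tangentField, inner_zero_right] at h5
  simpa using h5

/-- The infinitesimal motion of the leaves is constant up to scale. -/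
theorem exists_const_motion : ∃ (ρ : E 4 → ℝ) (B : E n →L[ℝ] E n) (b : E n), ContDiff ℝ ∞ ρ ∧
    (∀ x, 0 < ρ x) ∧ (∀ x, spin f X x = ρ x • B) ∧ ∀ x, drift f X x = ρ x • b := by
  have s : ∀ k : Fin n, ContDiff ℝ ∞ fun x => spin f X x (EuclideanSpace.basisFun (Fin n) ℝ k) :=
    fun k => h.smooth_spin.clm_apply contDiff_const
  -- The squared Hilbert–Schmidt norm of A. Its square root is the scale ρ, which has the same
  -- logarithmic derivatives as A and the drift.
  set σ : E 4 → ℝ := fun x => ∑ k, inner ℝ (spin f X x (EuclideanSpace.basisFun (Fin n) ℝ k))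
    (spin f X x (EuclideanSpace.basisFun (Fin n) ℝ k)) with hσ
  have hs : ContDiff ℝ ∞ σ := ContDiff.sum fun k _ => (s k).inner ℝ (s k)
  have hpos : ∀ x, 0 < σ x := by
    intro x
    refine lt_of_le_of_ne (Finset.sum_nonneg fun k _ => real_inner_self_nonneg) fun h0 => ?_
    have h1 := (Finset.sum_eq_zero_iff_of_nonneg fun k _ => real_inner_self_nonneg).1 h0.symm
    have h2 : spin f X x = 0 := by
      ext1 z
      rw [← (EuclideanSpace.basisFun (Fin n) ℝ).sum_repr z, map_sum]
      simp only [map_smul]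
      refine (Finset.sum_eq_zero fun k hk => ?_).trans (zero_apply _).symm
      rw [inner_self_eq_zero.1 (h1 k hk), smul_zero]
    have h3 := (h.eq_zero_of_spin_eq_smul (x := x) (z := tangentField f X (Fin.succ 0) x) (s := 0)
      (by rw [h2]; simp)).2 0
    rw [h.inner_tangentField] at h3
    simp at h3
  set κ : Fin 4 → E 4 → ℝ := Fin.cons (fun _ => 0) (spinCoef f X) with hκ
  have hA : ∀ c x, frameDeriv X c (spin f X) x = κ c x • spin f X x := by
    intro c x
    refine Fin.cases ?_ (fun i => ?_) c
    · rw [h.frameDeriv_zero_spin]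
      exact (zero_smul ℝ (spin f X x)).symm
    · exact h.frameDeriv_spin i x
  have hb : ∀ c x, frameDeriv X c (drift f X) x = κ c x • drift f X x := by
    intro c x
    refine Fin.cases ?_ (fun i => ?_) c
    · rw [h.frameDeriv_zero_drift_eq]
      exact (zero_smul ℝ _).symm
    · exact h.frameDeriv_drift i x
  have hσd : ∀ c x, frameDeriv X c σ x = 2 * κ c x * σ x := by
    intro c x
    rw [hσ, frameDeriv_sum _ fun k => (s k).inner ℝ (s k)]
    simp only [frameDeriv_inner (s _) (s _), frameDeriv_clm_apply_const h.smooth_spin, hA,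
      smul_apply, inner_smul_left, inner_smul_right, Finset.mul_sum, conj_trivial]
    exact Finset.sum_congr rfl fun k _ => by ring
  set ρ : E 4 → ℝ := fun x => √(σ x) with hρ
  have hρs : ContDiff ℝ ∞ ρ := hs.sqrt fun x => (hpos x).ne'
  have hρpos : ∀ x, 0 < ρ x := fun x => Real.sqrt_pos.2 (hpos x)
  have hρd : ∀ c x, frameDeriv X c ρ x = κ c x * ρ x := by
    intro c x
    have h1 : (fun x => ρ x ^ 2) = σ := funext fun x => Real.sq_sqrt (hpos x).le
    have h2 := congrFun (frameDeriv_sq (X := X) (c := c) hρs) x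
    rw [h1, hσd, ← h1] at h2
    have h3 := (hρpos x).ne'
    have h4 : (2 * ρ x) * frameDeriv X c ρ x = (2 * ρ x) * (κ c x * ρ x) := by
      rw [← h2]; ring
    exact mul_left_cancel₀ (by positivity) h4
  have hinv : ContDiff ℝ ∞ fun x => (ρ x)⁻¹ := hρs.inv fun x => (hρpos x).ne'
  have hinvd : ∀ c x, frameDeriv X c (fun x => (ρ x)⁻¹) x = -κ c x * (ρ x)⁻¹ := by
    intro c x
    have h1 : (fun x => (ρ x)⁻¹ * ρ x) = fun _ => 1 :=
      funext fun x => inv_mul_cancel₀ (hρpos x).ne'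
    have h2 := congrFun (frameDeriv_mul (X := X) (c := c) hinv hρs) x
    rw [h1, frameDeriv_const, hρd] at h2
    have h3 := (hρpos x).ne'
    field_simp at h2 ⊢
    linarith
  have key : ∀ {W : Type} [NormedAddCommGroup W] [NormedSpace ℝ W] {g : E 4 → W},
      ContDiff ℝ ∞ g → (∀ c x, frameDeriv X c g x = κ c x • g x) →
      ∀ x, g x = ρ x • ((ρ 0)⁻¹ • g 0) := by
    intro W _ _ g hg hd x
    have h1 := h.eq_of_frameDeriv_eq_zero (hinv.smul hg) (fun c x => by
      refine (frameDeriv_smul hinv hg x).trans ?_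
      rw [hinvd, hd, smul_smul, ← add_smul]
      convert zero_smul ℝ _ using 2
      ring) x 0
    change (ρ x)⁻¹ • g x = (ρ 0)⁻¹ • g 0 at h1
    rw [← h1, smul_inv_smul₀ (hρpos x).ne']
  exact ⟨ρ, _, _, hρs, hρpos, key h.smooth_spin hA, key h.smooth_drift hb⟩

/-- The leaves are moved by a screw motion. -/
theorem exists_screw : ∃ (ρ : E 4 → ℝ) (B : E n →L[ℝ] E n) (v y₀ : E n), ContDiff ℝ ∞ ρ ∧
    (∀ x, 0 < ρ x) ∧ (∀ x, spin f X x = ρ x • B) ∧ (∀ z z', inner ℝ (B z) z' = -inner ℝ z (B z')) ∧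
    B v = 0 ∧ inner ℝ v v = (1 : ℝ) ∧
    ∀ x, tangentField f X 0 x = ρ x • (B (f x - y₀) + v) := by
  obtain ⟨ρ, B, b, hρs, hρ, hB, hb⟩ := h.exists_const_motion
  have hskew : ∀ z z', inner ℝ (B z) z' = -inner ℝ z (B z') := by
    intro z z'
    have h1 := h.inner_spin 0 z z'
    rw [hB, smul_apply, smul_apply, inner_smul_left, inner_smul_right, conj_trivial] at h1
    have := (hρ 0).ne'
    have h2 : ρ 0 * inner ℝ (B z) z' = ρ 0 * -inner ℝ z (B z') := by linarith
    exact mul_left_cancel₀ this h2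
  set S := LinearMap.range B.toLinearMap with hS
  -- The component of b in the image of B is absorbed by moving the origin. The orthogonal rest v is
  -- the axis direction, killed by B because B is skew.
  obtain ⟨p, hp, v, hv, hpv⟩ := S.exists_add_mem_mem_orthogonal b
  obtain ⟨y, rfl⟩ := hp
  have hBv : B v = 0 := by
    refine ext_inner_right ℝ fun w => ?_
    have h1 : inner ℝ (B w) v = 0 := hv _ ⟨w, rfl⟩
    rw [hskew, inner_zero_left, real_inner_comm, h1, neg_zero]
  have he : ∀ x, tangentField f X 0 x = ρ x • (B (f x + y) + v) := by
    intro x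
    have h1 : tangentField f X 0 x = drift f X x + spin f X x (f x) := (sub_add_cancel _ _).symm
    rw [h1, hb, hB, hpv, smul_apply, map_add, ContinuousLinearMap.coe_coe]
    module
  -- A pure rotation is impossible: e₀ would be in the image of A.
  have hv0 : v ≠ 0 := by
    intro hv0
    have h1 := (h.eq_zero_of_spin_eq_smul (x := 0) (z := f 0 + y) (s := 1) (by
      rw [he, hB, hv0, add_zero, one_smul, smul_apply])).1
    exact one_ne_zero h1
  have hm : 0 < ‖v‖ := norm_pos_iff.2 hv0
  refine ⟨fun x => ρ x * ‖v‖, ‖v‖⁻¹ • B, ‖v‖⁻¹ • v, -y, hρs.mul contDiff_const,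
    fun x => mul_pos (hρ x) hm, fun x => ?_, fun z z' => ?_, ?_, ?_, fun x => ?_⟩
  · rw [hB, smul_smul, mul_assoc, mul_inv_cancel₀ hm.ne', mul_one]
  · simp only [smul_apply, inner_smul_left, inner_smul_right, hskew, conj_trivial, mul_neg]
  · simp [hBv]
  · rw [inner_smul_left, inner_smul_right, real_inner_self_eq_norm_sq, conj_trivial]
    field_simp
  · rw [he, sub_neg_eq_add, smul_apply, ← smul_add, smul_smul, mul_assoc, mul_inv_cancel₀ hm.ne',
      mul_one]

end AdaptedFrame

end

end Austere

/-! ### Vanishing parameters: the axis -/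

namespace Austere

section
variable {n : ℕ} {f : E 4 → E n} {X : Fin 4 → E 4 → E 4}

/-- Singular value decomposition of an injective linear map. -/
theorem exists_singular_basis {S : E 3 →ₗ[ℝ] E n} (hS : Function.Injective S) :
    ∃ (q : OrthonormalBasis (Fin 3) ℝ (E 3)) (μ : Fin 3 → ℝ), (∀ i, 0 < μ i) ∧
      ∀ i j, inner ℝ (S (q i)) (S (q j)) = if i = j then μ i ^ 2 else 0 := by
  have hT : (S.adjoint ∘ₗ S).IsSymmetric := fun a b => by
    simp [LinearMap.adjoint_inner_left, LinearMap.adjoint_inner_right]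
  have hn : Module.finrank ℝ (E 3) = 3 := by simp
  set q := hT.eigenvectorBasis hn
  have h1 : ∀ i j, inner ℝ (S (q i)) (S (q j)) = if i = j then hT.eigenvalues hn i else 0 := by
    intro i j
    have h2 : inner ℝ ((S.adjoint ∘ₗ S) (q i)) (q j) = inner ℝ (S (q i)) (S (q j)) := by
      simp [LinearMap.adjoint_inner_left]
    rw [← h2, hT.apply_eigenvectorBasis, inner_smul_left, orthonormal_iff_ite.1 q.orthonormal]
    simp
  have hpos : ∀ i, 0 < hT.eigenvalues hn i := by
    intro i
    have h2 := h1 i i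
    rw [if_pos rfl] at h2
    rw [← h2]
    refine real_inner_self_pos.2 fun h0 => ?_
    exact q.orthonormal.ne_zero i (hS (by rw [h0, map_zero]))
  refine ⟨q, fun i => √(hT.eigenvalues hn i), fun i => Real.sqrt_pos.2 (hpos i), fun i j => ?_⟩
  rw [h1, Real.sq_sqrt (hpos i).le]

/-- An affine isometry with given values on an orthonormal frame. -/
theorem exists_affineIsometry {g : Fin 7 → E n} (hg : Orthonormal ℝ g) (y : E n) :
    ∃ Φ : E 7 →ᵃⁱ[ℝ] E n, ∀ x, Φ x = y + ∑ i, x i • g i := by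
  set b := EuclideanSpace.basisFun (Fin 7) ℝ
  set L := (b.toBasis.constr ℝ g).isometryOfOrthonormal (v := b.toBasis)
    (by rw [OrthonormalBasis.coe_toBasis]; exact b.orthonormal)
    (by convert hg using 1; funext i; simp)
  refine ⟨(AffineIsometryEquiv.constVAdd ℝ (E n) y).toAffineIsometry.comp L.toAffineIsometry,
    fun x => ?_⟩
  simp [L, Module.Basis.constr_apply_fintype, b]

/-- Rotating orthonormal vectors span the points of a generalized helicoid. -/
theorem mem_image_helicoid {v : E n} {u u' : Fin 3 → E n} (hv : inner ℝ v v = (1 : ℝ))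
    (hvu : ∀ i, inner ℝ v (u i) = (0 : ℝ)) (hvu' : ∀ i, inner ℝ v (u' i) = (0 : ℝ))
    (huu : ∀ i j, inner ℝ (u i) (u j) = if i = j then (1 : ℝ) else 0)
    (huu' : ∀ i j, inner ℝ (u i) (u' j) = (0 : ℝ))
    (hu'u' : ∀ i j, inner ℝ (u' i) (u' j) = if i = j then (1 : ℝ) else 0) (y : E n)
    (μ : Fin 3 → ℝ) : ∃ Φ : E 7 →ᵃⁱ[ℝ] E n, ∀ (τ : ℝ) (s : Fin 3 → ℝ),
      y + τ • v + ∑ i, s i • (Real.cos (μ i * τ) • u i + Real.sin (μ i * τ) • u' i) ∈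
        Φ '' generalizedHelicoid μ := by
  have hg : Orthonormal ℝ ![v, u 0, u' 0, u 1, u' 1, u 2, u' 2] := by
    rw [orthonormal_iff_ite]
    have huv := fun i => (real_inner_comm (u i) v).symm.trans (hvu i)
    have hu'v := fun i => (real_inner_comm (u' i) v).symm.trans (hvu' i)
    have hu'u := fun i j => (real_inner_comm (u' i) (u j)).symm.trans (huu' j i)
    intro i j
    fin_cases i <;> fin_cases j <;>
      simp [hv, hvu, hvu', huu, huu', hu'u', huv, hu'v, hu'u, -inner_self_eq_norm_sq_to_K]
  obtain ⟨Φ, hΦ⟩ := exists_affineIsometry hg y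
  refine ⟨Φ, fun τ s => ⟨_, ⟨![τ, s 0, s 1, s 2], rfl⟩, ?_⟩⟩
  rw [hΦ]
  simp [Fin.sum_univ_succ]
  module

namespace AdaptedFrame

variable (h : AdaptedFrame 0 f X)
include h

/-- The leaves pass through a common axis, around which they rotate. -/
theorem exists_axis : ∃ (ρ τ : E 4 → ℝ) (B : E n →L[ℝ] E n) (v y : E n), ContDiff ℝ ∞ τ ∧
    (∀ x, 0 < ρ x) ∧ (∀ x, spin f X x = ρ x • B) ∧ (∀ z z', inner ℝ (B z) z' = -inner ℝ z (B z')) ∧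
    B v = 0 ∧ inner ℝ v v = (1 : ℝ) ∧ τ 0 = 0 ∧ (∀ x, frameDeriv X 0 τ x = ρ x) ∧
    (∀ (i : Fin 3) x, frameDeriv X i.succ τ x = 0) ∧
    ∀ x, f x = y + τ x • v + proj f X x (f x - y) := by
  obtain ⟨ρ, B, v, y₀, hρs, hρ, hB, hskew, hBv, hv, he⟩ := h.exists_screw
  have hev : ∀ (i : Fin 3) x, inner ℝ (tangentField f X i.succ x) v = 0 := fun i x =>
    (h.eq_zero_of_spin_eq_smul (x := x) (z := v) (s := 0) (by
      rw [hB, smul_apply, hBv, smul_zero, zero_smul])).2 i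
  have hPv : ∀ x, proj f X x v = 0 := fun x => by simp [proj_apply, hev]
  have he0 : ∀ x, inner ℝ (tangentField f X 0 x) v = ρ x := fun x => by
    rw [he, inner_smul_left, inner_add_left, hskew, hBv, hv]
    simp
  have hPB : ∀ x, proj f X x (B (f x - y₀)) = 0 := by
    intro x
    have h1 := h.proj_zero x
    rw [he, map_smul, map_add, hPv, add_zero] at h1
    exact (smul_eq_zero.1 h1).resolve_left (hρ x).ne'
  have hBeq : ∀ x, B = B * proj f X x + proj f X x * B := by
    intro x
    have h1 := h.spin_eq x
    rw [hB] at h1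
    ext1 z
    have h2 := congrArg (fun T => T z) h1
    simp only [add_apply, mul_apply_eq_comp, smul_apply, map_smul, ← smul_add] at h2 ⊢
    exact smul_right_injective _ (hρ x).ne' h2
  set τ : E 4 → ℝ := fun x => inner ℝ (f x - y₀) v with hτ
  have sy : ContDiff ℝ ∞ fun x => f x - y₀ := h.smooth.sub contDiff_const
  have sτ : ContDiff ℝ ∞ τ := sy.inner ℝ contDiff_const
  have dy : ∀ c x, frameDeriv X c (fun x => f x - y₀) x = tangentField f X c x := by
    intro c x
    rw [frameDeriv_fun_sub h.smooth contDiff_const, frameDeriv_position f]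
    simp [frameDeriv]
  have dτ : ∀ c x, frameDeriv X c τ x = inner ℝ (tangentField f X c x) v := by
    intro c x
    rw [hτ, frameDeriv_inner sy contDiff_const, dy]
    simp [frameDeriv]
  -- The part of f - y₀ orthogonal to the axis direction and to the leaf. It is constant, so a
  -- translation removes it and every leaf plane meets the axis.
  set z : E 4 → E n := fun x => f x - y₀ - τ x • v - proj f X x (f x - y₀) with hz
  have s1 : ContDiff ℝ ∞ fun x => τ x • v := sτ.smul contDiff_const
  have s2 : ContDiff ℝ ∞ fun x => proj f X x (f x - y₀) := h.smooth_proj.clm_apply sy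
  have s3 : ContDiff ℝ ∞ fun x => f x - y₀ - τ x • v := sy.sub s1
  have hzc : ∀ x, z x = z 0 := by
    refine fun x => h.eq_of_frameDeriv_eq_zero (s3.sub s2) (fun c x => ?_) x 0
    have h1 : frameDeriv X c (fun x => τ x • v) x = inner ℝ (tangentField f X c x) v • v := by
      rw [frameDeriv_smul sτ contDiff_const, dτ]
      simp [frameDeriv]
    refine (frameDeriv_fun_sub s3 s2 x).trans ?_
    rw [frameDeriv_fun_sub sy s1, frameDeriv_clm_apply h.smooth_proj sy, dy, h1]
    refine Fin.cases ?_ (fun i => ?_) c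
    · rw [h.proj_zero, he0, add_zero]
      change tangentField f X 0 x - ρ x • v - projDeriv f X x (f x - y₀) = 0
      have h2 := congrArg (fun T => T (f x - y₀)) (h.projDeriv_eq_spin x)
      simp only [sub_apply, mul_apply_eq_comp, hB, smul_apply, map_smul, hPB] at h2
      have h3 := congrArg (fun T => T (f x - y₀)) (hBeq x)
      simp only [add_apply, mul_apply_eq_comp, hPB, add_zero] at h3
      rw [h2, he, ← h3]
      simp [smul_add]
    · rw [h.frameDeriv_proj, h.proj_succ, hev]
      simp
  have hzv : inner ℝ (z 0) v = 0 := by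
    rw [hz]
    simp only [inner_sub_left, inner_smul_left, hv, inner_proj, hPv]
    simp [hτ, inner_sub_left]
  have hPz : ∀ x, proj f X x (z 0) = 0 := by
    intro x
    have h2 := congrArg (fun T => T (f x - y₀)) (h.proj_mul_self x)
    simp only [mul_apply_eq_comp] at h2
    rw [← hzc x, hz]
    simp only [map_sub, map_smul, hPv, smul_zero, sub_zero] at h2 ⊢
    rw [h2, sub_self]
  refine ⟨ρ, fun x => τ x - τ 0, B, v, y₀ + z 0 + τ 0 • v, sτ.sub contDiff_const, hρ, hB, hskew,
    hBv, hv, sub_self _, fun x => ?_, fun i x => ?_, fun x => ?_⟩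
  · rw [frameDeriv_fun_sub sτ contDiff_const, dτ, he0]
    simp [frameDeriv]
  · rw [frameDeriv_fun_sub sτ contDiff_const, dτ, hev]
    simp [frameDeriv]
  · have h1 : proj f X x (f x - (y₀ + z 0 + τ 0 • v)) = proj f X x (f x - y₀) := by
      have : f x - (y₀ + z 0 + τ 0 • v) = (f x - y₀) - z 0 - τ 0 • v := by abel
      rw [this, map_sub, map_sub, hPz, map_smul, hPv, smul_zero, sub_zero, sub_zero]
    have h2 : f x - y₀ - τ x • v - proj f X x (f x - y₀) = z 0 := hzc x
    rw [h1, ← h2, sub_smul]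
    abel

end AdaptedFrame

end

end Austere

/-! ### Vanishing parameters: the helicoid -/

namespace Austere

section
variable {n : ℕ} {f : E 4 → E n} {X : Fin 4 → E 4 → E 4}

namespace AdaptedFrame

variable (h : AdaptedFrame 0 f X)
include h

theorem proj_eq_self_iff (x : E 4) (z : E n) :
    proj f X x z = z ↔ z ∈ Submodule.span ℝ (Set.range fun i : Fin 3 => tangentField f X i.succ x) := by
  constructor
  · intro hz
    rw [← hz, proj_apply]
    exact Submodule.sum_mem _ fun i _ => Submodule.smul_mem _ _ (Submodule.subset_span ⟨i, rfl⟩)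
  · intro hz
    obtain ⟨c, rfl⟩ := (Submodule.mem_span_range_iff_exists_fun ℝ).1 hz
    simp [h.proj_succ]

/-- Three orthonormal vectors in the image of the projection span it. -/
theorem exists_eq_sum {x : E 4} {w : Fin 3 → E n} (hw : Orthonormal ℝ w)
    (hP : ∀ i, proj f X x (w i) = w i) {z : E n} (hz : proj f X x z = z) :
    ∃ s : Fin 3 → ℝ, z = ∑ i, s i • w i := by
  have h1 : Submodule.span ℝ (Set.range w) =
      Submodule.span ℝ (Set.range fun i : Fin 3 => tangentField f X i.succ x) := by
    apply Submodule.eq_of_le_of_finrank_eq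
    · rw [Submodule.span_le]
      rintro _ ⟨i, rfl⟩
      exact (h.proj_eq_self_iff x _).1 (hP i)
    · rw [finrank_span_eq_card hw.linearIndependent]
      have h2 : LinearIndependent ℝ fun i : Fin 3 => tangentField f X i.succ x :=
        ((h.adapted x).1.comp _ (Fin.succ_injective 3)).linearIndependent
      rw [finrank_span_eq_card h2]
  rw [h.proj_eq_self_iff, ← h1] at hz
  obtain ⟨c, hc⟩ := (Submodule.mem_span_range_iff_exists_fun ℝ).1 hz
  exact ⟨c, hc.symm⟩

/-- An orthonormal basis of a leaf which diagonalises the infinitesimal rotation. -/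
theorem exists_rotation_basis {ρ : ℝ} {B : E n →L[ℝ] E n} (hρ : 0 < ρ)
    (hB : spin f X 0 = ρ • B) (hskew : ∀ z z', inner ℝ (B z) z' = -inner ℝ z (B z')) :
    ∃ (u : Fin 3 → E n) (μ : Fin 3 → ℝ), (∀ i, 0 < μ i) ∧
      (∀ i, proj f X 0 (u i) = u i) ∧ (∀ i j, inner ℝ (u i) (u j) = if i = j then (1 : ℝ) else 0) ∧
      (∀ i j, inner ℝ (u i) (B (u j)) = (0 : ℝ)) ∧
      (∀ i j, inner ℝ (B (u i)) (B (u j)) = if i = j then μ i ^ 2 else 0) ∧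
      ∀ i, B (B (u i)) = -(μ i ^ 2) • u i := by
  have ho : Orthonormal ℝ fun i : Fin 3 => tangentField f X i.succ 0 :=
    (h.adapted 0).1.comp _ (Fin.succ_injective 3)
  set b := EuclideanSpace.basisFun (Fin 3) ℝ
  set ι := (b.toBasis.constr ℝ fun i : Fin 3 => tangentField f X i.succ 0).isometryOfOrthonormal
    (v := b.toBasis) (by rw [OrthonormalBasis.coe_toBasis]; exact b.orthonormal)
    (by convert ho using 1; funext i; simp)
  have hι : ∀ c, ι c = ∑ i : Fin 3, c i • tangentField f X i.succ 0 := fun c => by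
    simp [ι, Module.Basis.constr_apply_fintype, b]
  have hPι : ∀ c, proj f X 0 (ι c) = ι c := fun c => by simp [hι, h.proj_succ]
  have hιP : ∀ z, proj f X 0 z = z → ∃ c, z = ι c := fun z hz => by
    refine ⟨WithLp.toLp 2 fun i => inner ℝ (tangentField f X i.succ 0) z, ?_⟩
    rw [hι]
    conv_lhs => rw [← hz, proj_apply]
  set S := B.toLinearMap ∘ₗ ι.toLinearMap with hS
  have hSi : Function.Injective S := by
    rw [injective_iff_map_eq_zero]
    intro c hc
    change B (ι c) = 0 at hc
    have h1 := (h.eq_zero_of_spin_eq_smul (x := 0) (z := ι c) (s := 0) (by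
      rw [hB, smul_apply, hc, smul_zero, zero_smul])).2
    have h2 : ι c = 0 := by rw [← hPι, proj_apply]; simp [h1]
    exact ι.injective (by rw [h2, map_zero])
  obtain ⟨q, μ, hμ, hq⟩ := exists_singular_basis hSi
  have hBB : ∀ i j, inner ℝ (B (ι (q i))) (B (ι (q j))) = if i = j then μ i ^ 2 else 0 := hq
  have hPBP : ∀ z, proj f X 0 z = z → proj f X 0 (B z) = 0 := by
    intro z hz
    have h1 := congrArg (fun T => T z) (h.proj_spin_proj 0)
    simp only [mul_apply_eq_comp, hz, hB, smul_apply, map_smul, zero_apply] at h1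
    exact (smul_eq_zero.1 h1).resolve_left hρ.ne'
  refine ⟨fun i => ι (q i), μ, hμ, fun i => hPι _, fun i j => ?_, fun i j => ?_, hBB, fun i => ?_⟩
  · rw [ι.inner_map_map]
    exact orthonormal_iff_ite.1 q.orthonormal i j
  · change inner ℝ (ι (q i)) (B (ι (q j))) = 0
    rw [← hPι (q i), inner_proj, hPBP _ (hPι _), inner_zero_right]
  -- B exchanges the leaf directions at the origin with orthogonal ones, so B² preserves them. There
  -- it is the negative Gram operator of B, hence diagonal in the singular basis.
  · have h1 : proj f X 0 (B (B (ι (q i)))) = B (B (ι (q i))) := by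
      have h2 := congrArg (fun T => T (B (ι (q i)))) (h.spin_eq 0)
      simp only [add_apply, mul_apply_eq_comp, hPBP _ (hPι _), map_zero, zero_add, hB, smul_apply,
        map_smul] at h2
      exact (smul_right_injective _ hρ.ne' h2).symm
    obtain ⟨c, hc⟩ := hιP _ h1
    rw [hc, ← map_smul]
    congr 1
    refine q.repr.injective ?_
    ext j
    rw [q.repr_apply_apply, q.repr_apply_apply, ← ι.inner_map_map, ← hc, real_inner_comm, hskew, hBB, inner_smul_right,
      orthonormal_iff_ite.1 q.orthonormal]
    by_cases hij : i = j
    · simp [hij]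
    · simp [hij, Ne.symm hij]

/-- An austere immersion of type C with vanishing parameters and rank three lies on a generalized
helicoid. -/
theorem range_subset_helicoid : ∃ μ : Fin 3 → ℝ, (∀ i, 0 < μ i) ∧
    ∃ Φ : E 7 →ᵃⁱ[ℝ] E n, Set.range f ⊆ Φ '' generalizedHelicoid μ := by
  obtain ⟨ρ, τ, B, v, y, hτ, hρ, hB, hskew, hBv, hv, hτ0, dτ0, dτ, hf⟩ := h.exists_axis
  obtain ⟨u, μ, hμ, hPu, huu, huB, hBB, hB2⟩ := h.exists_rotation_basis (hρ 0) (hB 0) hskew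
  have hev : ∀ (i : Fin 3) x, inner ℝ (tangentField f X i.succ x) v = 0 := fun i x =>
    (h.eq_zero_of_spin_eq_smul (x := x) (z := v) (s := 0) (by
      rw [hB, smul_apply, hBv, smul_zero, zero_smul])).2 i
  have hPv : ∀ x, proj f X x v = 0 := fun x => by simp [proj_apply, hev]
  obtain ⟨Φ, hΦ⟩ := mem_image_helicoid (v := v) (u := u) (u' := fun i => (μ i)⁻¹ • B (u i)) hv
    (fun i => by rw [← hPu i, ← inner_proj, hPv, inner_zero_left])
    (fun i => by rw [inner_smul_right, ← neg_eq_iff_eq_neg.2 (hskew v (u i)), hBv]; simp) huu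
    (fun i j => by rw [inner_smul_right, huB, mul_zero])
    (fun i j => by
      rw [inner_smul_left, inner_smul_right, hBB, conj_trivial]
      by_cases hij : i = j
      · subst hij
        have := (hμ i).ne'
        simp only [if_true]
        field_simp
      · simp [hij]) y μ
  refine ⟨μ, hμ, Φ, ?_⟩
  rintro _ ⟨x, rfl⟩
  set w : Fin 3 → E 4 → E n := fun i x =>
    Real.cos (μ i * τ x) • u i + Real.sin (μ i * τ x) • ((μ i)⁻¹ • B (u i)) with hw
  -- The vector w i solves dw = dτ · B w, and so does its component outside the leaf, because D₀P =
  -- ρ[B, P]. As B is skew that component has constant length, and at the origin it is zero.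
  have hPw : ∀ i x, proj f X x (w i x) = w i x := by
    intro i
    have sc : ContDiff ℝ ∞ fun x => Real.cos (μ i * τ x) := Real.contDiff_cos.comp (contDiff_const.mul hτ)
    have ss : ContDiff ℝ ∞ fun x => Real.sin (μ i * τ x) := Real.contDiff_sin.comp (contDiff_const.mul hτ)
    have sm : Differentiable ℝ fun x => μ i * τ x := (contDiff_const.mul hτ).differentiable (by simp)
    have s1 : ContDiff ℝ ∞ fun x => Real.cos (μ i * τ x) • u i := sc.smul contDiff_const
    have s2 : ContDiff ℝ ∞ fun x => Real.sin (μ i * τ x) • ((μ i)⁻¹ • B (u i)) :=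
      ss.smul contDiff_const
    have sw : ContDiff ℝ ∞ (w i) := s1.add s2
    have dm : ∀ c x, fderiv ℝ (fun x => μ i * τ x) x (X c x) = μ i * frameDeriv X c τ x :=
      fun c x => congrFun (frameDeriv_const_mul (X := X) (c := c) (μ i) hτ) x
    have dw : ∀ c x, frameDeriv X c (w i) x = frameDeriv X c τ x • B (w i x) := by
      intro c x
      refine (frameDeriv_fun_add s1 s2 x).trans ?_
      rw [frameDeriv_smul sc contDiff_const, frameDeriv_smul ss contDiff_const]
      have e1 : frameDeriv X c (fun x => Real.cos (μ i * τ x)) x =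
          -Real.sin (μ i * τ x) * (μ i * frameDeriv X c τ x) := by
        rw [frameDeriv, fderiv_cos (sm x), smul_apply, dm, smul_eq_mul]
      have e2 : frameDeriv X c (fun x => Real.sin (μ i * τ x)) x =
          Real.cos (μ i * τ x) * (μ i * frameDeriv X c τ x) := by
        rw [frameDeriv, fderiv_sin (sm x), smul_apply, dm, smul_eq_mul]
      have e3 : ∀ z : E n, frameDeriv X c (fun _ => z) x = 0 := fun z => by simp [frameDeriv]
      rw [e1, e2, e3, e3]
      simp only [hw, map_add, map_smul, hB2, smul_zero, add_zero, smul_add, smul_smul, neg_smul,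
        smul_neg]
      have := (hμ i).ne'
      match_scalars <;> field_simp
    have sP : ContDiff ℝ ∞ fun x => proj f X x (w i x) := h.smooth_proj.clm_apply sw
    have sz : ContDiff ℝ ∞ fun x => w i x - proj f X x (w i x) := sw.sub sP
    have dz : ∀ c x, frameDeriv X c (fun x => w i x - proj f X x (w i x)) x =
        frameDeriv X c τ x • B (w i x - proj f X x (w i x)) := by
      intro c x
      rw [frameDeriv_fun_sub sw sP, frameDeriv_clm_apply h.smooth_proj sw, dw]
      refine Fin.cases ?_ (fun j => ?_) c
      · have h2 := congrArg (fun T => T (w i x)) (h.projDeriv_eq_spin x)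
        simp only [sub_apply, mul_apply_eq_comp, hB, smul_apply, map_smul] at h2
        change _ - (projDeriv f X x (w i x) + _) = _
        rw [h2, dτ0, map_smul, map_sub, smul_sub]
        abel
      · rw [dτ, h.frameDeriv_proj]
        simp
    have hskew0 : ∀ z, inner ℝ (B z) z = (0 : ℝ) := fun z => by
      have h1 := hskew z z
      rw [real_inner_comm] at h1
      rw [real_inner_comm]
      linarith
    have hc : ∀ x, inner ℝ (w i x - proj f X x (w i x)) (w i x - proj f X x (w i x)) = (0 : ℝ) := by
      intro x
      have h1 := h.eq_of_frameDeriv_eq_zero (sz.inner ℝ sz) (fun c x => by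
        rw [frameDeriv_inner sz sz, dz, inner_smul_left, inner_smul_right, hskew0,
          real_inner_comm, hskew0]
        simp) x 0
      rw [h1]
      have h2 : w i 0 = u i := by simp [hw, hτ0]
      rw [h2, hPu, sub_self, inner_zero_left]
    intro x
    exact (sub_eq_zero.1 (inner_self_eq_zero.1 (hc x))).symm
  have how : Orthonormal ℝ fun i => w i x := by
    rw [orthonormal_iff_ite]
    intro i j
    have hBu : ∀ i j, inner ℝ (B (u i)) (u j) = (0 : ℝ) := fun i j => by
      rw [real_inner_comm, huB]
    simp only [hw, inner_add_left, inner_add_right, inner_smul_left, inner_smul_right, huu, huB,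
      hBB, hBu, conj_trivial]
    by_cases hij : i = j
    · subst hij
      have := (hμ i).ne'
      have h3 := Real.sin_sq_add_cos_sq (μ i * τ x)
      simp only [if_true]
      field_simp
      linear_combination (μ i) * h3
    · simp [hij]
  have hPP : proj f X x (proj f X x (f x - y)) = proj f X x (f x - y) :=
    congrArg (fun T => T (f x - y)) (h.proj_mul_self x)
  obtain ⟨s, hs⟩ := h.exists_eq_sum how (fun i => hPw i x) hPP
  rw [hf x, hs]
  exact hΦ (τ x) s

end AdaptedFrame

end

end Austere

/-! ### Analytic continuation and openness -/

namespace Austere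

section
open Filter Topology

/-- An analytic embedding `Z` of `ℝ⁴` with a global analytic retraction `R`. -/
structure IsAnalyticRetract {n : ℕ} (Z : E 4 → E n) (R : E n → E 4) : Prop where
  contDiff : ContDiff ℝ ω Z
  contDiff_retract : ContDiff ℝ ω R
  leftInverse : Function.LeftInverse R Z

namespace IsAnalyticRetract

variable {n : ℕ} {Z Z' : E 4 → E n} {R R' : E n → E 4}

theorem mem_range_iff (h : IsAnalyticRetract Z R) {z : E n} : z ∈ Set.range Z ↔ Z (R z) = z := by
  constructor
  · rintro ⟨x, rfl⟩
    rw [h.leftInverse]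
  · exact fun hz => ⟨_, hz⟩

/-- Unique continuation: an analytic image that meets another one in an open piece is contained
in it. -/
theorem range_subset (h : IsAnalyticRetract Z R) (h' : IsAnalyticRetract Z' R') {x₀ : E 4}
    (hx : ∀ᶠ x in 𝓝 x₀, Z' x ∈ Set.range Z) : Set.range Z' ⊆ Set.range Z := by
  have ha : AnalyticOnNhd ℝ (fun x => Z (R (Z' x)) - Z' x) Set.univ :=
    contDiff_omega_iff_analyticOnNhd.1
      ((h.contDiff.comp (h.contDiff_retract.comp h'.contDiff)).sub h'.contDiff)
  have h0 : (fun x => Z (R (Z' x)) - Z' x) =ᶠ[𝓝 x₀] 0 := by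
    filter_upwards [hx] with x hx
    rw [h.mem_range_iff.1 hx, sub_self]
    rfl
  have h1 := ha.eqOn_zero_of_preconnected_of_eventuallyEq_zero isPreconnected_univ
    (Set.mem_univ x₀) h0
  rintro _ ⟨x, rfl⟩
  exact h.mem_range_iff.2 (sub_eq_zero.1 (h1 (Set.mem_univ x)))

end IsAnalyticRetract

section Manifold

variable {M : Type*} [TopologicalSpace M] [ChartedSpace (E 4) M] [IsManifold 𝓘(ℝ, E 4) ∞ M]
  {n : ℕ} {F : M → E n} {Z : E 4 → E n} {R : E n → E 4}

/-- An immersion into the image of an analytic embedding is open in the parameters. -/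
theorem IsImmersed.nhds_le_map (hF : IsImmersed F) (h : IsAnalyticRetract Z R) {q : M}
    (hq : ∀ᶠ p in 𝓝 q, F p ∈ Set.range Z) : 𝓝 (R (F q)) ≤ map (R ∘ F) (𝓝 q) := by
  set y := extChartAt 𝓘(ℝ, E 4) q q with hy
  set G := R ∘ localRep F q with hG
  have hqy : localRep F q y = F q := by
    rw [localRep, Function.comp_apply, hy, extChartAt_to_inv]
  have hl := localRep_contDiffAt hF q (mem_extChartAt_target (I := 𝓘(ℝ, E 4)) q)
  have hR : ContDiff ℝ ∞ R := h.contDiff_retract.of_le le_top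
  have hZ : ContDiff ℝ ∞ Z := h.contDiff.of_le le_top
  have hGs : ContDiffAt ℝ ∞ G y := hR.contDiffAt.comp y hl
  have hc : Tendsto (extChartAt 𝓘(ℝ, E 4) q).symm (𝓝 y) (𝓝 q) := by
    have := continuousAt_extChartAt_symm (I := 𝓘(ℝ, E 4)) q
    rwa [ContinuousAt, extChartAt_to_inv] at this
  have hZG : localRep F q =ᶠ[𝓝 y] Z ∘ G := by
    filter_upwards [hc.eventually hq] with x hx
    exact (h.mem_range_iff.1 hx).symm
  -- Locally F = Z ∘ R ∘ F, so R ∘ F inherits an injective differential; both sides have dimension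
  -- four, so it is a local diffeomorphism and open.
  have hinj : Function.Injective (fderiv ℝ G y) := by
    have h1 := hF.injective q
    rw [differential_eq_fderiv hF, hZG.fderiv_eq, fderiv_comp _
      (hZ.differentiable (by simp) _) (hGs.differentiableAt (by simp))] at h1
    exact Function.Injective.of_comp (f := fderiv ℝ Z (G y)) h1
  have hsurj : Function.Surjective (fderiv ℝ G y) :=
    (LinearMap.injective_iff_surjective (f := (fderiv ℝ G y).toLinearMap)).1 hinj
  have h2 := (hGs.hasStrictFDerivAt (by simp)).map_nhds_eq_of_surj
    (LinearMap.range_eq_top.2 hsurj)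
  have h3 : G y = R (F q) := congrArg R hqy
  rw [← h3, ← h2]
  have h4 : map G (𝓝 y) = map (R ∘ F) (map (extChartAt 𝓘(ℝ, E 4) q).symm (𝓝 y)) := rfl
  rw [h4]
  exact map_mono hc

/-- A connected immersed manifold locally contained in images of analytic embeddings of `ℝ⁴` is
contained in any one of them that contains an open piece. -/
theorem IsImmersed.forall_mem_range [ConnectedSpace M] (hF : IsImmersed F)
    (h : IsAnalyticRetract Z R)
    (hloc : ∀ p, ∃ Z' R', IsAnalyticRetract Z' R' ∧ ∀ᶠ q in 𝓝 p, F q ∈ Set.range Z') {p₀ : M}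
    (hp₀ : ∀ᶠ q in 𝓝 p₀, F q ∈ Set.range Z) (p : M) : F p ∈ Set.range Z := by
  set A : Set M := {p | ∀ᶠ q in 𝓝 p, F q ∈ Set.range Z} with hA
  have hopen : IsOpen A := isOpen_setOfPred_eventually_nhds
  have hclosed : IsClosed A := by
    refine isClosed_of_closure_subset fun p hp => ?_
    obtain ⟨Z', R', h', hev⟩ := hloc p
    -- Near a point q of A close to p, F lies in both images. As F is open in the parameters of Z',
    -- an open piece of Z' lies in the image of Z, and by analyticity all of it does.
    obtain ⟨q, hqA, hq⟩ := mem_closure_iff_nhds.1 hp _ hev.eventually_nhds |>.imp fun _ => And.symm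
    have h1 : ∀ᶠ x in 𝓝 (R' (F q)), Z' x ∈ Set.range Z := by
      refine hF.nhds_le_map h' hq ?_
      rw [mem_map]
      have hqA' : ∀ᶠ p in 𝓝 q, F p ∈ Set.range Z := hqA
      have hq' : ∀ᶠ p in 𝓝 q, F p ∈ Set.range Z' := hq
      filter_upwards [hqA', hq'] with x hx hx'
      change Z' (R' (F x)) ∈ Set.range Z
      rwa [h'.mem_range_iff.1 hx']
    have h2 := h.range_subset h' h1
    exact hev.mono fun q hq => h2 hq
  have huniv : A = Set.univ := IsClopen.eq_univ ⟨hclosed, hopen⟩ ⟨p₀, hp₀⟩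
  have hp : p ∈ A := huniv ▸ Set.mem_univ p
  exact Eventually.self_of_nhds (p := fun q => F q ∈ Set.range Z) hp

theorem IsImmersed.exists_isOpen_image_eq (hF : IsImmersed F) (h : IsAnalyticRetract Z R)
    (hmem : ∀ p, F p ∈ Set.range Z) {V : Set M} (hV : IsOpen V) :
    ∃ O, IsOpen O ∧ F '' V = O ∩ Set.range Z := by
  refine ⟨R ⁻¹' ((R ∘ F) '' V), ?_, ?_⟩
  · refine IsOpen.preimage h.contDiff_retract.continuous (isOpen_iff_mem_nhds.2 ?_)
    rintro _ ⟨q, hq, rfl⟩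
    exact hF.nhds_le_map h (Eventually.of_forall hmem) (image_mem_map (hV.mem_nhds hq))
  · ext z
    constructor
    · rintro ⟨q, hq, rfl⟩
      exact ⟨⟨q, hq, rfl⟩, hmem q⟩
    · rintro ⟨⟨q, hq, hz⟩, hz'⟩
      refine ⟨q, hq, ?_⟩
      rw [← h.mem_range_iff.1 hz', ← hz]
      exact (h.mem_range_iff.1 (hmem q)).symm

end Manifold

/-- The parametrisation of the generalized helicoid. -/
def helicoidMap (μ : Fin 3 → ℝ) (x : E 4) : E 7 :=
  !₂[x 0,
     x 1 * Real.cos (μ 0 * x 0), x 1 * Real.sin (μ 0 * x 0),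
     x 2 * Real.cos (μ 1 * x 0), x 2 * Real.sin (μ 1 * x 0),
     x 3 * Real.cos (μ 2 * x 0), x 3 * Real.sin (μ 2 * x 0)]

/-- A retraction onto the parameters of the generalized helicoid. -/
def helicoidRetract (μ : Fin 3 → ℝ) (y : E 7) : E 4 :=
  !₂[y 0,
     y 1 * Real.cos (μ 0 * y 0) + y 2 * Real.sin (μ 0 * y 0),
     y 3 * Real.cos (μ 1 * y 0) + y 4 * Real.sin (μ 1 * y 0),
     y 5 * Real.cos (μ 2 * y 0) + y 6 * Real.sin (μ 2 * y 0)]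

theorem range_helicoidMap (μ : Fin 3 → ℝ) :
    Set.range (helicoidMap μ) = generalizedHelicoid μ := by
  ext z
  constructor
  · rintro ⟨x, rfl⟩
    exact ⟨x, rfl⟩
  · rintro ⟨x, rfl⟩
    exact ⟨WithLp.toLp 2 x, rfl⟩

theorem contDiff_helicoidMap (μ : Fin 3 → ℝ) : ContDiff ℝ ω (helicoidMap μ) := by
  rw [contDiff_euclidean]
  have hx : ∀ i, ContDiff ℝ ω fun x : E 4 => x i := fun i => contDiff_euclidean.1 contDiff_id i
  have hc : ∀ i, ContDiff ℝ ω fun x : E 4 => Real.cos (μ i * x 0) := fun i =>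
    Real.contDiff_cos.comp (contDiff_const.mul (hx 0))
  have hs : ∀ i, ContDiff ℝ ω fun x : E 4 => Real.sin (μ i * x 0) := fun i =>
    Real.contDiff_sin.comp (contDiff_const.mul (hx 0))
  intro i
  fin_cases i
  exacts [hx 0, (hx 1).mul (hc 0), (hx 1).mul (hs 0), (hx 2).mul (hc 1), (hx 2).mul (hs 1),
    (hx 3).mul (hc 2), (hx 3).mul (hs 2)]

theorem contDiff_helicoidRetract (μ : Fin 3 → ℝ) : ContDiff ℝ ω (helicoidRetract μ) := by
  rw [contDiff_euclidean]
  have hx : ∀ i, ContDiff ℝ ω fun x : E 7 => x i := fun i => contDiff_euclidean.1 contDiff_id i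
  have hc : ∀ i, ContDiff ℝ ω fun x : E 7 => Real.cos (μ i * x 0) := fun i =>
    Real.contDiff_cos.comp (contDiff_const.mul (hx 0))
  have hs : ∀ i, ContDiff ℝ ω fun x : E 7 => Real.sin (μ i * x 0) := fun i =>
    Real.contDiff_sin.comp (contDiff_const.mul (hx 0))
  intro i
  fin_cases i
  exacts [hx 0, ((hx 1).mul (hc 0)).add ((hx 2).mul (hs 0)),
    ((hx 3).mul (hc 1)).add ((hx 4).mul (hs 1)), ((hx 5).mul (hc 2)).add ((hx 6).mul (hs 2))]

theorem helicoidRetract_helicoidMap (μ : Fin 3 → ℝ) (x : E 4) :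
    helicoidRetract μ (helicoidMap μ x) = x := by
  ext i
  fin_cases i <;>
    simp [helicoidRetract, helicoidMap, mul_assoc, ← mul_add, ← sq]

theorem isAnalyticRetract_helicoid {n : ℕ} (μ : Fin 3 → ℝ) (Φ : E 7 →ᵃⁱ[ℝ] E n) :
    ∃ Z R, IsAnalyticRetract Z R ∧ Set.range Z = Φ '' generalizedHelicoid μ := by
  set L := Φ.linearIsometry.toContinuousLinearMap
  have hΦ : ∀ y, Φ y = L y + Φ 0 := fun y => by
    have := Φ.map_vadd 0 y
    simp only [vadd_eq_add, add_zero] at this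
    exact this
  -- The adjoint is a left inverse of the isometry, which extends the retraction linearly to the
  -- whole ambient space.
  have hL : ∀ y, L.adjoint (L y) = y := fun y => by
    refine ext_inner_right ℝ fun w => ?_
    rw [ContinuousLinearMap.adjoint_inner_left]
    exact Φ.linearIsometry.inner_map_map y w
  refine ⟨Φ ∘ helicoidMap μ, fun z => helicoidRetract μ (L.adjoint (z - Φ 0)), ⟨?_, ?_, ?_⟩, ?_⟩
  · have : Φ ∘ helicoidMap μ = fun x => L (helicoidMap μ x) + Φ 0 := funext fun x => hΦ _
    rw [this]
    exact (L.contDiff.comp (contDiff_helicoidMap μ)).add contDiff_const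
  · exact (contDiff_helicoidRetract μ).comp (L.adjoint.contDiff.comp (contDiff_id.sub contDiff_const))
  · intro x
    change helicoidRetract μ (L.adjoint (Φ (helicoidMap μ x) - Φ 0)) = x
    rw [hΦ, add_sub_cancel_right, hL, helicoidRetract_helicoidMap]
  · rw [Set.range_comp, range_helicoidMap]

end

end Austere

end

theorem mainTheorem4 {M : Type*} [TopologicalSpace M] [ChartedSpace (Austere.E 4) M]
    [IsManifold 𝓘(ℝ, Austere.E 4) ∞ M] [ConnectedSpace M] (r : ℕ)
    (F : M → Austere.E (4 + r)) (hF : Austere.IsImmersed F)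
    (l : Fin 3 → ℝ) (hC : Austere.IsTypeC F fun _ => l)
    (hrank : ∀ p, Austere.normalRank F p = 3) :
    (∀ i, l i = 0) ∧
      ∃ μ : Fin 3 → ℝ, (∀ i, 0 < μ i) ∧
        ∃ Φ : Austere.E 7 →ᵃⁱ[ℝ] Austere.E (4 + r),
          ∀ V : Set M, IsOpen V →
            ∃ O : Set (Austere.E (4 + r)), IsOpen O ∧
              F '' V = O ∩ Φ '' Austere.generalizedHelicoid μ := by
  obtain ⟨p₀⟩ : Nonempty M := inferInstance
  have hl : l = 0 := by
    obtain ⟨g, ⟨X, hX⟩, -⟩ := Austere.exists_local_model hF hC hrank p₀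
    exact hX.param_eq_zero (hC.param p₀)
  subst hl
  refine ⟨fun i => rfl, ?_⟩
  have hloc : ∀ p, ∃ μ : Fin 3 → ℝ, (∀ i, 0 < μ i) ∧
      ∃ Φ : Austere.E 7 →ᵃⁱ[ℝ] Austere.E (4 + r),
        ∀ᶠ q in nhds p, F q ∈ Φ '' Austere.generalizedHelicoid μ := by
    intro p
    obtain ⟨g, ⟨X, hX⟩, hg⟩ := Austere.exists_local_model hF hC hrank p
    obtain ⟨μ, hμ, Φ, hΦ⟩ := hX.range_subset_helicoid
    exact ⟨μ, hμ, Φ, hg.mono fun q hq => hΦ hq⟩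
  -- The helicoid found at one point serves for all of M; those at other points only enter the
  -- continuation argument.
  obtain ⟨μ, hμ, Φ, hp₀⟩ := hloc p₀
  refine ⟨μ, hμ, Φ, fun V hV => ?_⟩
  obtain ⟨Z, R, hZR, hZ⟩ := Austere.isAnalyticRetract_helicoid μ Φ
  rw [← hZ] at hp₀ ⊢
  refine hF.exists_isOpen_image_eq hZR (hF.forall_mem_range hZR (fun p => ?_) hp₀) hV
  obtain ⟨μ', -, Φ', h'⟩ := hloc p
  obtain ⟨Z', R', hZR', hZ'⟩ := Austere.isAnalyticRetract_helicoid μ' Φ'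
  exact ⟨Z', R', hZR', hZ' ▸ h'⟩
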